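/- Let $t\in\mathbb{C}\setminus\mathbb{Z}$. The oriented Brauer category with parameter $t$ is the $\mathbb{C}$-linear monoidal category whose objects are the words in the letters $\uparrow,\downarrow$, with tensor product of objects given by concatenation, and whose morphisms $v\to w$ are the formal $\mathbb{C}$-linear combinations of oriented Brauer diagrams, i.e. of orientation-compatible perfect matchings of the letters of $v$ (bottom) and $w$ (top). Diagrams are composed by stacking them and replacing each closed loop by the factor $t$. Let $X=\uparrow\downarrow$, and let $b_n$ be the number of indecomposable summands, counted with multiplicity, of $X^{\otimes n}$ in the additive Karoubi envelope (the idempotent completion of the additive envelope) of this category. For $m\ge 0$ let $cd(m)$ be the sum of the dimensions of the (finitely many) irreducible complex representations of the symmetric group $S_m$, up to isomorphism. Then: 1. $cd(m)=\#\{\sigma\in S_m:\sigma^2=1\}$ for all $m\ge 0$. 2. For every $n\ge 0$ the number $b_n$ is well defined: $X^{\otimes n}$ is a finite direct sum of indecomposable objects, and every such decomposition has the same number of summands. 3. For every $n\ge 0$, $$b_n=\sum_{k=0}^{n}cd(k)^2\binom{n}{k}^2(n-k)!=cd(2n).$$ 4. As $n\to\infty$, $$b_n\sim n^n\,2^{n-1/2}\exp\Bigl(-n+\sqrt{2n}-\tfrac14\Bigr)\Bigl(1+\frac{7}{24\sqrt{2n}}\Bigr),$$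 where $\sim$ means that the quotient of the two sides tends to $1$. Moreover, the last factor is the correct second-order term: $$\frac{b_n}{n^n\,2^{n-1/2}\exp(-n+\sqrt{2n}-1/4)}=1+\frac{7}{24\sqrt{2n}}+o\bigl(n^{-1/2}\bigr).$$ 5. As $n\to\infty$, $\sqrt[n]{b_n}\sim\frac{2}{e}\,n$. -/

import Mathlib

open CategoryTheory CategoryTheory.Limits

namespace OrientedBrauer

/-! ### Gluing strands -/

section Gluing

variable {A B U : Type} (h : A ⊕ U ≃ B ⊕ U)

/-- Given a bijection `h : A ⊕ U ≃ B ⊕ U`, think of each `x : A ⊕ U` as the starting point of a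
strand ending at `h x`, and glue every end point in `U` to the corresponding starting point.
`Leads h x b` says that following the glued strands from `x` one comes out at `b`. -/
inductive Leads : A ⊕ U → B → Prop
  | done {x : A ⊕ U} {b : B} : h x = Sum.inl b → Leads x b
  | step {x : A ⊕ U} {u : U} {b : B} : h x = Sum.inr u → Leads (Sum.inr u) b → Leads x b

/-- Two glued points are joined by a strand. -/
def Joined (u v : U) : Prop := h (Sum.inr u) = Sum.inr v

/-- The number of closed loops created by gluing: connected components of the set of glued points
in which no strand leaves to `B`. -/
noncomputable def loopCount : ℕ :=
  Nat.card {c : Quot (Joined h) // ∀ u, Quot.mk _ u = c → ∃ v, h (Sum.inr u) = Sum.inr v}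

variable {h}

theorem Leads.unique {x : A ⊕ U} {b b' : B} (p : Leads h x b) (q : Leads h x b') : b = b' := by
  induction p with
  | done e =>
    cases q with
    | done e' => exact Sum.inl.inj (e.symm.trans e')
    | step e' _ => exact absurd (e.symm.trans e') (by simp)
  | step e _ ih =>
    cases q with
    | done e' => exact absurd (e.symm.trans e') (by simp)
    | step e' q' =>
      obtain rfl := Sum.inr.inj (e.symm.trans e')
      exact ih q'

variable (h)

theorem exists_leads [Finite A] [Finite U] (a : A) : ∃ b, Leads h (Sum.inl a) b := by
  by_contra hn
  let N := {x : A ⊕ U // ¬ ∃ b, Leads h x b}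
  have key : ∀ x : N, ∃ y : N, ∃ u, y.1 = Sum.inr u ∧ h x.1 = Sum.inr u := by
    rintro ⟨x, hx⟩
    change ∃ y : N, ∃ u, y.1 = Sum.inr u ∧ h x = Sum.inr u
    obtain ⟨z, e⟩ : ∃ z, h x = z := ⟨_, rfl⟩
    rcases z with b | u
    · exact absurd ⟨b, Leads.done e⟩ hx
    · exact ⟨⟨Sum.inr u, fun ⟨b, hb⟩ => hx ⟨b, Leads.step e hb⟩⟩, u, rfl, e⟩
  choose φ w hw hφ using key
  have inj : Function.Injective φ := by
    intro x y hxy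
    have h1 : w x = w y := Sum.inr.inj ((hw x).symm.trans ((congrArg Subtype.val hxy).trans (hw y)))
    exact Subtype.ext (h.injective (by rw [hφ, hφ, h1]))
  obtain ⟨y, hy⟩ := (Finite.injective_iff_surjective.mp inj) ⟨Sum.inl a, hn⟩
  have := hw y
  rw [hy] at this
  simp at this

variable {h}

theorem Leads.reverse_aux {x : A ⊕ U} {b : B} (p : Leads h x b) {a : A}
    (q : Leads h.symm (h x) a) : Leads h.symm (Sum.inl b) a := by
  induction p with
  | done e => rwa [e] at q
  | step e _ ih =>
    rw [e] at q
    exact ih (Leads.step (h.symm_apply_apply _) q)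

theorem Leads.reverse {a : A} {b : B} (p : Leads h (Sum.inl a) b) :
    Leads h.symm (Sum.inl b) a :=
  p.reverse_aux (Leads.done (h.symm_apply_apply _))

variable (h)

/-- The bijection `A ≃ B` obtained by following the glued strands until they come out. -/
noncomputable def contract [Finite A] [Finite B] [Finite U] : A ≃ B where
  toFun a := (exists_leads h a).choose
  invFun b := (exists_leads h.symm b).choose
  left_inv a := (exists_leads h.symm _).choose_spec.unique (exists_leads h a).choose_spec.reverse
  right_inv b := (exists_leads h _).choose_spec.unique (exists_leads h.symm b).choose_spec.reverse

theorem leads_contract [Finite A] [Finite B] [Finite U] (a : A) :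
    Leads h (Sum.inl a) (contract h a) := (exists_leads h a).choose_spec

/-! Counting two-colourings of the glued points. -/

/-- Colourings of the glued points that, together with the given colours of the free end points,
are constant along strands. -/
def Colouring (α : A → Bool) (β : B → Bool) : Type :=
  {c : U → Bool // ∀ x, Sum.elim β c (h x) = Sum.elim α c x}

variable {h}

theorem Leads.colour {α : A → Bool} {β : B → Bool} {c : U → Bool}
    (hc : ∀ x, Sum.elim β c (h x) = Sum.elim α c x) {x : A ⊕ U} {b : B} (p : Leads h x b) :
    Sum.elim α c x = β b := by
  induction p with
  | done e => rw [← hc, e]; rfl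
  | step e _ ih => rw [← hc, e]; exact ih

theorem leads_iff_of_eq {x : A ⊕ U} {u : U} (e : h x = Sum.inr u) {b : B} :
    Leads h x b ↔ Leads h (Sum.inr u) b := by
  refine ⟨fun p => ?_, Leads.step e⟩
  cases p with
  | done e' => exact absurd (e.symm.trans e') (by simp)
  | step e' q => exact Sum.inr.inj (e'.symm.trans e) ▸ q

theorem leads_iff_of_mk_eq {u v : U} (e : Quot.mk (Joined h) u = Quot.mk _ v) (b : B) :
    Leads h (Sum.inr u) b ↔ Leads h (Sum.inr v) b := by
  have := congrArg (Quot.lift (fun u => Leads h (Sum.inr u) b)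
    fun u v (huv : Joined h u v) => propext (leads_iff_of_eq huv)) e
  exact iff_of_eq this

theorem closed_iff {u : U} :
    (∀ v, Quot.mk (Joined h) v = Quot.mk _ u → ∃ w, h (Sum.inr v) = Sum.inr w) ↔
      ¬ ∃ b, Leads h (Sum.inr u) b := by
  constructor
  · rintro H ⟨b, p⟩
    have gen : ∀ x b, Leads h x b → ∀ v, x = Sum.inr v → Quot.mk (Joined h) v = Quot.mk _ u →
        False := by
      intro x b q
      clear p
      induction q with
      | done e =>
        rintro v rfl hv
        obtain ⟨w, hw⟩ := H v hv
        exact absurd (e.symm.trans hw) (by simp)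
      | @step x w b e _ ih =>
        rintro v rfl hv
        exact ih w rfl ((Quot.sound (r := Joined h) e).symm.trans hv)
    exact gen _ _ p u rfl rfl
  · intro H v hv
    obtain ⟨z, e⟩ : ∃ z, h (Sum.inr v) = z := ⟨_, rfl⟩
    rcases z with b | w
    · exact absurd ⟨b, (leads_iff_of_mk_eq hv b).1 (Leads.done e)⟩ H
    · exact ⟨w, e⟩

variable (h)

open Classical in
theorem card_colouring [Finite A] [Finite B] [Finite U] (α : A → Bool) (β : B → Bool) :
    Nat.card (Colouring h α β) = if ∀ a, β (contract h a) = α a then 2 ^ loopCount h else 0 := by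
  split_ifs with H
  · rw [loopCount]
    have hb : (2 : ℕ) = Nat.card Bool := by simp
    rw [hb, ← Nat.card_fun]
    refine Nat.card_eq_of_bijective
      (fun c l => Quot.lift c.1 (fun u v (e : Joined h u v) => by
        have := c.2 (Sum.inr u)
        rw [e] at this
        exact this.symm) l.1) ⟨?_, ?_⟩
    · rintro ⟨c, hc⟩ ⟨c', hc'⟩ e
      refine Subtype.ext (funext fun u => ?_)
      by_cases p : ∃ b, Leads h (Sum.inr u) b
      · obtain ⟨b, p⟩ := p
        exact (p.colour hc).trans (p.colour hc').symm
      · exact congrFun e ⟨Quot.mk _ u, closed_iff.2 p⟩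
    · intro f
      let col (u : U) : Bool :=
        if p : ∃ b, Leads h (Sum.inr u) b then β p.choose else f ⟨Quot.mk _ u, closed_iff.2 p⟩
      have col_pos : ∀ {u b}, Leads h (Sum.inr u) b → col u = β b := by
        intro u b p
        have q : ∃ b, Leads h (Sum.inr u) b := ⟨b, p⟩
        simp only [col, dif_pos q]
        rw [q.choose_spec.unique p]
      have col_neg : ∀ {u} (p : ¬ ∃ b, Leads h (Sum.inr u) b),
          col u = f ⟨Quot.mk _ u, closed_iff.2 p⟩ := by
        intro u p
        simp only [col, dif_neg p]
      refine ⟨⟨col, fun x => ?_⟩, ?_⟩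
      · obtain ⟨z, e⟩ : ∃ z, h x = z := ⟨_, rfl⟩
        rw [e]
        rcases z with b | v
        · rcases x with a | u
          · change β b = α a
            rw [← H a, (leads_contract h a).unique (Leads.done e)]
          · exact (col_pos (Leads.done e)).symm
        · rcases x with a | u
          · exact (col_pos ((leads_iff_of_eq e).1 (leads_contract h a))).trans (H a)
          · change col v = col u
            by_cases p : ∃ b, Leads h (Sum.inr u) b
            · obtain ⟨b, p⟩ := p
              rw [col_pos p, col_pos ((leads_iff_of_eq e).1 p)]
            · have p' : ¬ ∃ b, Leads h (Sum.inr v) b :=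
                fun ⟨b, q⟩ => p ⟨b, (leads_iff_of_eq e).2 q⟩
              rw [col_neg p, col_neg p']
              congr 2
              exact (Quot.sound (r := Joined h) e).symm
      · funext ⟨l, hl⟩
        induction l using Quot.ind with
        | mk u => exact col_neg (closed_iff.1 hl)
  · rw [Nat.card_eq_zero]
    left
    constructor
    rintro ⟨c, hc⟩
    exact H fun a => ((leads_contract h a).colour hc).symm

end Gluing

/-! ### Oriented Brauer diagrams -/

/-- The two generating objects `↑` and `↓`. -/
inductive Letter
  | up
  | down
  deriving DecidableEq

open Letter

/-- The positions of the word `w` carrying the letter `o`. -/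
abbrev Pt (w : List Letter) (o : Letter) : Type := {i : Fin w.length // w.get i = o}

/-- An oriented Brauer diagram from the word `v` (at the bottom) to the word `w` (at the top):
a perfect matching of the boundary points by oriented strands. A strand starts at an `↑` at the
bottom or at a `↓` at the top, and ends at a `↓` at the bottom or at an `↑` at the top; so such a
matching is a bijection from the set of starting points to the set of end points. -/
abbrev Diagram (v w : List Letter) : Type := Pt v up ⊕ Pt w down ≃ Pt v down ⊕ Pt w up

namespace Diagram

variable {u v w x : List Letter}

/-- The identity diagram: all strands are vertical. -/
def id (w : List Letter) : Diagram w w := Equiv.sumComm _ _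

/-- The strands of two stacked diagrams (`f` below `g`), where the points of the middle word are
kept separate from the other boundary points. -/
def stack (f : Diagram u v) (g : Diagram v w) :
    (Pt u up ⊕ Pt w down) ⊕ (Pt v down ⊕ Pt v up) ≃
      (Pt u down ⊕ Pt w up) ⊕ (Pt v down ⊕ Pt v up) :=
  (Equiv.sumSumSumComm _ _ _ _).trans <|
    (f.sumCongr ((Equiv.sumComm _ _).trans g)).trans <|
      (((Equiv.refl _).sumCongr (Equiv.sumComm _ _)).trans (Equiv.sumSumSumComm _ _ _ _)).trans
        ((Equiv.refl _).sumCongr (Equiv.sumComm _ _))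

/-- The diagram obtained by stacking `g` on top of `f`, with the closed loops removed. -/
noncomputable def comp (f : Diagram u v) (g : Diagram v w) : Diagram u w := contract (stack f g)

/-- The number of closed loops created by stacking `g` on top of `f`. -/
noncomputable def loops (f : Diagram u v) (g : Diagram v w) : ℕ := loopCount (stack f g)

/-! The composition of diagrams is associative and unital, including the number of loops. To see
this we compare diagrams with their matrices, indexed by two-colourings of the words. -/

/-- Two-colourings of the letters of a word. -/
abbrev Col (w : List Letter) : Type := (Pt w up → Bool) × (Pt w down → Bool)

/-- Both boundary colourings together are constant along the strands of `f`. -/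
def Compat (f : Diagram v w) (c : Col v) (d : Col w) : Prop :=
  ∀ s, Sum.elim c.2 d.1 (f s) = Sum.elim c.1 d.2 s

open Classical in
/-- The matrix of a diagram. -/
noncomputable def mat (f : Diagram v w) : Matrix (Col v) (Col w) ℕ :=
  Matrix.of fun c d => if f.Compat c d then 1 else 0

theorem compat_id (c d : Col w) : (id w).Compat c d ↔ c = d := by
  constructor
  · intro h
    refine Prod.ext (funext fun p => ?_) (funext fun p => ?_)
    · exact (h (Sum.inl p)).symm
    · exact h (Sum.inr p)
  · rintro rfl (s | s) <;> rfl

theorem stack_compat (f : Diagram u v) (g : Diagram v w) (c : Col u) (e : Col w) (d : Col v) :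
    (∀ x, Sum.elim (Sum.elim c.2 e.1) (Sum.elim d.2 d.1) (stack f g x) =
      Sum.elim (Sum.elim c.1 e.2) (Sum.elim d.2 d.1) x) ↔ f.Compat c d ∧ g.Compat d e := by
  have hf : ∀ z : Pt u down ⊕ Pt v up, Sum.elim (Sum.elim c.2 e.1) (Sum.elim d.2 d.1)
      (((Equiv.refl _).sumCongr (Equiv.sumComm _ _)) ((Equiv.sumSumSumComm _ _ _ _)
        ((((Equiv.refl _).sumCongr (Equiv.sumComm _ _))) (Sum.inl z)))) = Sum.elim c.2 d.1 z := by
    rintro (z | z) <;> rfl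
  have hg : ∀ z : Pt v down ⊕ Pt w up, Sum.elim (Sum.elim c.2 e.1) (Sum.elim d.2 d.1)
      (((Equiv.refl _).sumCongr (Equiv.sumComm _ _)) ((Equiv.sumSumSumComm _ _ _ _)
        ((((Equiv.refl _).sumCongr (Equiv.sumComm _ _))) (Sum.inr z)))) = Sum.elim d.2 e.1 z := by
    rintro (z | z) <;> rfl
  constructor
  · intro H
    refine ⟨?_, ?_⟩
    · rintro (s | s)
      · exact (hf _).symm.trans (H (Sum.inl (Sum.inl s)))
      · exact (hf _).symm.trans (H (Sum.inr (Sum.inl s)))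
    · rintro (s | s)
      · exact (hg _).symm.trans (H (Sum.inr (Sum.inr s)))
      · exact (hg _).symm.trans (H (Sum.inl (Sum.inr s)))
  · rintro ⟨Hf, Hg⟩ ((s | s) | (s | s))
    · exact (hf _).trans (Hf (Sum.inl s))
    · exact (hg _).trans (Hg (Sum.inr s))
    · exact (hf _).trans (Hf (Sum.inr s))
    · exact (hg _).trans (Hg (Sum.inl s))

theorem mat_id (w : List Letter) : mat (id w) = 1 := by
  classical
  ext c d
  simp only [mat, Matrix.of_apply, compat_id, Matrix.one_apply]

theorem mat_mul (f : Diagram u v) (g : Diagram v w) :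
    mat f * mat g = 2 ^ loops f g • mat (comp f g) := by
  classical
  ext c e
  have h := card_colouring (stack f g) (Sum.elim c.1 e.2) (Sum.elim c.2 e.1)
  have h2 : Nat.card (Colouring (stack f g) (Sum.elim c.1 e.2) (Sum.elim c.2 e.1)) =
      Nat.card {d : Col v // f.Compat c d ∧ g.Compat d e} := by
    refine Nat.card_congr (Equiv.subtypeEquiv
      ((Equiv.sumArrowEquivProdArrow _ _ _).trans (Equiv.prodComm _ _)) fun k => ?_)
    rw [← stack_compat]
    have : Sum.elim (fun p => k (Sum.inl p)) (fun p => k (Sum.inr p)) = k := by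
      funext p; rcases p with p | p <;> rfl
    change _ ↔ ∀ x, Sum.elim (Sum.elim c.2 e.1)
      (Sum.elim (fun p => k (Sum.inl p)) (fun p => k (Sum.inr p))) _ = Sum.elim _
      (Sum.elim (fun p => k (Sum.inl p)) (fun p => k (Sum.inr p))) x
    rw [this]
  rw [h2, Nat.card_eq_fintype_card, Fintype.card_subtype] at h
  simp only [Matrix.mul_apply, mat, Matrix.of_apply, Matrix.smul_apply, smul_eq_mul, mul_ite,
    mul_one, mul_zero, ← ite_and, Finset.sum_boole]
  rw [Nat.cast_id]
  simp only [and_comm (a := g.Compat _ _)]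
  exact h

theorem mat_injective {f g : Diagram v w} {k l : ℕ} (h : 2 ^ k • mat f = 2 ^ l • mat g) :
    f = g ∧ k = l := by
  classical
  have hkl : k = l := by
    have := congrFun (congrFun h (fun _ => true, fun _ => true)) (fun _ => true, fun _ => true)
    have t : ∀ f : Diagram v w,
        f.Compat (fun _ => true, fun _ => true) (fun _ => true, fun _ => true) := by
      intro f s
      rcases s with s | s <;> rcases f _ with t | t <;> rfl
    simp only [mat, Matrix.smul_apply, Matrix.of_apply, t, if_true, smul_eq_mul, mul_one] at this
    exact Nat.pow_right_injective le_rfl this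
  subst hkl
  refine ⟨Equiv.ext fun s => ?_, rfl⟩
  let β : Pt v down ⊕ Pt w up → Bool := fun z => decide (z = f s)
  let α : Pt v up ⊕ Pt w down → Bool := fun z => β (f z)
  let c : Col v := (fun p => α (Sum.inl p), fun p => β (Sum.inl p))
  let d : Col w := (fun p => β (Sum.inr p), fun p => α (Sum.inr p))
  have hβ : Sum.elim c.2 d.1 = β := by funext z; rcases z with z | z <;> rfl
  have hα : Sum.elim c.1 d.2 = α := by funext z; rcases z with z | z <;> rfl
  have hf : f.Compat c d := by intro z; rw [hβ, hα]
  have := congrFun (congrFun h c) d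
  simp only [mat, Matrix.smul_apply, Matrix.of_apply, hf, if_true, smul_eq_mul, mul_one] at this
  have hg : g.Compat c d := by
    by_contra hn
    simp [hn] at this
  have := hg s
  rw [hβ, hα] at this
  simpa [α, β, eq_comm] using this

theorem id_comp (f : Diagram v w) : comp (id v) f = f ∧ loops (id v) f = 0 := by
  refine mat_injective ?_
  rw [← mat_mul, mat_id, Matrix.one_mul, pow_zero, one_smul]

theorem comp_id (f : Diagram v w) : comp f (id w) = f ∧ loops f (id w) = 0 := by
  refine mat_injective ?_
  rw [← mat_mul, mat_id, Matrix.mul_one, pow_zero, one_smul]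

theorem assoc (f : Diagram u v) (g : Diagram v w) (k : Diagram w x) :
    comp (comp f g) k = comp f (comp g k) ∧
      loops f g + loops (comp f g) k = loops g k + loops f (comp g k) := by
  refine mat_injective ?_
  rw [pow_add, pow_add, mul_smul, mul_smul, ← mat_mul, ← mat_mul, ← Matrix.smul_mul,
    ← Matrix.mul_smul, ← mat_mul, ← mat_mul, Matrix.mul_assoc]

end Diagram

/-! ### The oriented Brauer category -/

/-- Objects of the oriented Brauer category with parameter `t` over `k`: words in `↑` and `↓`. -/
@[ext]
structure OBrauer (k : Type) [CommRing k] (t : k) where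
  /-- the underlying word -/
  word : List Letter

namespace OBrauer

variable {k : Type} [CommRing k] {t : k}

/-- Vertical composition, extended bilinearly from diagrams: stack the diagrams, remove the closed
loops, and multiply by `t` for each of them. -/
noncomputable def compLin (t : k) (u v w : List Letter) :
    (Diagram u v →₀ k) →ₗ[k] (Diagram v w →₀ k) →ₗ[k] (Diagram u w →₀ k) :=
  Finsupp.linearCombination k fun f => Finsupp.linearCombination k fun g =>
    t ^ f.loops g • Finsupp.single (f.comp g) (1 : k)

theorem compLin_single {u v w : List Letter} (f : Diagram u v) (g : Diagram v w) (a b : k) :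
    compLin t u v w (Finsupp.single f a) (Finsupp.single g b) =
      Finsupp.single (f.comp g) (a * b * t ^ f.loops g) := by
  simp only [compLin, Finsupp.linearCombination_single, LinearMap.smul_apply, Finsupp.smul_single,
    smul_eq_mul, mul_one, mul_assoc]

/-- Morphisms are formal `k`-linear combinations of oriented Brauer diagrams. -/
noncomputable instance : Category (OBrauer k t) where
  Hom X Y := Diagram X.word Y.word →₀ k
  id X := Finsupp.single (Diagram.id X.word) 1
  comp f g := compLin t _ _ _ f g
  id_comp {X Y} f := by
    induction f using Finsupp.induction_linear with
    | zero => simp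
    | add f g hf hg => rw [map_add, hf, hg]
    | single d a =>
      rw [compLin_single, (Diagram.id_comp d).1, (Diagram.id_comp d).2]; simp
  comp_id {X Y} f := by
    induction f using Finsupp.induction_linear with
    | zero => simp
    | add f g hf hg => rw [map_add, LinearMap.add_apply, hf, hg]
    | single d a =>
      rw [compLin_single, (Diagram.comp_id d).1, (Diagram.comp_id d).2]; simp
  assoc {W X Y Z} f g h := by
    induction f using Finsupp.induction_linear with
    | zero => simp
    | add f f' hf hf' => simp only [map_add, LinearMap.add_apply, hf, hf']
    | single d a =>
    induction g using Finsupp.induction_linear with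
    | zero => simp
    | add g g' hg hg' => simp only [map_add, LinearMap.add_apply, hg, hg']
    | single e b =>
    induction h using Finsupp.induction_linear with
    | zero => simp
    | add h h' hh hh' => simp only [map_add, hh, hh']
    | single f c =>
      simp only [compLin_single, (Diagram.assoc d e f).1]
      congr 1
      have := congrArg (t ^ ·) (Diagram.assoc d e f).2
      simp only [pow_add] at this
      linear_combination (a * b * c) * this

noncomputable instance : Preadditive (OBrauer k t) where
  homGroup X Y := inferInstanceAs (AddCommGroup (Diagram X.word Y.word →₀ k))
  add_comp X Y Z f f' g := LinearMap.map_add₂ (compLin t X.word Y.word Z.word) f f' g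
  comp_add X Y Z f g g' := (compLin t X.word Y.word Z.word f).map_add g g'

noncomputable instance : Linear k (OBrauer k t) where
  homModule X Y := inferInstanceAs (Module k (Diagram X.word Y.word →₀ k))
  smul_comp X Y Z r f g := LinearMap.map_smul₂ (compLin t X.word Y.word Z.word) r f g
  comp_smul X Y Z f r g := (compLin t X.word Y.word Z.word f).map_smul r g

/-- The tensor product of objects is concatenation of words. -/
def tensor (X Y : OBrauer k t) : OBrauer k t := ⟨X.word ++ Y.word⟩

/-- The tensor unit is the empty word. -/
def one : OBrauer k t := ⟨[]⟩

/-- The tensor powers `X^{⊗ n}` of an object. -/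
def tensorPow (X : OBrauer k t) : ℕ → OBrauer k t
  | 0 => one
  | n + 1 => tensor (tensorPow X n) X

end OBrauer

/-- The additive Karoubi envelope of the oriented Brauer category: the idempotent completion of its
additive envelope. -/
abbrev OBrauerKar (k : Type) [CommRing k] (t : k) : Type 1 :=
  Idempotents.Karoubi (Mat_ (OBrauer k t))

/-- The embedding of the oriented Brauer category into its additive Karoubi envelope. -/
noncomputable def toKar (k : Type) [CommRing k] (t : k) : OBrauer k t ⥤ OBrauerKar k t :=
  Mat_.embedding _ ⋙ Idempotents.toKaroubi _

/-- The object `↑↓`. -/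
def upDown (k : Type) [CommRing k] (t : k) : OBrauer k t := ⟨[Letter.up, Letter.down]⟩

end OrientedBrauer

/-- `X` is a direct sum of `m` indecomposable objects. -/
def IsSumOfIndecomposables {C : Type*} [Category C] [Preadditive C]
    [HasFiniteBiproducts C] (X : C) (m : ℕ) : Prop :=
  haveI : HasBinaryBiproducts C := hasBinaryBiproducts_of_finite_biproducts C
  ∃ F : Fin m → C, (∀ i, Indecomposable (F i)) ∧ Nonempty (X ≅ ⨁ F)

/-- The isomorphism classes of irreducible finite-dimensional complex representations of the
symmetric group on `m` letters. -/
def SymIrrep (m : ℕ) : Type 1 :=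
  {c : Quotient (isIsomorphicSetoid (FDRep ℂ (Equiv.Perm (Fin m)))) // Simple c.out}

/-- The sum of the dimensions of the irreducible complex representations of the symmetric group on
`m` letters. -/
noncomputable def cd (m : ℕ) : ℕ := ∑ᶠ c : SymIrrep m, Module.finrank ℂ c.1.out

/-!
# Indecomposable summands of tensor powers in the oriented Brauer category

All counts in the theorem are numbers of involutions. Let `A` be a finite-dimensional complex
algebra with a linear anti-involution `τ`, and suppose that `1 ∈ A` is a sum of `n` orthogonal
idempotents `p` with `τ p = p` and `p A p = ℂ p` (`SymSplit τ n 1`). On the Peirce decomposition of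
`A` the trace of `τ` is `n`. If `τ` permutes a basis, then `n` is the number of fixed basis elements
(`SymSplit.eq_card_fixed`). This applies to two kinds of algebras.

*Group algebras of symmetric groups*, with `τ` the inversion. A permutation of `α ∪ {∗}` is
conjugate to its inverse by a permutation of `α`. Hence, for a symmetric minimal idempotent `p` of
`ℂ[S_α]`, averaging over `S_α` shows that all elements of `p ℂ[S_{α ∪ ∗}] p` are symmetric. So this
algebra is commutative, and `p` splits further (`exists_symSplit_of_conj`). By induction, `1` splits
in the group algebra of `S_a × S_b`. Each of the idempotents has rank one on a single irreducible
representation, so the dimensions of the irreducible representations of `S_m` add up to the number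
of involutions (`cd_eq_card_involutions`).

*Endomorphism algebras of the tensor powers of `X = ↑↓`*, with `τ` the flip of diagrams. The trace
that closes up a diagram is nondegenerate for `t ∉ ℤ`: on diagrams its form is the matrix
`t ^ (number of cycles of ψ φ)` over permutations, and the element `∑ t ^ (number of cycles of σ) σ`
is a product of factors `t + J` with `J` a Jucys–Murphy element, all of whose eigenvalues are
integers (`loopElement_injective`). By induction on `n`, the endomorphism algebra of `X ^ n` splits
into symmetric minimal idempotents. The ideal of morphisms through `X ^ (n - 1)` is dealt with by a
symmetric bilinear form that is nonzero by nondegeneracy (`TracedDagger.exists_unit_through`), and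
modulo this ideal there remain the permutations, so the group algebra of `S_n × S_n`
(`TracedDagger.exists_symSplit_of_through`). The number of idempotents is the number of diagrams
fixed by the flip, which is the number of involutions of `2 n` letters. By nondegeneracy of the
trace the algebra is semisimple, and in the Karoubi envelope the number of indecomposable summands
is the number of these idempotents (`isSumOfIndecomposables_iff`).

Sorting the involutions of `n + n` letters by the number of two-cycles that join the two halves
gives the sum formula (`numInvolutions_add`).

For the asymptotics, put `x = √(2 n)`. Sorting by the number `2 k` of fixed points, the number of
involutions of `2 n` letters is `(2 n)! / (2 ^ n n!)` times the sum over `k` of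
`x ^ (2 k) / (2 k)! * W k`, where `W k = ∏ i < k, (1 - i / n)`. The weights concentrate at
`2 k ≈ x`, and in terms of `D = (2 k - x) / x` one has
`W k = exp (-1 / 4) * (1 - D / 2 - D ^ 2 / 8 + 5 / (12 x))` up to terms of smaller order
(`exists_abs_descFactorial_sub_le`). The moments of `D` are explicit in `cosh x` and `sinh x`: the
mean is negligible and the mean of `D ^ 2` is `1 / x`, so the sum is
`exp (x - 1 / 4) / 2 * (1 + 7 / (24 x) + O(x ^ (-3 / 2)))` (`exists_abs_numInvolutions_sub_le`).
Stirling's formula with an error term of order `1 / n` gives the prefactor.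
-/

/-! ### Symmetric minimal idempotents -/

/-- A linear anti-involution of a complex algebra. -/
structure AntiInvolution (A : Type*) [Ring A] [Algebra ℂ A] where
  /-- the underlying linear map -/
  map : A →ₗ[ℂ] A
  map_mul : ∀ a b, map (a * b) = map b * map a
  map_map : ∀ a, map (map a) = a

section Symmetric

variable {A : Type*} [Ring A] [Algebra ℂ A]

/-- A nonzero idempotent `p` fixed by the anti-involution `τ` and with `p A p = ℂ p`. -/
structure MinSym (τ : AntiInvolution A) (p : A) : Prop where
  ne_zero : p ≠ 0
  idem : p * p = p
  fixed : τ.map p = p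
  scalar : ∀ a, ∃ c : ℂ, p * a * p = c • p

/-- `SymSplit τ n e`: the element `e` is a sum of `n` pairwise orthogonal minimal idempotents, each
of them fixed by `τ`. -/
inductive SymSplit (τ : AntiInvolution A) : ℕ → A → Prop
  | zero : SymSplit τ 0 0
  | add {n : ℕ} {e p : A} : SymSplit τ n e → MinSym τ p → e * p = 0 → p * e = 0 →
      SymSplit τ (n + 1) (e + p)

variable {τ : AntiInvolution A}

theorem MinSym.symSplit {p : A} (h : MinSym τ p) : SymSplit τ 1 p := by
  simpa using SymSplit.zero.add h (zero_mul p) (mul_zero p)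

namespace SymSplit

variable {n m : ℕ} {e f : A}

theorem idem (h : SymSplit τ n e) : e * e = e := by
  induction h with
  | zero => simp
  | add _ hp h1 h2 ih => rw [mul_add, add_mul, add_mul, ih, h1, h2, hp.idem]; simp

theorem fixed (h : SymSplit τ n e) : τ.map e = e := by
  induction h with
  | zero => simp
  | add _ hp _ _ ih => rw [map_add, ih, hp.fixed]

theorem add_split (he : SymSplit τ n e) (hf : SymSplit τ m f) (h1 : e * f = 0) (h2 : f * e = 0) :
    SymSplit τ (n + m) (e + f) := by
  induction hf with
  | zero => simpa using he
  | @add m f p hf hp h3 h4 ih =>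
    have h5 : p * (f + p) = p := by rw [mul_add, h4, hp.idem, zero_add]
    have h6 : (f + p) * p = p := by rw [add_mul, h3, hp.idem, zero_add]
    have h7 : e * p = 0 := by rw [← h6, ← mul_assoc, h1, zero_mul]
    have h8 : p * e = 0 := by rw [← h5, mul_assoc, h2, mul_zero]
    have h9 : e * f = 0 := by rwa [mul_add, h7, add_zero] at h1
    have h10 : f * e = 0 := by rwa [add_mul, h8, add_zero] at h2
    rw [← add_assoc, ← add_assoc]
    exact (ih h9 h10).add hp (by rw [add_mul, h7, h3, add_zero]) (by rw [mul_add, h8, h4, add_zero])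

/-- `e` as the sum of a family of orthogonal symmetric minimal idempotents. -/
theorem exists_family (h : SymSplit τ n e) : ∃ p : Fin n → A, (∀ i, MinSym τ (p i)) ∧
    (∀ i j, i ≠ j → p i * p j = 0) ∧ ∑ i, p i = e := by
  induction h with
  | zero => exact ⟨Fin.elim0, fun i => i.elim0, fun i => i.elim0, by simp⟩
  | @add n e q he hq h1 h2 ih =>
    obtain ⟨p, hp, ho, hs⟩ := ih
    have hpe : ∀ i, p i * e = p i := fun i => by
      rw [← hs, Finset.mul_sum, Finset.sum_eq_single i (fun j _ hj => ho i j hj.symm) (by simp),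
        (hp i).idem]
    have hep : ∀ i, e * p i = p i := fun i => by
      rw [← hs, Finset.sum_mul, Finset.sum_eq_single i (fun j _ hj => ho j i hj) (by simp),
        (hp i).idem]
    refine ⟨Fin.snoc p q, fun i => ?_, fun i j => ?_, ?_⟩
    · induction i using Fin.lastCases with
      | last => simpa using hq
      | cast i => simpa using hp i
    · induction i using Fin.lastCases with
      | last =>
        induction j using Fin.lastCases with
        | last => simp
        | cast j => intro _; simp only [Fin.snoc_last, Fin.snoc_castSucc]
                    rw [← hep, ← mul_assoc, h2, zero_mul]
      | cast i =>
        induction j using Fin.lastCases with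
        | last => intro _; simp only [Fin.snoc_last, Fin.snoc_castSucc]
                  rw [← hpe, mul_assoc, h1, mul_zero]
        | cast j => intro hij; simpa using ho i j (by simpa using hij)
    · simp [Fin.sum_univ_castSucc, hs]

theorem le_finrank [FiniteDimensional ℂ A] (h : SymSplit τ n e) : n ≤ Module.finrank ℂ A := by
  obtain ⟨p, hp, ho, -⟩ := h.exists_family
  have : LinearIndependent ℂ p := by
    rw [Fintype.linearIndependent_iff]
    intro g hg i
    have := congrArg (p i * ·) hg
    simp only [Finset.mul_sum, mul_smul_comm, mul_zero] at this
    rw [Finset.sum_eq_single i (fun j _ hj => by rw [ho i j hj.symm, smul_zero]) (by simp),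
      (hp i).idem] at this
    exact (smul_eq_zero.1 this).resolve_right (hp i).ne_zero
  simpa using this.fintype_card_le_finrank

end SymSplit

/-- The linear map `x ↦ a x b`. -/
def sandwich (a b : A) : A →ₗ[ℂ] A := LinearMap.mulLeft ℂ a ∘ₗ LinearMap.mulRight ℂ b

@[simp] theorem sandwich_apply (a b x : A) : sandwich a b x = a * (x * b) := rfl

/-- For orthogonal symmetric idempotents `e`, `p` the map `x ↦ τ (e x p)` takes `e A p` to `p A e`,
so it has trace zero. -/
theorem trace_sandwich_eq_zero {e p : A} (he : e * e = e) (hp : p * p = p) (h : e * p = 0)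
    (hτe : τ.map e = e) (hτp : τ.map p = p) :
    LinearMap.trace ℂ A (τ.map ∘ₗ sandwich e p) = 0 := by
  have h1 : τ.map ∘ₗ sandwich e p = (τ.map ∘ₗ sandwich e p) * sandwich e p := by
    ext x
    simp only [Module.End.mul_apply, LinearMap.comp_apply, sandwich_apply]
    rw [show e * (e * (x * p) * p) = (e * e) * x * (p * p) by noncomm_ring, he, hp, mul_assoc]
  have h2 : sandwich e p * (τ.map ∘ₗ sandwich e p) = 0 := by
    ext x
    simp only [Module.End.mul_apply, LinearMap.comp_apply, sandwich_apply, τ.map_mul, hτe, hτp]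
    rw [show e * (p * τ.map x * e * p) = (e * p) * τ.map x * (e * p) by noncomm_ring, h]
    simp
  rw [h1, LinearMap.trace_mul_comm, h2, map_zero]

/-- The anti-involution has trace one on `p A p`, since it is the identity on `ℂ p`. -/
theorem MinSym.trace_sandwich [FiniteDimensional ℂ A] {p : A} (h : MinSym τ p) :
    LinearMap.trace ℂ A (τ.map ∘ₗ sandwich p p) = 1 := by
  have hproj : LinearMap.IsProj (Submodule.span ℂ {p}) (τ.map ∘ₗ sandwich p p) := by
    constructor
    · intro x
      obtain ⟨c, hc⟩ := h.scalar x
      simp only [LinearMap.comp_apply, sandwich_apply, ← mul_assoc, hc, map_smul, h.fixed]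
      exact Submodule.mem_span_singleton.2 ⟨c, rfl⟩
    · intro x hx
      obtain ⟨c, rfl⟩ := Submodule.mem_span_singleton.1 hx
      simp [h.idem, h.fixed]
  rw [hproj.trace, finrank_span_singleton h.ne_zero, Nat.cast_one]

/-- The trace of `τ` on `e A e` is the number of symmetric minimal idempotents that `e` splits
into. -/
theorem SymSplit.trace_sandwich [FiniteDimensional ℂ A] {n : ℕ} {e : A} (h : SymSplit τ n e) :
    LinearMap.trace ℂ A (τ.map ∘ₗ sandwich e e) = n := by
  induction h with
  | zero =>
    have : sandwich (0 : A) 0 = 0 := by ext; simp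
    simp [this]
  | @add n e p he hp h1 h2 ih =>
    have : τ.map ∘ₗ sandwich (e + p) (e + p) = τ.map ∘ₗ sandwich e e + τ.map ∘ₗ sandwich e p +
        τ.map ∘ₗ sandwich p e + τ.map ∘ₗ sandwich p p := by
      ext x
      simp only [LinearMap.comp_apply, LinearMap.add_apply, sandwich_apply, mul_add, add_mul,
        map_add]
      abel
    rw [this, map_add, map_add, map_add, ih, hp.trace_sandwich,
      trace_sandwich_eq_zero he.idem hp.idem h1 he.fixed hp.fixed,
      trace_sandwich_eq_zero hp.idem he.idem h2 hp.fixed he.fixed]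
    simp

/-- The number of symmetric minimal idempotents into which `1` splits is the trace of the
anti-involution; if the latter permutes a basis, it is the number of fixed basis elements. -/
theorem SymSplit.eq_card_fixed [FiniteDimensional ℂ A] {n : ℕ} (h : SymSplit τ n 1)
    {ι : Type*} [Finite ι] (b : Module.Basis ι ℂ A) (s : ι → ι) (hs : ∀ i, τ.map (b i) = b (s i)) :
    n = Nat.card {i // s i = i} := by
  classical
  have := Fintype.ofFinite ι
  have h1 := h.trace_sandwich
  have h2 : τ.map ∘ₗ sandwich 1 1 = τ.map := by ext x; simp
  rw [h2, LinearMap.trace_eq_matrix_trace ℂ b, Matrix.trace] at h1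
  simp only [Matrix.diag_apply, LinearMap.toMatrix_apply, hs, Module.Basis.repr_self,
    Finsupp.single_apply, Finset.sum_boole] at h1
  rw [Nat.card_eq_fintype_card, Fintype.card_subtype]
  exact_mod_cast h1.symm

end Symmetric

section Length

variable {A : Type*} [Ring A]

/-- For a complete family of orthogonal idempotents generating simple left ideals, the number of
its members is the length of the ring. -/
theorem length_eq_card_of_isAtom {m : ℕ} (q : Fin m → A)
    (ho : ∀ i j, q i * q j = if i = j then q i else 0) (hs : ∑ i, q i = 1)
    (ha : ∀ i, IsAtom (Submodule.span A {q i})) : Module.length A A = m := by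
  have hmem : ∀ i, ∀ x ∈ Submodule.span A {q i}, x * q i = x := by
    intro i x hx
    obtain ⟨a, rfl⟩ := Submodule.mem_span_singleton.1 hx
    rw [smul_eq_mul, mul_assoc, ho, if_pos rfl]
  -- the Peirce decomposition of `A` into the left ideals `A q i`
  let E : A ≃ₗ[A] ((i : Fin m) → Submodule.span A {q i}) :=
    { toFun := fun a i => ⟨a * q i, Submodule.mem_span_singleton.2 ⟨a, rfl⟩⟩
      map_add' := fun a b => by ext i; simp [add_mul]
      map_smul' := fun a b => by ext i; simp [mul_assoc]
      invFun := fun x => ∑ i, (x i : A)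
      left_inv := fun a => by simp [← Finset.mul_sum, hs]
      right_inv := fun x => by
        ext i
        simp only [Finset.sum_mul]
        rw [Finset.sum_eq_single i, hmem i _ (x i).2]
        · intro j _ hj
          rw [← hmem j _ (x j).2, mul_assoc, ho, if_neg hj, mul_zero]
        · simp }
  have := fun i => isSimpleModule_iff_isAtom.2 (ha i)
  rw [E.length_eq, Module.length_pi_of_fintype]
  simp [Module.length_eq_one]

theorem isSemisimpleRing_of_isAtom {m : ℕ} (q : Fin m → A) (hs : ∑ i, q i = 1)
    (ha : ∀ i, IsAtom (Submodule.span A {q i})) : IsSemisimpleRing A := by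
  have := fun i => isSimpleModule_iff_isAtom.2 (ha i)
  refine isSemisimpleModule_of_isSemisimpleModule_submodule' (p := fun i => Submodule.span A {q i})
    (fun i => inferInstance) ?_
  rw [eq_top_iff]
  intro a _
  have : a = ∑ i, a * q i := by rw [← Finset.mul_sum, hs, mul_one]
  rw [this]
  exact Submodule.sum_mem _ fun i _ =>
    Submodule.mem_iSup_of_mem i (Submodule.mem_span_singleton.2 ⟨a, rfl⟩)

/-- In a semisimple ring a primitive idempotent generates a simple left ideal. -/
theorem isAtom_of_primitive [IsSemisimpleRing A] {q : A} (h0 : q ≠ 0) (hq : q * q = q)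
    (hprim : ∀ r s, r * r = r → s * s = s → r * s = 0 → s * r = 0 → r + s = q → r = 0 ∨ s = 0) :
    IsAtom (Submodule.span A {q}) := by
  refine ⟨by simpa using h0, fun L hL => ?_⟩
  obtain ⟨K, hK⟩ := exists_isCompl L
  have hmem : ∀ x ∈ Submodule.span A {q}, x * q = x := by
    intro x hx
    obtain ⟨a, rfl⟩ := Submodule.mem_span_singleton.1 hx
    rw [smul_eq_mul, mul_assoc, hq]
  have hqm : q ∈ L ⊔ K := by rw [hK.sup_eq_top]; trivial
  obtain ⟨r, hr, s, hs, hrs⟩ := Submodule.mem_sup.1 hqm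
  have hsq : s ∈ Submodule.span A {q} := by
    rw [← eq_sub_iff_add_eq'] at hrs
    rw [hrs]
    exact Submodule.sub_mem _ (Submodule.mem_span_singleton_self q) (hL.le hr)
  have hrq := hmem r (hL.le hr)
  have hsq' := hmem s hsq
  have hdisj := Submodule.disjoint_def.1 hK.disjoint
  rw [← hrs, mul_add] at hrq hsq'
  -- `r s = r - r r` lies in `L ⊓ K`, and likewise `s r`, so `r` and `s` are orthogonal idempotents
  have e1 : r * s = 0 := hdisj _
    (by rw [← sub_eq_iff_eq_add'.2 hrq.symm]
        exact L.sub_mem hr (L.smul_mem r hr)) (K.smul_mem r hs)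
  have e2 : s * r = 0 := hdisj _ (L.smul_mem s hr)
    (by rw [← sub_eq_iff_eq_add.2 hsq'.symm]; exact K.sub_mem hs (K.smul_mem s hs))
  rw [e1, add_zero] at hrq
  rw [e2, zero_add] at hsq'
  rcases hprim r s hrq hsq' e1 e2 hrs with rfl | rfl
  · rw [eq_bot_iff]
    intro x hx
    have hxq := hmem x (hL.le hx)
    refine hdisj x hx ?_
    rw [← hxq, ← hrs, zero_add]
    exact K.smul_mem x hs
  · exfalso
    rw [add_zero] at hrs
    subst hrs
    exact hL.not_ge ((Submodule.span_singleton_le_iff_mem _ _).2 hr)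

/-- With a nondegenerate trace form, an idempotent `p` with `p A p = ℂ p` generates a simple left
ideal. -/
theorem isAtom_of_scalar [Algebra ℂ A] (tr : A →ₗ[ℂ] ℂ) (tr_comm : ∀ a b, tr (a * b) = tr (b * a))
    (nondeg : ∀ x, (∀ a, tr (a * x) = 0) → x = 0) {p : A} (h0 : p ≠ 0) (hp : p * p = p)
    (hsc : ∀ a, ∃ c : ℂ, p * a * p = c • p) : IsAtom (Submodule.span A {p}) := by
  refine ⟨by simpa using h0, fun L hL => ?_⟩
  by_contra hne
  obtain ⟨x, hx, hx0⟩ := (Submodule.ne_bot_iff _).1 hne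
  have hxp : x * p = x := by
    obtain ⟨a, rfl⟩ := Submodule.mem_span_singleton.1 (hL.le hx)
    rw [smul_eq_mul, mul_assoc, hp]
  -- `tr (a x) ≠ 0` forces `p a x ≠ 0`; as `p a x` is a multiple of `p`, the generator
  -- `p` lies in `L`
  obtain ⟨a, ha⟩ : ∃ a, tr (a * x) ≠ 0 := by
    by_contra! H
    exact hx0 (nondeg x H)
  obtain ⟨c, hc⟩ := hsc (a * x)
  have hc0 : c ≠ 0 := by
    rintro rfl
    apply ha
    rw [← hxp, ← hp, ← mul_assoc, ← mul_assoc, tr_comm, ← mul_assoc, ← mul_assoc,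
      mul_assoc p a x, hc, zero_smul, map_zero]
  have hpx : p * a * x = c • p := by rw [← hc, ← mul_assoc, mul_assoc (p * a), hxp]
  refine hL.not_ge ((Submodule.span_singleton_le_iff_mem _ _).2 ?_)
  have : p = (c⁻¹ • (p * a)) • x := by
    rw [smul_eq_mul, smul_mul_assoc, hpx, smul_smul, inv_mul_cancel₀ hc0, one_smul]
  rw [this]
  exact L.smul_mem _ hx

/-- In an algebra with a nondegenerate trace form and a complete family of `n` orthogonal minimal
idempotents, all complete families of orthogonal primitive idempotents have `n` members. -/
theorem SymSplit.card_primitive [Algebra ℂ A] {τ : AntiInvolution A} {n : ℕ} (h : SymSplit τ n 1)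
    (tr : A →ₗ[ℂ] ℂ) (tr_comm : ∀ a b, tr (a * b) = tr (b * a))
    (nondeg : ∀ x, (∀ a, tr (a * x) = 0) → x = 0) {m : ℕ} (q : Fin m → A) (h0 : ∀ i, q i ≠ 0)
    (ho : ∀ i j, q i * q j = if i = j then q i else 0) (hs : ∑ i, q i = 1)
    (hprim : ∀ i r s, r * r = r → s * s = s → r * s = 0 → s * r = 0 → r + s = q i →
      r = 0 ∨ s = 0) : m = n := by
  obtain ⟨p, hp, hpo, hps⟩ := h.exists_family
  have ha := fun i => isAtom_of_scalar tr tr_comm nondeg (hp i).ne_zero (hp i).idem (hp i).scalar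
  have := isSemisimpleRing_of_isAtom p hps ha
  have e1 := length_eq_card_of_isAtom p (fun i j => by
    split_ifs with hij
    · rw [hij, (hp j).idem]
    · exact hpo i j hij) hps ha
  have e2 := length_eq_card_of_isAtom q ho hs fun i =>
    isAtom_of_primitive (h0 i) (by rw [ho, if_pos rfl]) (hprim i)
  exact_mod_cast e2.symm.trans e1

end Length

/-! ### Symmetric idempotents in group algebras -/

/-- A symmetric idempotent `p` splits into symmetric minimal idempotents if all elements of `p A p`
are symmetric and `A` is von Neumann regular: then `p A p` is commutative, and if `λ` is an
eigenvalue of a non-scalar element `x`, then `x - λ p` generates a proper ideal of `p A p`, which is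
generated by an idempotent. -/
theorem exists_symSplit_of_fixed {A : Type*} [Ring A] [Algebra ℂ A] [FiniteDimensional ℂ A]
    {τ : AntiInvolution A} (hreg : ∀ x : A, ∃ a, x * a * x = x) (p : A) (hp : p * p = p)
    (hτp : τ.map p = p) (hfix : ∀ a, τ.map (p * a * p) = p * a * p) :
    ∃ m, SymSplit τ m p := by
  by_cases h0 : p = 0
  · exact ⟨0, h0 ▸ SymSplit.zero⟩
  by_cases hsc : ∀ a, ∃ c : ℂ, p * a * p = c • p
  · exact ⟨1, MinSym.symSplit ⟨h0, hp, hτp, hsc⟩⟩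
  push Not at hsc
  obtain ⟨a, ha⟩ := hsc
  -- `W = p A p`
  let W : Submodule ℂ A := LinearMap.range (sandwich p p)
  have hW : ∀ x, x ∈ W ↔ p * x * p = x := fun x =>
    ⟨by rintro ⟨b, rfl⟩; simp only [sandwich_apply]
        rw [show p * (p * (b * p)) * p = (p * p) * b * (p * p) by noncomm_ring, hp, mul_assoc],
      fun h => ⟨x, by rw [sandwich_apply, ← mul_assoc, h]⟩⟩
  have hl : ∀ x ∈ W, p * x = x := fun x hx => by
    rw [← (hW x).1 hx, ← mul_assoc, ← mul_assoc, hp]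
  have hr : ∀ x ∈ W, x * p = x := fun x hx => by
    rw [← (hW x).1 hx, mul_assoc, hp]
  have hsand : ∀ b, p * b * p ∈ W := fun b => ⟨b, by simp [mul_assoc]⟩
  have hτ : ∀ x ∈ W, τ.map x = x := fun x hx => by rw [← (hW x).1 hx, hfix]
  have hmul : ∀ x ∈ W, ∀ y ∈ W, x * y ∈ W := fun x hx y hy => by
    rw [hW, ← mul_assoc, hl x hx, mul_assoc, hr y hy]
  have hcomm : ∀ x ∈ W, ∀ y ∈ W, x * y = y * x := fun x hx y hy => by
    rw [← hτ _ (hmul x hx y hy), τ.map_mul, hτ x hx, hτ y hy]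
  have hpW : p ∈ W := by rw [hW, hp, hp]
  set x := p * a * p with hx
  have hxW : x ∈ W := hsand a
  have : Nontrivial W := ⟨⟨p, hpW⟩, 0, fun h => h0 (congrArg Subtype.val h)⟩
  obtain ⟨lam, hlam⟩ := Module.End.exists_eigenvalue
    ((LinearMap.mulLeft ℂ x).restrict (p := W) (q := W) fun y hy => hmul x hxW y hy)
  obtain ⟨⟨v, hvW⟩, hv⟩ := hlam.exists_hasEigenvector
  have hv0 : v ≠ 0 := fun h => hv.2 (Subtype.ext h)
  have hxv : x * v = lam • v := congrArg Subtype.val hv.apply_eq_smul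
  set y := x - lam • p with hy
  have hyW : y ∈ W := W.sub_mem hxW (W.smul_mem _ hpW)
  have hy0 : y ≠ 0 := fun h => ha lam (sub_eq_zero.1 h)
  have hyv : y * v = 0 := by rw [hy, sub_mul, hxv, smul_mul_assoc, hl v hvW, sub_self]
  obtain ⟨b, hb⟩ := hreg y
  set c := p * b * p with hc
  have hcW : c ∈ W := hsand b
  have hycy : y * c * y = y := by
    rw [hc, show y * (p * b * p) * y = (y * p) * b * (p * y) by noncomm_ring, hr y hyW, hl y hyW,
      hb]
  -- by regularity `y` generates the ideal `r W` with `r` idempotent; `r ≠ 0` since `y ≠ 0`, and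
  -- `s = p - r ≠ 0` since `r` kills the eigenvector `v`
  set r := y * c with hrdef
  have hrW : r ∈ W := hmul y hyW c hcW
  have hrr : r * r = r := by rw [hrdef, ← mul_assoc, hycy]
  have hry : r * y = y := hycy
  have hrv : r * v = 0 := by rw [hrdef, hcomm y hyW c hcW, mul_assoc, hyv, mul_zero]
  set s := p - r with hs
  have hsW : s ∈ W := W.sub_mem hpW hrW
  have hrs : r * s = 0 := by rw [hs, mul_sub, hr r hrW, hrr, sub_self]
  have hsr : s * r = 0 := by rw [hcomm s hsW r hrW, hrs]
  have hss : s * s = s := by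
    conv_lhs => rw [hs, mul_sub, hsr, sub_zero, hr s hsW]
  have hr0 : r ≠ 0 := fun h => hy0 (by rw [← hry, h, zero_mul])
  have hs0 : s ≠ 0 := fun h => hv0 (by
    rw [← hl v hvW, ← sub_add_cancel p r, ← hs, h, zero_add, hrv])
  have hlt : ∀ e f : A, e ∈ W → f ∈ W → e * f = 0 → f ≠ 0 →
      Module.finrank ℂ (LinearMap.range (sandwich e e)) <
        Module.finrank ℂ (LinearMap.range (sandwich p p)) := by
    intro e f he hf hef hf0
    apply Submodule.finrank_lt_finrank_of_lt
    refine SetLike.lt_iff_le_and_exists.2 ⟨?_, f, hf, ?_⟩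
    · rintro _ ⟨z, rfl⟩
      change _ ∈ W
      rw [hW, sandwich_apply, ← mul_assoc, hl e he, mul_assoc, mul_assoc, hr e he]
    · rintro ⟨z, hz⟩
      apply hf0
      -- multiply `f = e z e` once more by `f` and use that the elements of `W` commute
      have h3 : f * f = 0 := by
        nth_rewrite 1 [← hz]
        rw [sandwich_apply, mul_assoc, mul_assoc, hef, mul_zero, mul_zero]
      obtain ⟨d, hd⟩ := hreg f
      have h4 : f * (p * d * p) * f = f := by
        rw [show f * (p * d * p) * f = (f * p) * d * (p * f) by noncomm_ring, hr f hf, hl f hf, hd]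
      rw [← h4, mul_assoc, hcomm _ (hsand d) f hf, ← mul_assoc, h3, zero_mul]
  have hfix' : ∀ e ∈ W, ∀ z, τ.map (e * z * e) = e * z * e := by
    intro e he z
    apply hτ
    rw [hW, ← mul_assoc, ← mul_assoc, hl e he, mul_assoc, hr e he]
  have hlt1 := hlt r s hrW hsW hrs hs0
  have hlt2 := hlt s r hsW hrW hsr hr0
  obtain ⟨m1, h1⟩ := exists_symSplit_of_fixed hreg r hrr (hτ r hrW) (hfix' r hrW)
  obtain ⟨m2, h2⟩ := exists_symSplit_of_fixed hreg s hss (hτ s hsW) (hfix' s hsW)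
  refine ⟨m1 + m2, ?_⟩
  have := h1.add_split h2 hrs hsr
  rwa [hs, add_sub_cancel] at this
termination_by Module.finrank ℂ (LinearMap.range (sandwich p p))

section GroupAlgebra

open MonoidAlgebra

/-- The linear extension of inversion to the group algebra. -/
noncomputable def groupInv (G : Type*) [Group G] : AntiInvolution (MonoidAlgebra ℂ G) where
  map := mapDomainLinearMap ℂ ℂ (·⁻¹)
  map_mul a b := by
    induction a using MonoidAlgebra.induction_linear with
    | zero => simp
    | add a a' h h' => rw [add_mul, map_add, h, h', map_add, mul_add]
    | single g r =>
      induction b using MonoidAlgebra.induction_linear with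
      | zero => simp
      | add b b' h h' => rw [mul_add, map_add, h, h', map_add, add_mul]
      | single h s => simp [mul_comm r s]
  map_map a := by
    induction a using MonoidAlgebra.induction_linear with
    | zero => simp
    | add a a' h h' => rw [map_add, map_add, h, h']
    | single g r => simp

@[simp] theorem groupInv_single {G : Type*} [Group G] (g : G) (r : ℂ) :
    (groupInv G).map (single g r) = single g⁻¹ r := by simp [groupInv]

variable {G H : Type*} [Group G] [Group H]

instance finiteDimensional_monoidAlgebra [Finite G] : FiniteDimensional ℂ (MonoidAlgebra ℂ G) :=
  Module.Finite.of_basis (MonoidAlgebra.basis G ℂ)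

theorem isSemisimpleRing_groupAlgebra [Finite G] : IsSemisimpleRing (MonoidAlgebra ℂ G) := by
  have : NeZero (Nat.card G : ℂ) := ⟨by simpa using Nat.card_pos.ne'⟩
  infer_instance

/-- A semisimple ring is von Neumann regular. -/
theorem exists_mul_mul_self {A : Type*} [Ring A] [IsSemisimpleRing A] (x : A) :
    ∃ a, x * a * x = x := by
  obtain ⟨K, hK⟩ := exists_isCompl (Submodule.span A {x})
  obtain ⟨r, hr, s, hs, hrs⟩ := Submodule.mem_sup.1
    (show (1 : A) ∈ Submodule.span A {x} ⊔ K by rw [hK.sup_eq_top]; trivial)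
  obtain ⟨a, rfl⟩ := Submodule.mem_span_singleton.1 hr
  refine ⟨a, ?_⟩
  have h : x * s = x - x * a * x := by
    rw [← eq_sub_iff_add_eq'] at hrs
    rw [hrs, mul_sub, mul_one, smul_eq_mul, mul_assoc]
  have : x * s = 0 := Submodule.disjoint_def.1 hK.disjoint _
    (by rw [h]; exact Submodule.sub_mem _ (Submodule.mem_span_singleton_self x)
          (Submodule.mem_span_singleton.2 ⟨x * a, rfl⟩)) (K.smul_mem x hs)
  exact (sub_eq_zero.1 (h.symm.trans this)).symm

/-- The coefficient of the neutral element, as a trace form on the group algebra. -/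
noncomputable def groupTrace (G : Type*) [Group G] : MonoidAlgebra ℂ G →ₗ[ℂ] ℂ :=
  Finsupp.lapply 1 ∘ₗ (coeffLinearEquiv ℂ).toLinearMap

theorem groupTrace_apply (x : MonoidAlgebra ℂ G) : groupTrace G x = x.coeff 1 := rfl

theorem groupTrace_mul [Fintype G] (x y : MonoidAlgebra ℂ G) :
    groupTrace G (x * y) = ∑ g, x.coeff g * y.coeff g⁻¹ := by
  rw [groupTrace_apply, coeff_mul_apply_left, Finsupp.sum_fintype _ _ (by simp)]
  simp

theorem groupTrace_comm [Finite G] (x y : MonoidAlgebra ℂ G) :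
    groupTrace G (x * y) = groupTrace G (y * x) := by
  have := Fintype.ofFinite G
  rw [groupTrace_mul, groupTrace_mul, ← Equiv.sum_comp (Equiv.inv G)]
  exact Finset.sum_congr rfl fun g _ => by simp [mul_comm]

theorem groupTrace_single_mul (g : G) (x : MonoidAlgebra ℂ G) :
    groupTrace G (single g 1 * x) = x.coeff g⁻¹ := by
  simp [groupTrace_apply]

theorem groupTrace_nondeg (x : MonoidAlgebra ℂ G) (h : ∀ a, groupTrace G (a * x) = 0) : x = 0 := by
  ext g
  simpa [groupTrace_single_mul] using h (single g⁻¹ 1)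

/-- The scalars `χ h` given by `p h p = χ h • p` satisfy `∑ χ h * χ h⁻¹ ≠ 0`. -/
theorem MinSym.exists_character [Fintype H] {p : MonoidAlgebra ℂ H} (hp : MinSym (groupInv H) p) :
    ∃ χ : H → ℂ, (∀ h, p * single h 1 * p = χ h • p) ∧ ∑ h, χ h * χ h⁻¹ ≠ 0 := by
  choose χ hχ using fun h : H => hp.scalar (single h 1)
  refine ⟨χ, hχ, fun h0 => ?_⟩
  have key : ∀ h, χ h * groupTrace H p = p.coeff h⁻¹ := by
    intro h
    rw [← smul_eq_mul, ← map_smul, ← hχ, groupTrace_comm, ← mul_assoc, hp.idem, groupTrace_comm,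
      groupTrace_single_mul]
  have h1 : (∑ h, χ h * χ h⁻¹) * (groupTrace H p * groupTrace H p) = groupTrace H p := by
    conv_rhs => rw [← hp.idem, groupTrace_mul, ← Equiv.sum_comp (Equiv.inv H)]
    rw [Finset.sum_mul]
    refine Finset.sum_congr rfl fun h _ => ?_
    rw [mul_mul_mul_comm, key, key]
    simp
  rw [h0, zero_mul] at h1
  apply hp.ne_zero
  ext h
  rw [← inv_inv h, ← key, ← h1, mul_zero, coeff_zero, Finsupp.zero_apply]

/-- Averaging over the image of `H` makes all elements of `ℂ[G]` symmetric, provided that each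
element of `G` is conjugate to its inverse under `H`. -/
theorem groupInv_average [Fintype H] (φ : H →* G)
    (hconj : ∀ g : G, ∃ h : H, φ h * g * (φ h)⁻¹ = g⁻¹) (x : MonoidAlgebra ℂ G) :
    (groupInv G).map (∑ h, single (φ h) 1 * x * single (φ h⁻¹) 1) =
      ∑ h, single (φ h) 1 * x * single (φ h⁻¹) 1 := by
  induction x using MonoidAlgebra.induction_linear with
  | zero => simp
  | add x y hx hy => simp only [mul_add, add_mul, Finset.sum_add_distrib, map_add, hx, hy]
  | single g r =>
    obtain ⟨k, hk⟩ := hconj g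
    simp only [map_sum, single_mul_single, groupInv_single, one_mul, mul_one]
    rw [← Equiv.sum_comp (Equiv.mulRight k) fun h => single (φ h * g * φ h⁻¹) r]
    refine Finset.sum_congr rfl fun h _ => ?_
    congr 1
    simp only [Equiv.coe_mulRight, map_mul, mul_inv_rev, map_inv, inv_inv]
    rw [← hk]
    group

/-- If every element of `G` is conjugate to its inverse under `H`, then all elements of `P ℂ[G] P`
are symmetric, for the image `P` of a symmetric minimal idempotent of `ℂ[H]`: up to the nonzero
factor of `MinSym.exists_character`, such an element is its own average over `H`, cut down to
`P ℂ[G] P`. -/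
theorem fixed_of_conj [Finite H] (φ : H →* G) (hconj : ∀ g : G, ∃ h : H, φ h * g * (φ h)⁻¹ = g⁻¹)
    {p : MonoidAlgebra ℂ H} (hp : MinSym (groupInv H) p) (a : MonoidAlgebra ℂ G) :
    (groupInv G).map (mapDomainAlgHom ℂ ℂ φ p * a * mapDomainAlgHom ℂ ℂ φ p) =
      mapDomainAlgHom ℂ ℂ φ p * a * mapDomainAlgHom ℂ ℂ φ p := by
  have := Fintype.ofFinite H
  obtain ⟨χ, hχ, hc⟩ := hp.exists_character
  set P := mapDomainAlgHom ℂ ℂ φ p with hP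
  have hPP : P * P = P := by rw [hP, ← map_mul, hp.idem]
  have hτ : ∀ x, (groupInv G).map (mapDomainAlgHom ℂ ℂ φ x) =
      mapDomainAlgHom ℂ ℂ φ ((groupInv H).map x) := by
    intro x
    induction x using MonoidAlgebra.induction_linear with
    | zero => simp
    | add x y hx hy => rw [map_add, map_add, hx, hy, map_add, map_add]
    | single g r => simp
  have hτP : (groupInv G).map P = P := by rw [hP, hτ, hp.fixed]
  have hPχ : ∀ h, P * single (φ h) 1 * P = χ h • P := by
    intro h
    have := congrArg (mapDomainAlgHom ℂ ℂ φ) (hχ h)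
    rw [map_mul, map_mul, map_smul] at this
    rw [hP, ← this]
    simp
  -- averaging `P a P` over `H` and cutting down by `P` again multiplies it by a nonzero scalar
  have key : P * (∑ h, single (φ h) 1 * (P * a * P) * single (φ h⁻¹) 1) * P =
      (∑ h, χ h * χ h⁻¹) • (P * a * P) := by
    rw [Finset.mul_sum, Finset.sum_mul, Finset.sum_smul]
    refine Finset.sum_congr rfl fun h _ => ?_
    rw [show P * (single (φ h) 1 * (P * a * P) * single (φ h⁻¹) 1) * P =
      (P * single (φ h) 1 * P) * a * (P * single (φ h⁻¹) 1 * P) by noncomm_ring, hPχ, hPχ]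
    simp only [smul_mul_assoc, mul_smul_comm, smul_smul]
    rw [mul_comm]
  have h2 := congrArg (groupInv G).map key
  rw [(groupInv G).map_mul, (groupInv G).map_mul, groupInv_average φ hconj, hτP, ← mul_assoc, key,
    map_smul] at h2
  exact (smul_right_injective _ hc h2).symm

/-- If every element of `G` is conjugate to its inverse under the image of `H`, then a complete
family of symmetric minimal idempotents in `ℂ[H]` can be refined to one in `ℂ[G]`. -/
theorem exists_symSplit_of_conj [Finite G] [Finite H] (φ : H →* G)
    (hconj : ∀ g : G, ∃ h : H, φ h * g * (φ h)⁻¹ = g⁻¹)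
    (hH : ∃ n, SymSplit (groupInv H) n 1) : ∃ n, SymSplit (groupInv G) n 1 := by
  obtain ⟨n, hn⟩ := hH
  have := isSemisimpleRing_groupAlgebra (G := G)
  suffices ∀ e, SymSplit (groupInv H) n e →
      ∃ m, SymSplit (groupInv G) m (mapDomainAlgHom ℂ ℂ φ e) by
    simpa using this 1 hn
  intro e he
  clear hn
  induction he with
  | zero => exact ⟨0, by simpa using SymSplit.zero⟩
  | @add n e p he hp h1 h2 ih =>
    obtain ⟨m, hm⟩ := ih
    have hPP : mapDomainAlgHom ℂ ℂ φ p * mapDomainAlgHom ℂ ℂ φ p = mapDomainAlgHom ℂ ℂ φ p := by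
      rw [← map_mul, hp.idem]
    have hfix := fixed_of_conj φ hconj hp
    have hτP := hfix 1
    rw [mul_one, hPP] at hτP
    obtain ⟨k, hk⟩ := exists_symSplit_of_fixed exists_mul_mul_self _ hPP hτP hfix
    refine ⟨m + k, ?_⟩
    rw [map_add]
    exact hm.add_split hk (by rw [← map_mul, h1, map_zero]) (by rw [← map_mul, h2, map_zero])

theorem exists_symSplit_of_subsingleton [Subsingleton G] : ∃ n, SymSplit (groupInv G) n 1 := by
  refine ⟨1, MinSym.symSplit ⟨one_ne_zero, one_mul 1, by simp [one_def], fun a => ?_⟩⟩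
  refine ⟨a.coeff 1, ?_⟩
  ext g
  rw [Subsingleton.elim g 1]
  simp [one_def]

/-- If `1` splits into `n` symmetric minimal idempotents of `ℂ[G]`, then `n` is the number of group
elements fixed by inversion. -/
theorem card_involutions_of_symSplit [Finite G] {n : ℕ} (h : SymSplit (groupInv G) n 1) :
    n = Nat.card {g : G // g * g = 1} := by
  rw [h.eq_card_fixed (MonoidAlgebra.basis G ℂ) (·⁻¹) (fun g => by simp)]
  exact Nat.card_congr (Equiv.subtypeEquivRight fun g => inv_eq_iff_mul_eq_one)

end GroupAlgebra

section Reversal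

/-- A permutation is conjugate to its inverse by a permutation fixing a given point `a`: reverse
every cycle at a base point, choosing `a` as base point of its cycle. -/
theorem Equiv.Perm.exists_conj_inv_fixing {α : Type*} (σ : Equiv.Perm α) (a : α) :
    ∃ k : Equiv.Perm α, k a = a ∧ k * σ * k⁻¹ = σ⁻¹ := by
  classical
  let S := Equiv.Perm.SameCycle.setoid σ
  let rep : α → α := fun x => if σ.SameCycle a x then a else (Quotient.mk S x).out
  have hrep : ∀ x, σ.SameCycle (rep x) x := by
    intro x
    simp only [rep]
    split_ifs with h
    · exact h
    · exact Quotient.exact (Quotient.out_eq (Quotient.mk S x))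
  have hrepσ : ∀ x, rep (σ x) = rep x := by
    intro x
    have e : Quotient.mk S (σ x) = Quotient.mk S x :=
      Quotient.sound (show σ.SameCycle (σ x) x from (Equiv.Perm.sameCycle_apply_left).2 (by rfl))
    simp only [rep, e, Equiv.Perm.sameCycle_apply_right]
  have hrepa : rep a = a := by simp only [rep]; rw [if_pos]; rfl
  choose i hi using hrep
  have uniq : ∀ (m n : ℤ) y, (σ ^ m) y = (σ ^ n) y → (σ ^ (-m)) y = (σ ^ (-n)) y := by
    intro m n y h
    have h2 : (σ ^ (-m - n)) ((σ ^ m) y) = (σ ^ (-m - n)) ((σ ^ n) y) := by rw [h]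
    rw [← Equiv.Perm.mul_apply, ← Equiv.Perm.mul_apply, ← zpow_add, ← zpow_add] at h2
    rw [show -m - n + m = -n by ring, show -m - n + n = -m by ring] at h2
    exact h2.symm
  -- `f` sends `σ ^ n (rep x)` to `σ ^ (-n) (rep x)`; this does not depend on the choice of `n`
  let f : α → α := fun x => (σ ^ (-i x)) (rep x)
  have hf : ∀ x (n : ℤ), (σ ^ n) (rep x) = x → f x = (σ ^ (-n)) (rep x) := fun x n hn =>
    uniq _ _ _ ((hi x).trans hn.symm)
  have hrepz : ∀ (n : ℤ) x, rep ((σ ^ n) x) = rep x := by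
    intro n x
    induction n with
    | zero => simp
    | succ n ih => rw [add_comm, zpow_add, zpow_one, Equiv.Perm.mul_apply, hrepσ, ih]
    | pred n ih =>
      rw [sub_eq_add_neg, add_comm, zpow_add, zpow_neg_one, Equiv.Perm.mul_apply, ← ih, ← hrepσ]
      simp
  have hrr : ∀ x, rep (rep x) = rep x := fun x => by
    conv_rhs => rw [← hi x]
    rw [hrepz]
  have hrf : ∀ x, rep (f x) = rep x := fun x => by rw [hrepz, hrr]
  have hff : ∀ x, f (f x) = x := fun x => by
    rw [hf (f x) (-i x) (by rw [hrf]), hrf, neg_neg, hi]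
  refine ⟨⟨f, f, hff, hff⟩, ?_, ?_⟩
  · change f a = a
    rw [hf a 0 (by simp [hrepa])]
    simp [hrepa]
  · rw [mul_inv_eq_iff_eq_mul]
    ext x
    change f (σ x) = σ⁻¹ (f x)
    rw [hf (σ x) (1 + i x) (by rw [hrepσ, zpow_add, Equiv.Perm.mul_apply, hi, zpow_one]), hrepσ,
      neg_add, zpow_add, Equiv.Perm.mul_apply, zpow_neg_one]

/-- A permutation of `α ∪ {∗}` is conjugate to its inverse by a permutation of `α`. -/
theorem Equiv.Perm.exists_optionCongr_conj_inv {α : Type*} (σ : Equiv.Perm (Option α)) :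
    ∃ k : Equiv.Perm α, (optionCongr k : Equiv.Perm (Option α)) * σ * (optionCongr k)⁻¹ = σ⁻¹ := by
  obtain ⟨k, hk, h⟩ := σ.exists_conj_inv_fixing none
  refine ⟨removeNone k, ?_⟩
  rwa [show (optionCongr (removeNone k) : Equiv.Perm (Option α)) = k from ?_]
  ext1 x
  cases x with
  | none => simp [hk]
  | some x =>
    rw [Equiv.optionCongr_apply, Option.map_some]
    refine Equiv.removeNone_some _ (Option.ne_none_iff_exists'.1 fun h => ?_)
    exact absurd (k.injective (h.trans hk.symm)) (by simp)

theorem Equiv.Perm.exists_conj_inv {α : Type*} (σ : Equiv.Perm α) :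
    ∃ k : Equiv.Perm α, k * σ * k⁻¹ = σ⁻¹ := by
  rcases isEmpty_or_nonempty α with _ | ⟨⟨a⟩⟩
  · exact ⟨1, Subsingleton.elim _ _⟩
  · obtain ⟨k, -, h⟩ := σ.exists_conj_inv_fixing a
    exact ⟨k, h⟩

/-- The inclusion of the permutations of `α` into those of `Option α`. -/
def optionHom (α : Type*) : Equiv.Perm α →* Equiv.Perm (Option α) where
  toFun k := Equiv.optionCongr k
  map_one' := Equiv.optionCongr_refl
  map_mul' a b := by ext1 x; cases x <;> rfl

/-- The group algebras of products of two symmetric groups split into symmetric minimal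
idempotents, by induction along the chain of subgroups that adds one letter at a time. -/
theorem exists_symSplit_perm_prod (α β : Type) [Finite α] [Finite β] :
    ∃ n, SymSplit (groupInv (Equiv.Perm α × Equiv.Perm β)) n 1 := by
  have hemp : ∃ n, SymSplit (groupInv (Equiv.Perm PEmpty × Equiv.Perm β)) n 1 := by
    refine Finite.induction_empty_option
      (P := fun β : Type => Finite β →
        ∃ n, SymSplit (groupInv (Equiv.Perm PEmpty × Equiv.Perm β)) n 1)
      ?_ ?_ ?_ β inferInstance
    · intro β β' e ih _
      have : Finite β := Finite.of_equiv _ e.symm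
      refine exists_symSplit_of_conj
        ((MonoidHom.id _).prodMap (e.permCongrHom.toMonoidHom)) ?_ (ih this)
      rintro ⟨g, h⟩
      obtain ⟨l, hl⟩ := h.exists_conj_inv
      obtain ⟨l, rfl⟩ := e.permCongrHom.surjective l
      exact ⟨(1, l), Prod.ext (Subsingleton.elim _ _) hl⟩
    · intro _
      exact exists_symSplit_of_subsingleton
    · intro β _ ih _
      refine exists_symSplit_of_conj ((MonoidHom.id _).prodMap (optionHom _)) ?_ (ih inferInstance)
      rintro ⟨g, h⟩
      obtain ⟨l, hl⟩ := h.exists_optionCongr_conj_inv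
      exact ⟨(1, l), Prod.ext (Subsingleton.elim _ _) hl⟩
  refine Finite.induction_empty_option
    (P := fun α : Type => Finite α → ∃ n, SymSplit (groupInv (Equiv.Perm α × Equiv.Perm β)) n 1)
    ?_ ?_ ?_ α inferInstance
  · intro α α' e ih _
    have : Finite α := Finite.of_equiv _ e.symm
    refine exists_symSplit_of_conj ((e.permCongrHom.toMonoidHom).prodMap (MonoidHom.id _)) ?_
      (ih this)
    rintro ⟨g, h⟩
    obtain ⟨k, hk⟩ := g.exists_conj_inv
    obtain ⟨l, hl⟩ := h.exists_conj_inv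
    obtain ⟨k, rfl⟩ := e.permCongrHom.surjective k
    exact ⟨(k, l), Prod.ext hk hl⟩
  · intro _
    exact hemp
  · intro α _ ih _
    refine exists_symSplit_of_conj ((optionHom _).prodMap (MonoidHom.id _)) ?_ (ih inferInstance)
    rintro ⟨g, h⟩
    obtain ⟨k, hk⟩ := g.exists_optionCongr_conj_inv
    obtain ⟨l, hl⟩ := h.exists_conj_inv
    exact ⟨(k, l), Prod.ext hk hl⟩

theorem exists_symSplit_perm (α : Type) [Finite α] :
    ∃ n, SymSplit (groupInv (Equiv.Perm α)) n 1 := by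
  refine exists_symSplit_of_conj (MonoidHom.snd (Equiv.Perm PEmpty) _) (fun g => ?_)
    (exists_symSplit_perm_prod PEmpty α)
  obtain ⟨k, hk⟩ := g.exists_conj_inv
  exact ⟨(1, k), hk⟩

end Reversal

/-! ### Dimensions of irreducible representations -/

section FDRep

open MonoidAlgebra

variable {G : Type} [Group G]

/-- The action of the group algebra on a representation. -/
noncomputable def FDRep.act (V : FDRep ℂ G) : MonoidAlgebra ℂ G →ₐ[ℂ] (V →ₗ[ℂ] V) :=
  MonoidAlgebra.lift ℂ _ G V.ρ

@[simp] theorem FDRep.act_single (V : FDRep ℂ G) (g : G) (r : ℂ) :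
    V.act (single g r) = r • V.ρ g := MonoidAlgebra.lift_single _ _ _

/-- The linear map underlying a morphism of representations. -/
def FDRep.toLin {V W : FDRep ℂ G} (f : V ⟶ W) : V →ₗ[ℂ] W := f.hom.hom.hom

theorem FDRep.toLin_ext {V W : FDRep ℂ G} {f g : V ⟶ W} (h : FDRep.toLin f = FDRep.toLin g) :
    f = g := Action.Hom.ext (FGModuleCat.hom_ext h)

theorem FDRep.toLin_ρ {V W : FDRep ℂ G} (f : V ⟶ W) (g : G) (v : V) :
    FDRep.toLin f (V.ρ g v) = W.ρ g (FDRep.toLin f v) :=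
  ConcreteCategory.congr_hom (f.comm g) v

theorem FDRep.toLin_act {V W : FDRep ℂ G} (f : V ⟶ W) (a : MonoidAlgebra ℂ G) (v : V) :
    FDRep.toLin f (V.act a v) = W.act a (FDRep.toLin f v) := by
  induction a using MonoidAlgebra.induction_linear with
  | zero => simp
  | add a b ha hb => simp only [map_add, LinearMap.add_apply, ha, hb]
  | single g r => simp [FDRep.toLin_ρ]

theorem FDRep.exists_hom {V W : FDRep ℂ G} (φ : V →ₗ[ℂ] W)
    (h : ∀ g v, φ (V.ρ g v) = W.ρ g (φ v)) : ∃ f : V ⟶ W, FDRep.toLin f = φ :=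
  ⟨⟨InducedCategory.homMk (ModuleCat.ofHom φ), fun g => by ext v; exact h g v⟩, rfl⟩

variable (G) in
/-- Isomorphism classes of simple finite-dimensional complex representations. -/
abbrev IrrepClass : Type 1 :=
  {c : Quotient (isIsomorphicSetoid (FDRep ℂ G)) // Simple c.out}

theorem irrepClass_ext {c d : IrrepClass G} (h : Nonempty (c.1.out ≅ d.1.out)) : c = d := by
  apply Subtype.ext
  rw [← Quotient.out_eq c.1, ← Quotient.out_eq d.1]
  exact Quotient.sound h

/-- The rank of the action is additive on orthogonal idempotents. -/
theorem finrank_range_act_add {e p : MonoidAlgebra ℂ G} (he : e * e = e) (hp : p * p = p)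
    (h1 : e * p = 0) (h2 : p * e = 0) (V : FDRep ℂ G) :
    Module.finrank ℂ (LinearMap.range (V.act (e + p))) =
      Module.finrank ℂ (LinearMap.range (V.act e)) +
        Module.finrank ℂ (LinearMap.range (V.act p)) := by
  have key : ∀ a : MonoidAlgebra ℂ G, a * a = a →
      LinearMap.trace ℂ V (V.act a) = Module.finrank ℂ (LinearMap.range (V.act a)) := by
    intro a ha
    refine LinearMap.IsProj.trace ⟨fun x => ⟨x, rfl⟩, ?_⟩
    rintro _ ⟨x, rfl⟩
    rw [← Module.End.mul_apply, ← map_mul, ha]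
  have h3 : (e + p) * (e + p) = e + p := by rw [mul_add, add_mul, add_mul, he, hp, h1, h2]; simp
  have := key _ h3
  rw [map_add, map_add, key e he, key p hp, ← map_add] at this
  exact_mod_cast this.symm

variable [Finite G]

/-- The left ideal `ℂ[G] p`, as a representation of `G`. -/
noncomputable def leftIdealRep (p : MonoidAlgebra ℂ G) : FDRep ℂ G :=
  FDRep.of (V := LinearMap.range (LinearMap.mulRight ℂ p))
    { toFun := fun g => (LinearMap.mulLeft ℂ (single g (1 : ℂ))).restrict (by
        rintro _ ⟨a, rfl⟩
        exact ⟨single g 1 * a, by simp [mul_assoc]⟩)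
      map_one' := by
        ext x : 2
        change single (1 : G) (1 : ℂ) * x.1 = x.1
        rw [← one_def, one_mul]
      map_mul' := fun g h => by
        ext x : 2
        change single (g * h) (1 : ℂ) * x.1 = single g (1 : ℂ) * (single h (1 : ℂ) * x.1)
        rw [← mul_assoc, single_mul_single, one_mul] }

/-- The inclusion of the left ideal into the group algebra. -/
noncomputable def leftIdealVal (p : MonoidAlgebra ℂ G) :
    leftIdealRep p →ₗ[ℂ] MonoidAlgebra ℂ G :=
  (LinearMap.range (LinearMap.mulRight ℂ p)).subtype

/-- The generator of the left ideal. -/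
noncomputable def leftIdealGen (p : MonoidAlgebra ℂ G) : leftIdealRep p :=
  (⟨p, 1, by simp⟩ : LinearMap.range (LinearMap.mulRight ℂ p))

theorem leftIdealVal_gen (p : MonoidAlgebra ℂ G) : leftIdealVal p (leftIdealGen p) = p := rfl

theorem leftIdealVal_injective (p : MonoidAlgebra ℂ G) : Function.Injective (leftIdealVal p) :=
  Subtype.val_injective

theorem leftIdealVal_mul {p : MonoidAlgebra ℂ G} (hp : p * p = p) (x : leftIdealRep p) :
    leftIdealVal p x * p = leftIdealVal p x := by
  obtain ⟨_, a, rfl⟩ := x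
  change a * p * p = a * p
  rw [mul_assoc, hp]

theorem leftIdealVal_act (p a : MonoidAlgebra ℂ G) (x : leftIdealRep p) :
    leftIdealVal p ((leftIdealRep p).act a x) = a * leftIdealVal p x := by
  induction a using MonoidAlgebra.induction_linear with
  | zero => simp
  | add a b ha hb => simp only [map_add, LinearMap.add_apply, ha, hb, add_mul]
  | single g r =>
    rw [FDRep.act_single, LinearMap.smul_apply, map_smul]
    change r • (single g 1 * leftIdealVal p x) = _
    rw [← smul_mul_assoc, smul_single, smul_eq_mul, mul_one]

/-- A vector of a representation defines a morphism from the left ideal `ℂ[G] p`. -/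
theorem exists_hom_leftIdealRep (p : MonoidAlgebra ℂ G) (V : FDRep ℂ G) (v : V) :
    ∃ f : leftIdealRep p ⟶ V, ∀ x, FDRep.toLin f x = V.act (leftIdealVal p x) v := by
  obtain ⟨f, hf⟩ := FDRep.exists_hom (V := leftIdealRep p) (W := V)
    ((LinearMap.applyₗ v).comp ((V.act.toLinearMap).comp (leftIdealVal p))) (fun g x => by
      have := leftIdealVal_act p (single g 1) x
      rw [FDRep.act_single, one_smul] at this
      simp [this])
  exact ⟨f, fun x => by rw [hf]; rfl⟩

/-- The left ideal of a minimal idempotent `p` is simple: if `x` is a nonzero element of a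
subrepresentation, then `p a x` is a nonzero multiple of `p` for some `a`. -/
theorem leftIdealRep_simple {p : MonoidAlgebra ℂ G} (hp : MinSym (groupInv G) p) :
    Simple (leftIdealRep p) := by
  have hgen : leftIdealGen p ≠ 0 := fun h => hp.ne_zero (by
    rw [← leftIdealVal_gen p, h, map_zero])
  refine ⟨fun {Y} f _ => ⟨?_, fun h0 => ?_⟩⟩
  · rintro _ rfl
    have h1 : 𝟙 (leftIdealRep p) = 0 := by
      rw [← IsIso.inv_hom_id (0 : Y ⟶ leftIdealRep p), comp_zero]
    exact hgen (congrArg (fun k => FDRep.toLin k (leftIdealGen p)) h1)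
  · obtain ⟨y, hy⟩ : ∃ y, FDRep.toLin f y ≠ 0 := by
      by_contra! H
      exact h0 (FDRep.toLin_ext (LinearMap.ext H))
    set x := leftIdealVal p (FDRep.toLin f y) with hx
    have hx0 : x ≠ 0 := fun h => hy (leftIdealVal_injective p (by rw [← hx, h, map_zero]))
    obtain ⟨a, ha⟩ : ∃ a, groupTrace G (a * x) ≠ 0 := by
      by_contra! H
      exact hx0 (groupTrace_nondeg x H)
    have hxp : x * p = x := leftIdealVal_mul hp.idem _
    obtain ⟨c, hc⟩ := hp.scalar (a * x)
    have hc0 : c ≠ 0 := by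
      rintro rfl
      apply ha
      rw [← hxp, ← hp.idem, ← mul_assoc, ← mul_assoc, groupTrace_comm, ← mul_assoc, ← mul_assoc,
        mul_assoc p a x, hc, zero_smul, map_zero]
    have hpx : p * a * x = c • p := by rw [← hc, ← mul_assoc, mul_assoc (p * a), hxp]
    -- the generator is in the image of `f`, which gives a section of `f`
    obtain ⟨g, hg⟩ := exists_hom_leftIdealRep p Y (Y.act (c⁻¹ • (p * a)) y)
    have : g ≫ f = 𝟙 _ := by
      apply FDRep.toLin_ext
      ext z
      change FDRep.toLin f (FDRep.toLin g z) = z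
      apply leftIdealVal_injective
      rw [hg, FDRep.toLin_act, FDRep.toLin_act, leftIdealVal_act, leftIdealVal_act, ← hx,
        smul_mul_assoc, hpx, smul_smul, inv_mul_cancel₀ hc0, one_smul, leftIdealVal_mul hp.idem]
    have : IsSplitEpi f := ⟨⟨g, this⟩⟩
    exact isIso_of_mono_of_isSplitEpi f

/-- A minimal idempotent `p` acts nontrivially on a simple representation only if the latter is
isomorphic to `ℂ[G] p`, and then its rank is one. -/
theorem nonempty_iso_of_act_ne_zero {p : MonoidAlgebra ℂ G} (hp : MinSym (groupInv G) p)
    (V : FDRep ℂ G) [Simple V] (h : V.act p ≠ 0) :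
    Nonempty (leftIdealRep p ≅ V) ∧ Module.finrank ℂ (LinearMap.range (V.act p)) = 1 := by
  obtain ⟨v, hv⟩ : ∃ v, V.act p v ≠ 0 := by
    by_contra! H
    exact h (LinearMap.ext H)
  obtain ⟨f, hf⟩ := exists_hom_leftIdealRep p V v
  have hf0 : f ≠ 0 := fun h0 => hv (by
    have := hf (leftIdealGen p)
    rw [leftIdealVal_gen] at this
    rw [← this, h0]; rfl)
  have := leftIdealRep_simple hp
  have hiso : IsIso f := isIso_of_hom_simple hf0
  refine ⟨⟨asIso f⟩, ?_⟩
  have hrange : LinearMap.range (V.act p) = Submodule.span ℂ {V.act p v} := by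
    apply le_antisymm
    · rintro _ ⟨w, rfl⟩
      have hw : FDRep.toLin f (FDRep.toLin (inv f) w) = w :=
        congrArg (fun k => FDRep.toLin k w) (IsIso.inv_hom_id f)
      rw [← hw, hf]
      obtain ⟨c, hc⟩ := hp.scalar (leftIdealVal p (FDRep.toLin (inv f) w))
      rw [← leftIdealVal_mul hp.idem, ← Module.End.mul_apply, ← map_mul, ← mul_assoc, hc, map_smul]
      exact Submodule.mem_span_singleton.2 ⟨c, rfl⟩
    · rw [Submodule.span_singleton_le_iff_mem]
      exact ⟨v, rfl⟩
  rw [hrange, finrank_span_singleton hv]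

theorem act_leftIdealRep_ne_zero {p : MonoidAlgebra ℂ G} (hp : MinSym (groupInv G) p)
    {V : FDRep ℂ G} (i : leftIdealRep p ≅ V) : V.act p ≠ 0 := by
  intro h
  have h1 : FDRep.toLin i.inv (V.act p (FDRep.toLin i.hom (leftIdealGen p))) = leftIdealGen p := by
    rw [FDRep.toLin_act]
    have : FDRep.toLin i.inv (FDRep.toLin i.hom (leftIdealGen p)) = leftIdealGen p :=
      congrArg (fun k => FDRep.toLin k (leftIdealGen p)) i.hom_inv_id
    rw [this]
    apply leftIdealVal_injective
    rw [leftIdealVal_act, leftIdealVal_gen, hp.idem]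
  rw [h, LinearMap.zero_apply, map_zero] at h1
  exact hp.ne_zero (by rw [← leftIdealVal_gen p, ← h1, map_zero])

open Classical in
/-- Each minimal idempotent acts nontrivially on exactly one simple representation. -/
theorem exists_irrepClass {p : MonoidAlgebra ℂ G} (hp : MinSym (groupInv G) p) :
    ∃ c : IrrepClass G, ∀ d : IrrepClass G,
      Module.finrank ℂ (LinearMap.range (d.1.out.act p)) = if d = c then 1 else 0 := by
  have hS := leftIdealRep_simple hp
  obtain ⟨i⟩ : Nonempty ((Quotient.mk (isIsomorphicSetoid (FDRep ℂ G)) (leftIdealRep p)).out ≅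
    leftIdealRep p) := @Quotient.mk_out _ (isIsomorphicSetoid (FDRep ℂ G)) (leftIdealRep p)
  refine ⟨⟨Quotient.mk _ (leftIdealRep p), Simple.of_iso i⟩, fun d => ?_⟩
  have := d.2
  split_ifs with hd
  · subst hd
    exact (nonempty_iso_of_act_ne_zero hp _ (act_leftIdealRep_ne_zero hp i.symm)).2
  · by_contra h
    have h0 : d.1.out.act p ≠ 0 := fun h0 => h (by
      rw [h0, LinearMap.range_zero, finrank_bot])
    obtain ⟨j⟩ := (nonempty_iso_of_act_ne_zero hp _ h0).1
    exact hd (irrepClass_ext ⟨j.symm ≪≫ i.symm⟩)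

/-- The dimension of `V` is the sum of the ranks on `V` of the `n` minimal idempotents, and each of
them has rank one on a single irreducible `V` and rank zero on the others. -/
theorem finite_irrepClass_and_finsum {n : ℕ} (h : SymSplit (groupInv G) n 1) :
    Finite (IrrepClass G) ∧ ∑ᶠ c : IrrepClass G, Module.finrank ℂ c.1.out = n := by
  classical
  have h1 : ∀ V : FDRep ℂ G,
      Module.finrank ℂ (LinearMap.range (V.act 1)) = Module.finrank ℂ V := fun V => by
    rw [map_one, Module.End.one_eq_id, LinearMap.range_id, finrank_top]
  suffices ∀ e, SymSplit (groupInv G) n e →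
      (Function.support fun c : IrrepClass G =>
        Module.finrank ℂ (LinearMap.range (c.1.out.act e))).Finite ∧
      ∑ᶠ c : IrrepClass G, Module.finrank ℂ (LinearMap.range (c.1.out.act e)) = n by
    obtain ⟨h2, h3⟩ := this 1 h
    simp only [h1] at h2 h3
    refine ⟨?_, h3⟩
    rw [← Set.finite_univ_iff]
    refine h2.subset fun c _ => ?_
    have := c.2
    rw [Function.mem_support]
    intro h0
    have hsub := Module.finrank_zero_iff.1 h0
    apply id_nonzero c.1.out
    apply FDRep.toLin_ext
    ext v
    exact Subsingleton.elim _ _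
  intro e he
  clear h
  induction he with
  | zero =>
    have h0 : (fun c : IrrepClass G =>
        Module.finrank ℂ (LinearMap.range (c.1.out.act 0))) = fun _ => 0 :=
      funext fun c => by rw [map_zero, LinearMap.range_zero, finrank_bot]
    rw [h0]
    simp
  | @add n e p he hp h2 h3 ih =>
    obtain ⟨c, hc⟩ := exists_irrepClass hp
    have hsupp : (Function.support fun d : IrrepClass G =>
        Module.finrank ℂ (LinearMap.range (d.1.out.act p))).Finite := by
      refine (Set.finite_singleton c).subset fun d hd => ?_
      by_contra hne
      exact hd ((hc d).trans (if_neg hne))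
    simp only [fun V => finrank_range_act_add (G := G) he.idem hp.idem h2 h3 V]
    refine ⟨(ih.1.union hsupp).subset (Function.support_add _ _), ?_⟩
    rw [finsum_add_distrib ih.1 hsupp, ih.2]
    congr 1
    rw [finsum_congr hc, finsum_eq_single _ c fun d hd => if_neg hd, if_pos rfl]

end FDRep

theorem finite_symIrrep (m : ℕ) : Finite (SymIrrep m) := by
  obtain ⟨n, hn⟩ := exists_symSplit_perm (Fin m)
  exact (finite_irrepClass_and_finsum hn).1

/-- The dimensions of the irreducible representations of the symmetric group add up to the number
of involutions. -/
theorem cd_eq_card_involutions (m : ℕ) :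
    cd m = Nat.card {σ : Equiv.Perm (Fin m) // σ * σ = 1} := by
  obtain ⟨n, hn⟩ := exists_symSplit_perm (Fin m)
  rw [← card_involutions_of_symSplit hn]
  exact (finite_irrepClass_and_finsum hn).2

/-! ### Jucys–Murphy elements and the loop-counting form -/

section Orbits

/-- The number of orbits of a permutation. -/
noncomputable def Equiv.Perm.orbits {α : Type*} (σ : Equiv.Perm α) : ℕ :=
  Nat.card (Quot fun x y => σ x = y)

/-- The two-colourings invariant under a permutation. There are `2 ^ k` of them if the permutation
has `k` orbits, so that numbers of orbits can be compared by bijections of colourings. -/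
abbrev InvColouring {α : Type*} (σ : Equiv.Perm α) : Type _ := {c : α → Bool // ∀ x, c (σ x) = c x}

theorem card_invColouring {α : Type*} [Finite α] (σ : Equiv.Perm α) :
    Nat.card (InvColouring σ) = 2 ^ σ.orbits := by
  have h2 : (2 : ℕ) = Nat.card Bool := by simp
  rw [Equiv.Perm.orbits, h2, ← Nat.card_fun]
  exact Nat.card_congr
    { toFun := fun c => Quot.lift c.1 fun x y h => by rw [← h, c.2]
      invFun := fun f => ⟨fun x => f (Quot.mk _ x), fun x =>
        congrArg f (Quot.sound (r := fun x y => σ x = y) (rfl : σ x = σ x)).symm⟩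
      left_inv := fun c => rfl
      right_inv := fun f => by ext ⟨x⟩; rfl }

theorem orbits_eq_of_equiv {α β : Type*} [Finite α] [Finite β] {σ : Equiv.Perm α}
    {τ : Equiv.Perm β} (e : InvColouring σ ≃ InvColouring τ) : σ.orbits = τ.orbits :=
  Nat.pow_right_injective le_rfl
    (by simp only [← card_invColouring]; exact Nat.card_congr e)

theorem orbits_permCongr {α β : Type*} [Finite α] (e : α ≃ β) (σ : Equiv.Perm α) :
    (e.permCongr σ).orbits = σ.orbits := by
  have := Finite.of_equiv _ e
  refine orbits_eq_of_equiv
    { toFun := fun c => ⟨c.1 ∘ e, fun x => by simpa using c.2 (e x)⟩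
      invFun := fun c => ⟨c.1 ∘ e.symm, fun x => by simpa using c.2 (e.symm x)⟩
      left_inv := fun c => by ext; simp
      right_inv := fun c => by ext; simp }

theorem orbits_optionHom {α : Type} [Finite α] (σ : Equiv.Perm α) :
    (optionHom α σ).orbits = σ.orbits + 1 := by
  apply Nat.pow_right_injective le_rfl
  simp only [pow_succ]
  rw [← card_invColouring, ← card_invColouring]
  have h2 : (2 : ℕ) = Nat.card Bool := by simp
  rw [h2, ← Nat.card_prod]
  exact Nat.card_congr
    { toFun := fun c => (⟨fun x => c.1 (some x), fun x => c.2 (some x)⟩, c.1 none)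
      invFun := fun c => ⟨fun x => x.elim c.2 c.1.1, fun x => by
        cases x with
        | none => rfl
        | some x => exact c.1.2 x⟩
      left_inv := fun c => by ext x; cases x <;> rfl
      right_inv := fun c => rfl }

theorem orbits_swap_mul_optionHom {α : Type} [Finite α] [DecidableEq α] (a : α)
    (σ : Equiv.Perm α) : (Equiv.swap none (some a) * optionHom α σ).orbits = σ.orbits := by
  have hnone : (Equiv.swap none (some a) * optionHom α σ) none = some a := by
    change Equiv.swap none (some a) none = _
    rw [Equiv.swap_apply_left]
  have hsome : ∀ x, (Equiv.swap none (some a) * optionHom α σ) (some x) =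
      if σ x = a then none else some (σ x) := by
    intro x
    change Equiv.swap none (some a) (some (σ x)) = _
    split_ifs with h
    · rw [h, Equiv.swap_apply_right]
    · rw [Equiv.swap_apply_of_ne_of_ne (by simp) (by simpa using h)]
  refine orbits_eq_of_equiv
    { toFun := fun c => ⟨fun x => c.1 (some x), fun x => ?_⟩
      invFun := fun c => ⟨fun x => x.elim (c.1 a) c.1, fun x => ?_⟩
      left_inv := fun c => ?_
      right_inv := fun c => rfl }
  · have h1 := c.2 (some x)
    rw [hsome] at h1
    split_ifs at h1 with h
    · have h2 := c.2 none
      rw [hnone] at h2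
      change c.1 (some (σ x)) = c.1 (some x)
      rw [h, h2, h1]
    · exact h1
  · cases x with
    | none => rw [hnone]; rfl
    | some x =>
      rw [hsome]
      split_ifs with h
      · change c.1 a = c.1 x
        rw [← h, c.2]
      · exact c.2 x
  · ext x
    cases x with
    | none =>
      have h2 := c.2 none
      rw [hnone] at h2
      exact h2
    | some x => rfl

end Orbits

section JucysMurphy

open MonoidAlgebra

/-- The Jucys–Murphy element `∑ (∗ a)` of `ℂ[S_{α ∪ ∗}]`. -/
noncomputable def jucysMurphy (α : Type) [Fintype α] [DecidableEq α] :
    MonoidAlgebra ℂ (Equiv.Perm (Option α)) :=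
  ∑ a : α, single (Equiv.swap none (some a)) 1

variable (α : Type) [Fintype α] [DecidableEq α]

/-- The Jucys–Murphy element commutes with the permutations fixing `∗`. -/
theorem commute_jucysMurphy (x : MonoidAlgebra ℂ (Equiv.Perm α)) :
    mapDomainAlgHom ℂ ℂ (optionHom α) x * jucysMurphy α =
      jucysMurphy α * mapDomainAlgHom ℂ ℂ (optionHom α) x := by
  induction x using MonoidAlgebra.induction_linear with
  | zero => simp
  | add x y hx hy => rw [map_add, add_mul, mul_add, hx, hy]
  | single k r =>
    simp only [jucysMurphy, Finset.mul_sum, Finset.sum_mul, mapDomainAlgHom_apply,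
      mapDomain_single, single_mul_single, mul_one, one_mul]
    rw [← Equiv.sum_comp k fun a => single (Equiv.swap none (some a) * optionHom α k) r]
    refine Finset.sum_congr rfl fun a _ => ?_
    rw [Equiv.mul_swap_eq_swap_mul]
    rfl

/-- The recursion `J' = s + s J s` of the Jucys–Murphy elements, with `s` the transposition of the
two adjoined points. -/
theorem jucysMurphy_option : jucysMurphy (Option α) =
    single (Equiv.swap none (some none)) 1 + single (Equiv.swap none (some none)) 1 *
      mapDomainAlgHom ℂ ℂ (optionHom (Option α)) (jucysMurphy α) *
        single (Equiv.swap none (some none)) 1 := by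
  rw [jucysMurphy, Fintype.sum_option, jucysMurphy, map_sum, Finset.mul_sum, Finset.sum_mul]
  congr 1
  refine Finset.sum_congr rfl fun a _ => ?_
  simp only [mapDomainAlgHom_apply, mapDomain_single, single_mul_single, mul_one]
  congr 1
  have h1 : optionHom (Option α) (Equiv.swap none (some a)) =
      Equiv.swap (some none) (some (some a)) := Equiv.optionCongr_swap _ _
  rw [h1, Equiv.mul_swap_eq_swap_mul (Equiv.swap none (some none)), mul_assoc,
    Equiv.swap_mul_self, mul_one,
    Equiv.swap_apply_right, Equiv.swap_apply_of_ne_of_ne (by simp) (by simp)]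

/-- All eigenvalues of a Jucys–Murphy element are integers. If `v` is a joint eigenvector of two
consecutive ones, with eigenvalues `a ≠ b`, and `s` is the transposition between them, then either
`s v - (b - a)⁻¹ v` is an eigenvector of the former with eigenvalue `b`, or `b = a ± 1`. -/
theorem jucysMurphy_eigenvalue (V : Type) [AddCommGroup V] [Module ℂ V] [FiniteDimensional ℂ V]
    (ρ : MonoidAlgebra ℂ (Equiv.Perm (Option α)) →ₐ[ℂ] Module.End ℂ V) (b : ℂ)
    (hb : (ρ (jucysMurphy α)).HasEigenvalue b) : ∃ z : ℤ, b = z := by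
  refine Finite.induction_empty_option (P := fun α : Type => ∀ [Fintype α] [DecidableEq α]
    (V : Type) [AddCommGroup V] [Module ℂ V] [FiniteDimensional ℂ V]
    (ρ : MonoidAlgebra ℂ (Equiv.Perm (Option α)) →ₐ[ℂ] Module.End ℂ V) (b : ℂ),
    (ρ (jucysMurphy α)).HasEigenvalue b → ∃ z : ℤ, b = z) ?_ ?_ ?_ α V ρ b hb
  · intro α β e ih _ _ V _ _ _ ρ b hb
    classical
    have : Fintype α := Fintype.ofEquiv _ e.symm
    refine ih V (ρ.comp (mapDomainAlgHom ℂ ℂ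
      ((Equiv.optionCongr e).permCongrHom.toMonoidHom))) b ?_
    rw [AlgHom.comp_apply]
    convert hb
    simp only [jucysMurphy, map_sum]
    rw [← Equiv.sum_comp e]
    refine Finset.sum_congr rfl fun a _ => ?_
    simp only [mapDomainAlgHom_apply, mapDomain_single]
    congr 1
    exact Equiv.symm_trans_swap_trans _ _ _
  · intro _ _ V _ _ _ ρ b hb
    obtain ⟨v, hv⟩ := hb.exists_hasEigenvector
    have h := hv.apply_eq_smul
    refine ⟨0, ?_⟩
    simp only [jucysMurphy, Finset.univ_eq_empty, Finset.sum_empty, map_zero,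
      LinearMap.zero_apply] at h
    simpa using (smul_eq_zero.1 h.symm).resolve_right hv.2
  · intro α _ ih i₁ i₂ V _ _ _ ρ b hb
    have i₃ : DecidableEq α := Classical.decEq α
    obtain rfl : i₁ = instFintypeOption := Subsingleton.elim _ _
    obtain rfl : i₂ = Option.instDecidableEq := Subsingleton.elim _ _
    have hJ := congrArg ρ (jucysMurphy_option α)
    have hc := congrArg ρ (commute_jucysMurphy (Option α) (jucysMurphy α))
    have ih' := ih V (ρ.comp (mapDomainAlgHom ℂ ℂ (optionHom (Option α))))
    have hss : ρ (single (Equiv.swap none (some none)) 1) *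
        ρ (single (Equiv.swap none (some none)) 1) = 1 := by
      rw [← map_mul, single_mul_single, Equiv.swap_mul_self, mul_one, ← one_def, map_one]
    rw [map_add, map_mul, map_mul] at hJ
    rw [map_mul, map_mul] at hc
    rw [AlgHom.comp_apply] at ih'
    set s := ρ (single (Equiv.swap none (some none)) 1)
    set j := ρ (mapDomainAlgHom ℂ ℂ (optionHom (Option α)) (jucysMurphy α))
    set J := ρ (jucysMurphy (Option α))
    -- a joint eigenvector of `j` and `J`
    have hmaps : ∀ v ∈ J.eigenspace b, j v ∈ J.eigenspace b := by
      intro v hv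
      rw [Module.End.mem_eigenspace_iff] at hv ⊢
      rw [← Module.End.mul_apply, ← hc, Module.End.mul_apply, hv, map_smul]
    obtain ⟨u, hu⟩ := hb.exists_hasEigenvector
    have : Nontrivial (J.eigenspace b) := ⟨⟨u, hu.1⟩, 0, fun h => hu.2 (congrArg Subtype.val h)⟩
    obtain ⟨a, ha⟩ := Module.End.exists_eigenvalue (j.restrict hmaps)
    obtain ⟨⟨v, hvJ⟩, hv⟩ := ha.exists_hasEigenvector
    have hv0 : v ≠ 0 := fun h => hv.2 (Subtype.ext h)
    have hjv : j v = a • v := congrArg Subtype.val hv.apply_eq_smul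
    have hJv : J v = b • v := Module.End.mem_eigenspace_iff.1 hvJ
    have haZ : ∃ z : ℤ, a = z := ih' a (Module.End.hasEigenvalue_of_hasEigenvector
      ⟨Module.End.mem_eigenspace_iff.2 hjv, hv0⟩)
    by_cases hab : b - a = 0
    · rwa [sub_eq_zero.1 hab]
    have hjs : j (s v) = b • s v - v := by
      have h1 : s * J = 1 + j * s := by
        rw [hJ, mul_add, ← mul_assoc, ← mul_assoc, hss, one_mul]
      have h2 := congrArg (fun f => f v) h1
      simp only [Module.End.mul_apply, LinearMap.add_apply, Module.End.one_apply, hJv,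
        map_smul] at h2
      rw [h2, add_sub_cancel_left]
    -- if `s v` is a multiple of `v`, then `(b - a) ^ 2 = 1`; otherwise `s v - (b - a)⁻¹ v` is an
    -- eigenvector of `j` with eigenvalue `b`, to which the induction hypothesis applies
    by_cases hw : s v = (b - a)⁻¹ • v
    · have h3 : v = ((b - a)⁻¹ * (b - a)⁻¹) • v := by
        have := congrArg (fun f => f v) hss
        simp only [Module.End.mul_apply, Module.End.one_apply, hw, map_smul, smul_smul] at this
        exact this.symm
      have h4 : (b - a)⁻¹ * (b - a)⁻¹ = 1 := by
        by_contra hne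
        have h5 : ((b - a)⁻¹ * (b - a)⁻¹ - 1) • v = 0 := by
          rw [sub_smul, one_smul, ← h3, sub_self]
        exact (smul_ne_zero (sub_ne_zero.2 hne) hv0) h5
      obtain ⟨z, rfl⟩ := haZ
      rcases mul_self_eq_one_iff.1 h4 with h | h
      · rw [inv_eq_one] at h
        exact ⟨z + 1, by push_cast; linear_combination h⟩
      · rw [inv_eq_iff_eq_inv, inv_neg, inv_one] at h
        exact ⟨z - 1, by push_cast; linear_combination h⟩
    · refine ih' b (Module.End.hasEigenvalue_of_hasEigenvector (x := s v - (b - a)⁻¹ • v)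
        ⟨Module.End.mem_eigenspace_iff.2 ?_, sub_ne_zero.2 hw⟩)
      rw [map_sub, map_smul, hjs, hjv, smul_sub, smul_smul, smul_smul, sub_sub]
      congr 1
      nth_rewrite 1 [← one_smul ℂ v]
      rw [← add_smul]
      congr 1
      field_simp
      ring

/-- The weighted sum of all permutations, each loop counting for a factor `t`. -/
noncomputable def loopElement (t : ℂ) (α : Type) [Fintype α] [DecidableEq α] :
    MonoidAlgebra ℂ (Equiv.Perm α) :=
  ∑ σ : Equiv.Perm α, single σ (t ^ σ.orbits)

/-- Sorting the permutations of `α ∪ {∗}` by the image of `∗` factors the weighted sum over all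
permutations as `(t + J) T`, with `J` the Jucys–Murphy element and `T` the sum for `α`. -/
theorem loopElement_option (t : ℂ) : loopElement t (Option α) =
    (single 1 t + jucysMurphy α) * mapDomainAlgHom ℂ ℂ (optionHom α) (loopElement t α) := by
  rw [loopElement, ← Equiv.sum_comp Equiv.Perm.decomposeOption.symm, Fintype.sum_prod_type,
    Fintype.sum_option, add_mul, loopElement, map_sum]
  congr 1
  · rw [Finset.mul_sum]
    refine Finset.sum_congr rfl fun σ _ => ?_
    have : Equiv.Perm.decomposeOption.symm (none, σ) = optionHom α σ := by
      ext1 x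
      simp [Equiv.Perm.decomposeOption_symm_apply, optionHom]
    rw [this, orbits_optionHom]
    simp [single_mul_single, pow_succ']
  · rw [jucysMurphy, Finset.sum_mul]
    refine Finset.sum_congr rfl fun a _ => ?_
    rw [Finset.mul_sum]
    refine Finset.sum_congr rfl fun σ _ => ?_
    have : Equiv.Perm.decomposeOption.symm (some a, σ) =
        Equiv.swap none (some a) * optionHom α σ := by
      simp [Equiv.Perm.decomposeOption_symm_apply, optionHom]
    rw [this, orbits_swap_mul_optionHom]
    simp [single_mul_single]

/-- The sum `∑ t ^ (number of cycles of σ) • σ` acts injectively for `t ∉ ℤ`: it is a product of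
factors `t + J` with Jucys–Murphy elements `J`, whose eigenvalues are integers. -/
theorem loopElement_injective {t : ℂ} (ht : ∀ z : ℤ, t ≠ z) (V : Type) [AddCommGroup V]
    [Module ℂ V] [FiniteDimensional ℂ V]
    (ρ : MonoidAlgebra ℂ (Equiv.Perm α) →ₐ[ℂ] Module.End ℂ V) (v : V)
    (hv : ρ (loopElement t α) v = 0) : v = 0 := by
  refine Finite.induction_empty_option (P := fun α : Type => ∀ [Fintype α] [DecidableEq α]
    (V : Type) [AddCommGroup V] [Module ℂ V] [FiniteDimensional ℂ V]
    (ρ : MonoidAlgebra ℂ (Equiv.Perm α) →ₐ[ℂ] Module.End ℂ V) (v : V),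
    ρ (loopElement t α) v = 0 → v = 0) ?_ ?_ ?_ α V ρ v hv
  · intro α β e ih _ _ V _ _ _ ρ v hv
    classical
    have : Fintype α := Fintype.ofEquiv _ e.symm
    refine ih V (ρ.comp (mapDomainAlgHom ℂ ℂ e.permCongrHom.toMonoidHom)) v ?_
    rw [AlgHom.comp_apply]
    convert hv
    simp only [loopElement, map_sum]
    rw [← Equiv.sum_comp e.permCongrHom.toEquiv]
    refine Finset.sum_congr rfl fun σ _ => ?_
    simp only [mapDomainAlgHom_apply, mapDomain_single]
    rw [← orbits_permCongr e σ]
    rfl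
  · intro _ _ V _ _ _ ρ v hv
    have h0 : (1 : Equiv.Perm PEmpty.{1}).orbits = 0 := by
      rw [Equiv.Perm.orbits, Nat.card_eq_zero]
      exact Or.inl ⟨fun q => q.exists_rep.elim fun x _ => x.elim⟩
    have h1 : loopElement t PEmpty = 1 := by
      rw [loopElement, Fintype.sum_unique]
      change single (1 : Equiv.Perm PEmpty.{1}) (t ^ (1 : Equiv.Perm PEmpty.{1}).orbits) = 1
      rw [h0, pow_zero, one_def]
    rwa [h1, map_one] at hv
  · intro α _ ih i₁ i₂ V _ _ _ ρ v hv
    have i₃ : DecidableEq α := Classical.decEq α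
    obtain rfl : i₁ = instFintypeOption := Subsingleton.elim _ _
    obtain rfl : i₂ = Option.instDecidableEq := Subsingleton.elim _ _
    have h := loopElement_option α t
    rw [h, map_mul, Module.End.mul_apply] at hv
    refine ih V (ρ.comp (mapDomainAlgHom ℂ ℂ (optionHom α))) v ?_
    rw [AlgHom.comp_apply]
    set w := ρ (mapDomainAlgHom ℂ ℂ (optionHom α) (loopElement t α)) v
    by_contra hw
    have h1 : ρ (single 1 t) = t • 1 := by
      rw [show (single 1 t : MonoidAlgebra ℂ (Equiv.Perm (Option α))) = t • 1 by simp [one_def],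
        map_smul, map_one]
    rw [map_add, h1, LinearMap.add_apply, LinearMap.smul_apply, Module.End.one_apply] at hv
    obtain ⟨z, hz⟩ := jucysMurphy_eigenvalue α V ρ (-t)
      (Module.End.hasEigenvalue_of_hasEigenvector (x := w)
        ⟨Module.End.mem_eigenspace_iff.2 (by rw [neg_smul]; exact eq_neg_of_add_eq_zero_right hv),
          hw⟩)
    exact ht (-z) (by push_cast; rw [← hz, neg_neg])

/-- The matrix of the numbers `t ^ (number of cycles of ψ φ)` is nondegenerate for non-integral
`t`. -/
theorem orbits_form_nondegenerate {t : ℂ} (ht : ∀ z : ℤ, t ≠ z) (x : Equiv.Perm α → ℂ)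
    (hx : ∀ ψ : Equiv.Perm α, ∑ φ, x φ * t ^ (ψ * φ).orbits = 0) : x = 0 := by
  have hcoeff : ∀ σ, (loopElement t α).coeff σ = t ^ σ.orbits := by
    intro σ
    simp [loopElement, Finsupp.finsetSum_apply, Finsupp.single_apply]
  -- the hypothesis says that `X = ∑ x φ • φ⁻¹` is annihilated by the weighted sum of permutations
  let X : MonoidAlgebra ℂ (Equiv.Perm α) := ofCoeff (Finsupp.equivFunOnFinite.symm fun h => x h⁻¹)
  have h0 : loopElement t α * X = 0 := by
    ext ψ
    rw [coeff_mul_apply_right, Finsupp.sum_fintype _ _ (by simp), coeff_zero, Finsupp.zero_apply,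
      ← hx ψ, ← Equiv.sum_comp (Equiv.inv _)]
    refine Finset.sum_congr rfl fun φ _ => ?_
    rw [hcoeff]
    simp [X, mul_comm]
  have hX : X = 0 := loopElement_injective α ht _ (Algebra.lmul ℂ _) X h0
  funext φ
  have := congrArg (fun y => y.coeff φ⁻¹) hX
  simpa [X] using this

end JucysMurphy

/-! ### The flip and the trace on the oriented Brauer category -/

/-- A linear contravariant involution which is the identity on objects, together with a
nondegenerate trace. -/
structure TracedDagger (C : Type*) [Category C] [Preadditive C] [Linear ℂ C] where
  /-- the involution on morphisms -/
  dag : ∀ {X Y : C}, (X ⟶ Y) →ₗ[ℂ] (Y ⟶ X)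
  dag_dag : ∀ {X Y : C} (f : X ⟶ Y), dag (dag f) = f
  dag_comp : ∀ {X Y Z : C} (f : X ⟶ Y) (g : Y ⟶ Z), dag (f ≫ g) = dag g ≫ dag f
  /-- the trace of an endomorphism -/
  tr : ∀ {X : C}, (X ⟶ X) →ₗ[ℂ] ℂ
  tr_comm : ∀ {X Y : C} (f : X ⟶ Y) (g : Y ⟶ X), tr (f ≫ g) = tr (g ≫ f)
  nondeg : ∀ {X Y : C} (f : X ⟶ Y), (∀ g : Y ⟶ X, tr (f ≫ g) = 0) → f = 0

namespace OrientedBrauer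

namespace Diagram

open Letter

variable {u v w : List Letter}

/-- The reflection of a diagram in a horizontal line, with all strands reversed. -/
def flip (f : Diagram v w) : Diagram w v :=
  (Equiv.sumComm _ _).trans (f.symm.trans (Equiv.sumComm _ _))

@[simp] theorem flip_flip (f : Diagram v w) : f.flip.flip = f := by
  ext x
  simp [flip]

theorem compat_flip (f : Diagram v w) (c : Col v) (d : Col w) :
    f.flip.Compat d c ↔ f.Compat c d := by
  have h1 : ∀ z : Pt v Letter.up ⊕ Pt w Letter.down,
      Sum.elim d.2 c.1 (Equiv.sumComm _ _ z) = Sum.elim c.1 d.2 z := by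
    rintro (z | z) <;> rfl
  have h2 : ∀ z : Pt v Letter.down ⊕ Pt w Letter.up,
      Sum.elim d.1 c.2 (Equiv.sumComm _ _ z) = Sum.elim c.2 d.1 z := by
    rintro (z | z) <;> rfl
  constructor
  · intro h s
    have := h (Equiv.sumComm _ _ (f s))
    rw [h2] at this
    rw [← this, ← h1]
    congr 1
    simp [flip]
  · intro h s
    obtain ⟨s, rfl⟩ := (Equiv.sumComm _ _).surjective s
    obtain ⟨s, rfl⟩ := f.surjective s
    rw [h2, h, ← h1]
    congr 1
    simp [flip]

theorem mat_flip (f : Diagram v w) : mat f.flip = (mat f).transpose := by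
  classical
  ext c d
  simp only [mat, Matrix.of_apply, Matrix.transpose_apply]
  exact if_congr (compat_flip f d c) rfl rfl

/-- The flip reverses compositions and preserves the number of loops, since it corresponds to
transposing the matrices of the diagrams. -/
theorem flip_comp (f : Diagram u v) (g : Diagram v w) :
    (comp f g).flip = comp g.flip f.flip ∧ loops f g = loops g.flip f.flip := by
  apply mat_injective
  rw [← mat_mul, mat_flip, mat_flip, mat_flip, ← Matrix.transpose_smul, ← mat_mul,
    Matrix.transpose_mul]

/-- The permutation of the starting points of `f` obtained by gluing `f` and `g` cyclically. Its
orbits are the closed loops of the closure of the composition. -/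
def closure (f : Diagram v w) (g : Diagram w v) : Equiv.Perm (Pt v up ⊕ Pt w down) :=
  (f.trans (Equiv.sumComm _ _)).trans (g.trans (Equiv.sumComm _ _))

open Classical in
/-- The trace counts the two-colourings of the strands of the closure of the composition. -/
theorem trace_mat_mul (f : Diagram v w) (g : Diagram w v) :
    (mat f * mat g).trace = 2 ^ (closure f g).orbits := by
  have h1 : (mat f * mat g).trace =
      Nat.card {p : Col v × Col w // f.Compat p.1 p.2 ∧ g.Compat p.2 p.1} := by
    rw [Nat.card_eq_fintype_card, Fintype.card_subtype]
    simp only [Matrix.trace, Matrix.diag_apply, Matrix.mul_apply, mat, Matrix.of_apply, mul_ite,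
      mul_one, mul_zero, ← ite_and]
    rw [← Fintype.sum_prod_type', Finset.sum_boole, Nat.cast_id]
    simp only [and_comm]
  rw [h1, ← card_invColouring]
  have sw : ∀ {A B : Type} (a : A → Bool) (b : B → Bool) (z : A ⊕ B),
      Sum.elim b a (Equiv.sumComm _ _ z) = Sum.elim a b z := by
    rintro A B a b (z | z) <;> rfl
  have hinv : ∀ (c : Col v) (d : Col w), f.Compat c d → g.Compat d c →
      ∀ x, Sum.elim c.1 d.2 (closure f g x) = Sum.elim c.1 d.2 x := by
    intro c d hf hg x
    rw [← hf x, ← sw c.2 d.1, ← hg, ← sw d.2 c.1]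
    rfl
  exact Nat.card_congr
    { toFun := fun p => ⟨Sum.elim p.1.1.1 p.1.2.2, hinv _ _ p.2.1 p.2.2⟩
      invFun := fun k => ⟨((fun x => k.1 (Sum.inl x), fun x => k.1 (f.symm (Sum.inl x))),
          (fun x => k.1 (f.symm (Sum.inr x)), fun x => k.1 (Sum.inr x))), by
        have e1 : ∀ s, Sum.elim (fun x => k.1 (Sum.inl x)) (fun x => k.1 (Sum.inr x)) s =
            k.1 s := by
          rintro (s | s) <;> rfl
        have e2 : ∀ s, Sum.elim (fun x => k.1 (f.symm (Sum.inl x)))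
            (fun x => k.1 (f.symm (Sum.inr x))) s = k.1 (f.symm s) := by
          rintro (s | s) <;> rfl
        refine ⟨fun s => ?_, fun s => ?_⟩
        · rw [e1, e2, Equiv.symm_apply_apply]
        · obtain ⟨s, rfl⟩ := (Equiv.sumComm _ _).surjective s
          obtain ⟨s, rfl⟩ := f.surjective s
          change Sum.elim _ _ (g _) = Sum.elim _ _ (Equiv.sumComm _ _ (f s))
          rw [sw, e2, Equiv.symm_apply_apply, ← k.2 s, ← sw, e1]
          rfl⟩
      left_inv := by
        rintro ⟨⟨c, d⟩, hf, hg⟩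
        have key : ∀ s, Sum.elim c.1 d.2 (f.symm s) = Sum.elim c.2 d.1 s := by
          intro s
          rw [← hf, Equiv.apply_symm_apply]
        refine Subtype.ext (Prod.ext (Prod.ext rfl (funext fun x => key _))
          (Prod.ext (funext fun x => key _) rfl))
      right_inv := by
        rintro ⟨k, hk⟩
        refine Subtype.ext (funext ?_)
        rintro (s | s) <;> rfl }

/-- The number of loops of the closure of a diagram. -/
noncomputable def closedLoops (f : Diagram v v) : ℕ := (closure f (id v)).orbits

theorem loops_add_closedLoops (f : Diagram v w) (g : Diagram w v) :
    loops f g + closedLoops (comp f g) = (closure f g).orbits := by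
  apply Nat.pow_right_injective le_rfl
  simp only [pow_add]
  rw [closedLoops, ← trace_mat_mul, ← trace_mat_mul, mat_id, Matrix.mul_one, mat_mul,
    Matrix.trace_smul, smul_eq_mul]

theorem orbits_closure_comm (f : Diagram v w) (g : Diagram w v) :
    (closure f g).orbits = (closure g f).orbits := by
  apply Nat.pow_right_injective le_rfl
  simp only
  rw [← trace_mat_mul, ← trace_mat_mul, Matrix.trace_mul_comm]

end Diagram

open OBrauer

variable {t : ℂ}

/-- A diagram as a morphism. -/
noncomputable def ofDiagram {X Y : OBrauer ℂ t} (d : Diagram X.word Y.word) : X ⟶ Y :=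
  (Finsupp.single d 1 : Diagram X.word Y.word →₀ ℂ)

theorem ofDiagram_comp {X Y Z : OBrauer ℂ t} (f : Diagram X.word Y.word)
    (g : Diagram Y.word Z.word) :
    (ofDiagram f : X ⟶ Y) ≫ (ofDiagram g : Y ⟶ Z) = t ^ f.loops g • ofDiagram (f.comp g) := by
  change compLin t _ _ _ (Finsupp.single f 1) (Finsupp.single g 1) =
    t ^ f.loops g • (Finsupp.single _ 1 : _ →₀ ℂ)
  rw [compLin_single]
  simp

theorem ofDiagram_id (X : OBrauer ℂ t) : (ofDiagram (Diagram.id X.word) : X ⟶ X) = 𝟙 X := rfl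

/-- The basis of a morphism space given by the diagrams. -/
noncomputable def diagramBasis (X Y : OBrauer ℂ t) :
    Module.Basis (Diagram X.word Y.word) ℂ (X ⟶ Y) :=
  ⟨(LinearEquiv.refl ℂ (Diagram X.word Y.word →₀ ℂ) : _)⟩

@[simp] theorem diagramBasis_apply {X Y : OBrauer ℂ t} (d : Diagram X.word Y.word) :
    diagramBasis X Y d = ofDiagram d := rfl

instance {X Y : OBrauer ℂ t} : FiniteDimensional ℂ (X ⟶ Y) :=
  Module.Finite.of_basis (diagramBasis X Y)

theorem hom_induction {X Y : OBrauer ℂ t} {P : (X ⟶ Y) → Prop} (f : X ⟶ Y) (zero : P 0)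
    (add : ∀ f g, P f → P g → P (f + g)) (smul : ∀ (c : ℂ) d, P (c • ofDiagram d)) : P f := by
  have : f ∈ Submodule.span ℂ (Set.range (diagramBasis X Y)) := (diagramBasis X Y).mem_span f
  rw [← (diagramBasis X Y).sum_repr f]
  exact Finset.sum_induction _ P add zero fun d _ => smul _ d

/-- The flip of diagrams, extended linearly. -/
noncomputable def dagLin (X Y : OBrauer ℂ t) : (X ⟶ Y) →ₗ[ℂ] (Y ⟶ X) :=
  (diagramBasis X Y).constr ℂ fun d => ofDiagram d.flip

@[simp] theorem dagLin_ofDiagram {X Y : OBrauer ℂ t} (d : Diagram X.word Y.word) :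
    dagLin X Y (ofDiagram d) = ofDiagram d.flip := by
  rw [← diagramBasis_apply, dagLin, Module.Basis.constr_basis]

/-- The trace: close up a diagram and count a factor `t` for each loop. -/
noncomputable def trLin (X : OBrauer ℂ t) : (X ⟶ X) →ₗ[ℂ] ℂ :=
  (diagramBasis X X).constr ℂ fun d => t ^ d.closedLoops

@[simp] theorem trLin_ofDiagram {X : OBrauer ℂ t} (d : Diagram X.word X.word) :
    trLin X (ofDiagram d) = t ^ d.closedLoops := by
  rw [← diagramBasis_apply, trLin, Module.Basis.constr_basis]

theorem trLin_comp {X Y : OBrauer ℂ t} (f : Diagram X.word Y.word) (g : Diagram Y.word X.word) :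
    trLin X ((ofDiagram f : X ⟶ Y) ≫ (ofDiagram g : Y ⟶ X)) = t ^ (f.closure g).orbits := by
  rw [ofDiagram_comp, map_smul, trLin_ofDiagram, smul_eq_mul, ← pow_add,
    Diagram.loops_add_closedLoops]

/-- After composing with a fixed diagram, the matrix of the pairing `(f, g) ↦ tr (f ≫ g)` on
diagrams is that of `orbits_form_nondegenerate`. -/
theorem trLin_nondeg (ht : ∀ z : ℤ, t ≠ z) {X Y : OBrauer ℂ t} (f : X ⟶ Y)
    (h : ∀ g : Y ⟶ X, trLin X (f ≫ g) = 0) : f = 0 := by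
  classical
  apply (diagramBasis X Y).ext_elem
  intro d₀
  rw [map_zero, Finsupp.zero_apply]
  -- identify diagrams with permutations by means of the reference diagram `d₀`
  let e : Equiv.Perm (Pt X.word Letter.up ⊕ Pt Y.word Letter.down) ≃ Diagram X.word Y.word :=
    { toFun := fun φ => φ.trans d₀
      invFun := fun d => d.trans d₀.symm
      left_inv := fun φ => by ext; simp
      right_inv := fun d => by ext; simp }
  have key := orbits_form_nondegenerate _ ht (fun φ => (diagramBasis X Y).repr f (e φ)) (by
    intro ψ
    let g : Diagram Y.word X.word :=
      (Equiv.sumComm _ _).trans (d₀.symm.trans (ψ.trans (Equiv.sumComm _ _)))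
    have hg := h (ofDiagram g)
    rw [← (diagramBasis X Y).sum_repr f, Preadditive.sum_comp, map_sum,
      ← Equiv.sum_comp e] at hg
    rw [← hg]
    refine Finset.sum_congr rfl fun φ _ => ?_
    have hcl : (e φ).closure g = ψ * φ := by
      ext x
      simp [e, g, Diagram.closure]
    rw [Linear.smul_comp, map_smul, diagramBasis_apply, trLin_comp, hcl, smul_eq_mul])
  have h1 : e 1 = d₀ := by ext; simp [e]
  rw [← h1]
  exact congrFun key 1

/-- The flip and the trace of the oriented Brauer category. -/
noncomputable def tracedDagger (ht : ∀ z : ℤ, t ≠ z) : TracedDagger (OBrauer ℂ t) where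
  dag {X Y} := dagLin X Y
  dag_dag {X Y} f := by
    induction f using hom_induction with
    | zero => simp
    | add f g hf hg => rw [map_add, map_add, hf, hg]
    | smul c d => simp
  dag_comp {X Y Z} f g := by
    induction f using hom_induction with
    | zero => simp
    | add f f' hf hf' => rw [Preadditive.add_comp, map_add, hf, hf', map_add, Preadditive.comp_add]
    | smul c d =>
      induction g using hom_induction with
      | zero => simp
      | add g g' hg hg' =>
        rw [Preadditive.comp_add, map_add, hg, hg', map_add, Preadditive.add_comp]
      | smul c' d' =>
        simp only [Linear.smul_comp, Linear.comp_smul, map_smul, dagLin_ofDiagram, ofDiagram_comp,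
          (Diagram.flip_comp d d').1, (Diagram.flip_comp d d').2]
        rw [smul_comm c c']
  tr {X} := trLin X
  tr_comm {X Y} f g := by
    induction f using hom_induction with
    | zero => simp
    | add f f' hf hf' => rw [Preadditive.add_comp, map_add, hf, hf', Preadditive.comp_add, map_add]
    | smul c d =>
      induction g using hom_induction with
      | zero => simp
      | add g g' hg hg' =>
        rw [Preadditive.comp_add, map_add, hg, hg', Preadditive.add_comp, map_add]
      | smul c' d' =>
        simp only [Linear.smul_comp, Linear.comp_smul, map_smul, trLin_comp,
          Diagram.orbits_closure_comm d d']
        rw [smul_comm c c']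
  nondeg f h := trLin_nondeg ht f h

end OrientedBrauer

/-! ### Splitting off the morphisms through a smaller object -/

namespace TracedDagger

variable {C : Type*} [Category C] [Preadditive C] [Linear ℂ C] (D : TracedDagger C)

/-- The involution on the endomorphism algebra of an object. -/
def antiInv (X : C) : AntiInvolution (End X) where
  map := D.dag (X := X) (Y := X)
  map_mul f g := D.dag_comp g f
  map_map f := D.dag_dag f

variable {X' X : C}

/-- The endomorphisms of `X` that are sums of morphisms through `X'`. -/
def through (X' X : C) : AddSubgroup (End X) :=
  AddSubgroup.closure {a : X ⟶ X | ∃ (g : X ⟶ X') (f : X' ⟶ X), a = g ≫ f}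

/-- If the endomorphism algebra of `X'` splits into symmetric minimal idempotents, so does the ideal
of endomorphisms of `X` through `X'`, with a unit element `u` as the sum of the idempotents: if a
symmetric idempotent `u` does not act as identity on `Hom(X', X)`, then `β(k, l) p = k ≫ dag l`
defines a nonzero symmetric bilinear form on the morphisms `k` with `p ≫ k = k` and `k ≫ u = 0`, for
some symmetric minimal idempotent `p` of `X'`; if `β(l, l) = 1` then `dag l ≫ l` is a symmetric
minimal idempotent orthogonal to `u`. -/
theorem exists_unit_through [FiniteDimensional ℂ (End X)] {n' : ℕ}
    (h' : SymSplit (D.antiInv X') n' 1) :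
    ∃ (n : ℕ) (u : End X), SymSplit (D.antiInv X) n u ∧ u ∈ through X' X ∧
      ∀ f : X' ⟶ X, f ≫ (show X ⟶ X from u) = f := by
  classical
  let P : ℕ → Prop := fun n => ∃ u : End X, SymSplit (D.antiInv X) n u ∧ u ∈ through X' X
  have hbound : ∀ n, P n → n ≤ Module.finrank ℂ (End X) := fun n ⟨u, hu, _⟩ => hu.le_finrank
  have hP0 : P 0 := ⟨0, SymSplit.zero, AddSubgroup.zero_mem _⟩
  -- take `u` with as many summands as possible
  set N := Nat.findGreatest P (Module.finrank ℂ (End X)) with hN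
  obtain ⟨u, hu, huI⟩ : P N := Nat.findGreatest_spec (Nat.zero_le _) hP0
  refine ⟨N, u, hu, huI, ?_⟩
  by_contra! hne
  obtain ⟨f, hf⟩ := hne
  obtain ⟨p, hp, hpo, hps⟩ := h'.exists_family
  let u' : X ⟶ X := u
  have huu : u' ≫ u' = u' := hu.idem
  have hdu : D.dag u' = u' := hu.fixed
  set h : X' ⟶ X := f - f ≫ u' with hh
  have hh0 : h ≠ 0 := fun h0 => hf (sub_eq_zero.1 h0).symm
  have hhu : h ≫ u' = 0 := by rw [hh, Preadditive.sub_comp, Category.assoc, huu, sub_self]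
  obtain ⟨i, hi⟩ : ∃ i, (show X' ⟶ X' from p i) ≫ h ≠ 0 := by
    by_contra! H
    apply hh0
    have h1 : ∑ i, (show X' ⟶ X' from p i) = 𝟙 X' := hps
    rw [← Category.id_comp h, ← h1, Preadditive.sum_comp]
    exact Finset.sum_eq_zero fun i _ => H i
  let q : X' ⟶ X' := p i
  have hqq : q ≫ q = q := (hp i).idem
  have hdq : D.dag q = q := (hp i).fixed
  have hq0 : q ≠ 0 := (hp i).ne_zero
  have hsc : ∀ a : X' ⟶ X', ∃ c : ℂ, q ≫ a ≫ q = c • q := (hp i).scalar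
  -- the morphisms `k` with `q ≫ k = k` and `k ≫ u = 0`, with their bilinear form
  have hform : ∀ k l : X' ⟶ X, q ≫ k = k → q ≫ l = l → ∃ c : ℂ, k ≫ D.dag l = c • q := by
    intro k l hk hl
    obtain ⟨c, hc⟩ := hsc (k ≫ D.dag l)
    refine ⟨c, ?_⟩
    rw [← hc]
    conv_lhs => rw [← hk, ← hl, D.dag_comp, hdq]
    simp only [Category.assoc]
  -- the form is not alternating: otherwise polarization would make it zero, which contradicts the
  -- nondegeneracy of the trace
  obtain ⟨l, hql, hlu, c, hc0, hc⟩ : ∃ l : X' ⟶ X, q ≫ l = l ∧ l ≫ u' = 0 ∧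
      ∃ c : ℂ, c ≠ 0 ∧ l ≫ D.dag l = c • q := by
    by_contra! H
    have hzero : ∀ l : X' ⟶ X, q ≫ l = l → l ≫ u' = 0 → l ≫ D.dag l = 0 := by
      intro l h1 h2
      obtain ⟨c, hc⟩ := hform l l h1 h1
      by_cases hc0 : c = 0
      · rw [hc, hc0, zero_smul]
      · exact absurd hc (H l h1 h2 c hc0)
    set k := q ≫ h with hk
    have hqk : q ≫ k = k := by rw [hk, ← Category.assoc, hqq]
    have hku : k ≫ u' = 0 := by rw [hk, Category.assoc, hhu, comp_zero]
    apply hi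
    apply D.nondeg k
    intro g
    set k' : X' ⟶ X := D.dag ((𝟙 X - u') ≫ g ≫ q) with hk'
    have hqk' : q ≫ k' = k' := by
      rw [hk', D.dag_comp, D.dag_comp, hdq, ← Category.assoc, ← Category.assoc, hqq]
    have hk'u : k' ≫ u' = 0 := by
      have h1 : u' ≫ (𝟙 X - u') ≫ g ≫ q = 0 := by
        rw [← Category.assoc, Preadditive.comp_sub, Category.comp_id, huu, sub_self, zero_comp]
      calc k' ≫ u' = D.dag (u' ≫ (𝟙 X - u') ≫ g ≫ q) := by rw [D.dag_comp u', hdu]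
        _ = 0 := by rw [h1, map_zero]
    have hsum := hzero (k + k') (by rw [Preadditive.comp_add, hqk, hqk'])
      (by rw [Preadditive.add_comp, hku, hk'u, add_zero])
    obtain ⟨c, hc⟩ := hform k k' hqk hqk'
    have hsym : k' ≫ D.dag k = c • q := by
      rw [← D.dag_dag k', ← D.dag_comp, hc, map_smul, hdq]
    rw [map_add, Preadditive.add_comp, Preadditive.comp_add, Preadditive.comp_add,
      hzero k hqk hku, hzero k' hqk' hk'u, hc, hsym, zero_add, add_zero, ← two_smul ℂ,
      smul_smul] at hsum
    have hc0 : c = 0 := by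
      have := (smul_eq_zero.1 hsum).resolve_right hq0
      simpa using this
    have hkg : k ≫ g ≫ q = 0 := by
      rw [hk', D.dag_dag, Preadditive.sub_comp, Preadditive.comp_sub, Category.id_comp,
        ← Category.assoc k u', hku, zero_comp, sub_zero, hc0, zero_smul] at hc
      exact hc
    rw [← hqk, Category.assoc, D.tr_comm, Category.assoc, hkg, map_zero]
  -- rescale `l` to `m` with `m ≫ dag m = q`; then `dag m ≫ m` can be added to `u`
  obtain ⟨s, hs⟩ := IsAlgClosed.exists_pow_nat_eq c⁻¹ (n := 2) (by norm_num)
  set m := s • l with hm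
  have hqm : q ≫ m = m := by rw [hm, Linear.comp_smul, hql]
  have hmu : m ≫ u' = 0 := by rw [hm, Linear.smul_comp, hlu, smul_zero]
  have hmm : m ≫ D.dag m = q := by
    rw [hm, map_smul, Linear.smul_comp, Linear.comp_smul, hc, smul_smul, smul_smul,
      ← sq, hs, inv_mul_cancel₀ hc0, one_smul]
  have hdmq : D.dag m ≫ q = D.dag m := by
    conv_rhs => rw [← hqm, D.dag_comp, hdq]
  set r : X ⟶ X := D.dag m ≫ m with hr
  have hru : r ≫ u' = 0 := by rw [hr, Category.assoc, hmu, comp_zero]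
  have hdr : D.dag r = r := by rw [hr, D.dag_comp, D.dag_dag]
  have hur : u' ≫ r = 0 := by rw [← hdr, ← hdu, ← D.dag_comp, hru, map_zero]
  have hmin : MinSym (D.antiInv X) r := by
    refine ⟨fun h0 => hq0 ?_, ?_, hdr, fun a => ?_⟩
    · have h0' : r = 0 := h0
      have : m ≫ r ≫ D.dag m = q := by
        rw [hr, Category.assoc, hmm, ← Category.assoc, hmm, hqq]
      rw [← this, h0', zero_comp, comp_zero]
    · change r ≫ r = r
      rw [hr, Category.assoc, ← Category.assoc m, hmm, hqm]
    · let a' : X ⟶ X := a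
      obtain ⟨c, hc⟩ := hsc (m ≫ a' ≫ D.dag m)
      refine ⟨c, ?_⟩
      change r ≫ a' ≫ r = c • r
      have h1 : r ≫ a' ≫ r = D.dag m ≫ (q ≫ (m ≫ a' ≫ D.dag m) ≫ q) ≫ m := by
        rw [Category.assoc q, Category.assoc _ q m, hqm, ← Category.assoc (D.dag m) q, hdmq]
        simp only [hr, Category.assoc]
      rw [h1, hc, Linear.smul_comp, Linear.comp_smul, hqm]
  have hsplit : SymSplit (D.antiInv X) (N + 1) (u + (show End X from r)) := hu.add hmin hru hur
  have hrI : r ∈ through X' X := AddSubgroup.subset_closure ⟨_, _, rfl⟩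
  have hPN : P (N + 1) := ⟨_, hsplit, AddSubgroup.add_mem _ huI hrI⟩
  have := Nat.le_findGreatest (hbound _ hPN) hPN
  omega

/-- If modulo the morphisms through `X'` the endomorphisms of `X` come from a group algebra with a
complete family of symmetric minimal idempotents, and the endomorphism algebra of `X'` has one,
then so does the endomorphism algebra of `X`. -/
theorem exists_symSplit_of_through [FiniteDimensional ℂ (End X)]
    (h' : ∃ n', SymSplit (D.antiInv X') n' 1) {G : Type*} [Group G]
    (hG : ∃ n, SymSplit (groupInv G) n 1) (φ : MonoidAlgebra ℂ G →ₐ[ℂ] End X)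
    (hφ : ∀ x, (D.antiInv X).map (φ x) = φ ((groupInv G).map x))
    (hsum : ∀ a : End X, ∃ x, a - φ x ∈ through X' X) :
    ∃ n, SymSplit (D.antiInv X) n 1 := by
  obtain ⟨n', h'⟩ := h'
  obtain ⟨k, hk⟩ := hG
  obtain ⟨n, u, hu, huI, hfu⟩ := D.exists_unit_through (X := X) h'
  have hleft : ∀ a ∈ through X' X, u * a = a := by
    intro a ha
    refine AddSubgroup.closure_induction ?_ ?_ ?_ ?_ ha
    · rintro _ ⟨g, f, rfl⟩
      change (g ≫ f) ≫ _ = _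
      rw [Category.assoc, hfu]
    · exact mul_zero u
    · intro a b _ _ ha hb
      rw [mul_add, ha, hb]
    · intro a _ ha
      rw [mul_neg, ha]
  have hτI : ∀ a ∈ through X' X, (D.antiInv X).map a ∈ through X' X := by
    intro a ha
    refine AddSubgroup.closure_induction ?_ ?_ ?_ ?_ ha
    · rintro _ ⟨g, f, rfl⟩
      exact AddSubgroup.subset_closure ⟨_, _, D.dag_comp g f⟩
    · rw [map_zero]; exact AddSubgroup.zero_mem _
    · intro a b _ _ ha hb
      rw [map_add]; exact AddSubgroup.add_mem _ ha hb
    · intro a _ ha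
      rw [map_neg]; exact AddSubgroup.neg_mem _ ha
  have hright : ∀ a ∈ through X' X, a * u = a := by
    intro a ha
    have := congrArg (D.antiInv X).map (hleft _ (hτI a ha))
    rwa [AntiInvolution.map_mul, AntiInvolution.map_map, hu.fixed] at this
  have hmem : ∀ a : End X, u * a ∈ through X' X ∧ a * u ∈ through X' X := by
    intro a
    refine ⟨?_, ?_⟩
    · refine AddSubgroup.closure_induction (p := fun u _ => u * a ∈ through X' X) ?_ ?_ ?_ ?_ huI
      · rintro _ ⟨g, f, rfl⟩
        exact AddSubgroup.subset_closure ⟨(show X ⟶ X from a) ≫ g, f, (Category.assoc _ _ _).symm⟩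
      · rw [zero_mul]; exact AddSubgroup.zero_mem _
      · intro x y _ _ hx hy
        rw [add_mul]; exact AddSubgroup.add_mem _ hx hy
      · intro x _ hx
        rw [neg_mul]; exact AddSubgroup.neg_mem _ hx
    · refine AddSubgroup.closure_induction (p := fun u _ => a * u ∈ through X' X) ?_ ?_ ?_ ?_ huI
      · rintro _ ⟨g, f, rfl⟩
        exact AddSubgroup.subset_closure ⟨g, f ≫ (show X ⟶ X from a), Category.assoc _ _ _⟩
      · rw [mul_zero]; exact AddSubgroup.zero_mem _
      · intro x y _ _ hx hy
        rw [mul_add]; exact AddSubgroup.add_mem _ hx hy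
      · intro x _ hx
        rw [mul_neg]; exact AddSubgroup.neg_mem _ hx
  have hcentral : ∀ a : End X, u * a = a * u := fun a => by
    rw [← hright _ (hmem a).1, mul_assoc, hleft _ (hmem a).2]
  have huu := hu.idem
  have hvv : (1 - u) * (1 - u) = 1 - u := by
    rw [mul_sub, sub_mul, sub_mul, huu]; simp
  have hcv : ∀ a : End X, (1 - u) * a = a * (1 - u) := fun a => by
    rw [sub_mul, mul_sub, hcentral, one_mul, mul_one]
  have hvI : ∀ a ∈ through X' X, (1 - u) * a = 0 := fun a ha => by
    rw [sub_mul, one_mul, hleft a ha, sub_self]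
  have hprod : ∀ x y, φ x * (1 - u) * (φ y * (1 - u)) = φ (x * y) * (1 - u) := fun x y => by
    rw [mul_assoc, ← mul_assoc (1 - u), hcv, mul_assoc (φ y), hvv, ← mul_assoc, map_mul]
  -- multiply the idempotents of the group algebra by the central idempotent `1 - u`
  have main : ∀ (n : ℕ) (e : MonoidAlgebra ℂ G), SymSplit (groupInv G) n e →
      ∃ m, SymSplit (D.antiInv X) m (φ e * (1 - u)) := by
    intro n e he
    induction he with
    | zero => exact ⟨0, by rw [map_zero, zero_mul]; exact SymSplit.zero⟩
    | @add n e p he hp h1 h2 ih =>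
      obtain ⟨m, hm⟩ := ih
      by_cases hz : φ p * (1 - u) = 0
      · exact ⟨m, by rw [map_add, add_mul, hz, add_zero]; exact hm⟩
      refine ⟨m + 1, ?_⟩
      rw [map_add, add_mul]
      refine hm.add ⟨hz, by rw [hprod, hp.idem], ?_, fun a => ?_⟩ (by rw [hprod, h1]; simp)
        (by rw [hprod, h2]; simp)
      · rw [AntiInvolution.map_mul, hφ, hp.fixed, map_sub, hu.fixed, ← hcv]
        congr 2
        have := (D.antiInv X).map_mul 1 ((D.antiInv X).map 1)
        rw [one_mul, AntiInvolution.map_map, one_mul] at this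
        exact this.symm
      · obtain ⟨x, hx⟩ := hsum a
        obtain ⟨c, hc⟩ := hp.scalar x
        refine ⟨c, ?_⟩
        have e1 : φ p * (1 - u) * a = φ p * (1 - u) * φ x := by
          have := hvI _ hx
          rw [mul_sub, sub_eq_zero] at this
          rw [mul_assoc, this, mul_assoc]
        rw [e1, mul_assoc (φ p) (1 - u) (φ x), hcv, ← mul_assoc (φ p) (φ x), ← map_mul, hprod, hc,
          map_smul, smul_mul_assoc]
  obtain ⟨m, hm⟩ := main k 1 hk
  rw [map_one, one_mul] at hm
  refine ⟨n + m, ?_⟩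
  have := hu.add_split hm (by rw [mul_sub, mul_one, huu, sub_self])
    (by rw [sub_mul, one_mul, huu, sub_self])
  rwa [add_sub_cancel] at this

end TracedDagger

/-! ### The endomorphism algebras of the tensor powers -/

namespace OrientedBrauer

open Letter

/-- Extending an equivalence `Option A ≃ B` by a further summand. -/
def optionSum {A B : Type} (e : Option A ≃ B) (K : Type) : Option (A ⊕ K) ≃ B ⊕ K where
  toFun x := x.elim (Sum.inl (e none)) (Sum.map (fun a => e (some a)) fun k => k)
  invFun := Sum.elim (fun b => (e.symm b).map Sum.inl) fun k => some (Sum.inr k)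
  left_inv := by rintro (_ | _ | _) <;> simp
  right_inv := by
    rintro (b | k)
    · obtain ⟨x, rfl⟩ := e.surjective b
      cases x <;> simp
    · rfl

namespace Diagram

variable {v v' w : List Letter} (pu : Option (Pt v' up) ≃ Pt v up)
  (pd : Option (Pt v' down) ≃ Pt v down)

/-- The diagram with a single cap, joining the points `pu none` and `pd none`, all other strands
being vertical. -/
def cap : Diagram v v' where
  toFun := Sum.elim
    (fun p => (pu.symm p).elim (Sum.inl (pd none)) Sum.inr) fun q => Sum.inl (pd (some q))
  invFun := Sum.elim
    (fun q => (pd.symm q).elim (Sum.inl (pu none)) Sum.inr) fun p => Sum.inl (pu (some p))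
  left_inv := by
    rintro (p | q)
    · obtain ⟨x, rfl⟩ := pu.surjective p
      cases x <;> simp
    · simp
  right_inv := by
    rintro (q | p)
    · obtain ⟨x, rfl⟩ := pd.surjective q
      cases x <;> simp
    · simp

/-- The diagram obtained by removing the strand from `pu none` to `pd none`. -/
def removeCap (d : Diagram v w) : Diagram v' w :=
  Equiv.removeNone ((optionSum pu _).trans (d.trans (optionSum pd _).symm))

variable {pu pd}

theorem removeCap_spec {d : Diagram v w} (h : d (Sum.inl (pu none)) = Sum.inl (pd none))
    (z : Pt v' up ⊕ Pt w down) :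
    d (optionSum pu _ (some z)) = optionSum pd _ (some (d.removeCap pu pd z)) := by
  have hnone : ((optionSum pu _).trans (d.trans (optionSum pd _).symm)) none = none := by
    change (optionSum pd _).symm (d (Sum.inl (pu none))) = none
    rw [h, Equiv.symm_apply_eq]
    rfl
  rw [removeCap, Equiv.removeNone_some]
  · simp
  · refine Option.ne_none_iff_exists'.1 fun h' => ?_
    exact absurd (Equiv.injective _ (h'.trans hnone.symm)) (by simp)

/-- The colouring of the points other than the end points of the cap. -/
def restr (pu : Option (Pt v' up) ≃ Pt v up) (pd : Option (Pt v' down) ≃ Pt v down) (c : Col v) :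
    Col v' :=
  (fun p => c.1 (pu (some p)), fun q => c.2 (pd (some q)))

theorem compat_cap (c : Col v) (k : Col v') :
    (cap pu pd).Compat c k ↔ c.1 (pu none) = c.2 (pd none) ∧ k = restr pu pd c := by
  constructor
  · intro h
    refine ⟨?_, Prod.ext (funext fun p => ?_) (funext fun q => ?_)⟩
    · have := h (Sum.inl (pu none))
      simpa [cap] using this.symm
    · have := h (Sum.inl (pu (some p)))
      simpa [cap, restr] using this
    · have := h (Sum.inr q)
      simpa [cap, restr] using this.symm
  · rintro ⟨h, rfl⟩ (p | q)
    · obtain ⟨x, rfl⟩ := pu.surjective p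
      cases x with
      | none => simpa [cap] using h.symm
      | some x => simp [cap, restr]
    · simp [cap, restr]

theorem compat_removeCap {d : Diagram v w} (h : d (Sum.inl (pu none)) = Sum.inl (pd none))
    (c : Col v) (e : Col w) : d.Compat c e ↔
      c.1 (pu none) = c.2 (pd none) ∧ (d.removeCap pu pd).Compat (restr pu pd c) e := by
  have h1 : ∀ z, Sum.elim c.1 e.2 (optionSum pu _ (some z)) =
      Sum.elim (restr pu pd c).1 e.2 z := by rintro (z | z) <;> rfl
  have h2 : ∀ z, Sum.elim c.2 e.1 (optionSum pd _ (some z)) =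
      Sum.elim (restr pu pd c).2 e.1 z := by rintro (z | z) <;> rfl
  constructor
  · intro H
    refine ⟨?_, fun z => ?_⟩
    · have := H (Sum.inl (pu none))
      rw [h] at this
      exact this.symm
    · rw [← h2, ← removeCap_spec h, H, h1]
  · rintro ⟨H1, H2⟩ x
    obtain ⟨y, rfl⟩ := (optionSum pu _).surjective x
    cases y with
    | none =>
      change Sum.elim _ _ (d (Sum.inl (pu none))) = c.1 (pu none)
      rw [h]
      exact H1.symm
    | some z => rw [removeCap_spec h, h2, H2, h1]

/-- A diagram with a cap factors through the word without the two end points of the cap. -/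
theorem cap_comp_removeCap {d : Diagram v w} (h : d (Sum.inl (pu none)) = Sum.inl (pd none)) :
    comp (cap pu pd) (d.removeCap pu pd) = d ∧ loops (cap pu pd) (d.removeCap pu pd) = 0 := by
  classical
  apply mat_injective
  rw [← mat_mul, pow_zero, one_smul]
  ext c e
  simp only [Matrix.mul_apply, mat, Matrix.of_apply, mul_ite, mul_one, mul_zero, ← ite_and,
    compat_cap, compat_removeCap h c e]
  by_cases H : c.1 (pu none) = c.2 (pd none)
  · simp only [H, true_and]
    rw [Finset.sum_eq_single (restr pu pd c)]
    · simp
    · intro k _ hk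
      simp [hk]
    · simp
  · simp [H]

/-- The diagram without caps and cups given by a permutation of the upward strands and one of the
downward strands. -/
def ofPerm (σ : Equiv.Perm (Pt v up) × Equiv.Perm (Pt v down)) : Diagram v v :=
  (Equiv.sumCongr σ.1 σ.2⁻¹).trans (Equiv.sumComm _ _)

theorem compat_ofPerm (σ : Equiv.Perm (Pt v up) × Equiv.Perm (Pt v down)) (c d : Col v) :
    (ofPerm σ).Compat c d ↔ c = (d.1 ∘ σ.1, d.2 ∘ σ.2) := by
  constructor
  · intro h
    refine Prod.ext (funext fun p => (h (Sum.inl p)).symm) (funext fun q => ?_)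
    have := h (Sum.inr (σ.2 q))
    change c.2 (σ.2.symm (σ.2 q)) = d.2 (σ.2 q) at this
    rwa [Equiv.symm_apply_apply] at this
  · rintro rfl (p | q)
    · rfl
    · change d.2 (σ.2 (σ.2.symm q)) = d.2 q
      rw [Equiv.apply_symm_apply]

theorem ofPerm_comp (σ τ : Equiv.Perm (Pt v up) × Equiv.Perm (Pt v down)) :
    comp (ofPerm σ) (ofPerm τ) = ofPerm (τ * σ) ∧ loops (ofPerm σ) (ofPerm τ) = 0 := by
  classical
  apply mat_injective
  rw [← mat_mul, pow_zero, one_smul]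
  ext c e
  simp only [Matrix.mul_apply, mat, Matrix.of_apply, mul_ite, mul_one, mul_zero, ← ite_and,
    compat_ofPerm]
  rw [Finset.sum_eq_single (e.1 ∘ τ.1, e.2 ∘ τ.2)]
  · simp only [true_and]
    rfl
  · intro k _ hk
    simp [hk]
  · simp

theorem ofPerm_one : ofPerm (1 : Equiv.Perm (Pt v up) × Equiv.Perm (Pt v down)) = id v := by
  ext x
  rcases x with x | x <;> rfl

theorem flip_ofPerm (σ : Equiv.Perm (Pt v up) × Equiv.Perm (Pt v down)) :
    (ofPerm σ).flip = ofPerm σ⁻¹ := by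
  ext x
  rcases x with x | x <;> rfl

/-- A diagram without caps is given by permutations. -/
theorem exists_ofPerm (d : Diagram v v) (h : ∀ p q, d (Sum.inl p) ≠ Sum.inl q) :
    ∃ σ, d = ofPerm σ := by
  have h1 : Set.MapsTo (d.trans (Equiv.sumComm _ _) : Equiv.Perm (Pt v up ⊕ Pt v down))
      (Set.range Sum.inl) (Set.range Sum.inl) := by
    rintro _ ⟨p, rfl⟩
    obtain ⟨z, hz⟩ : ∃ z, d (Sum.inl p) = z := ⟨_, rfl⟩
    rcases z with q | p'
    · exact absurd hz (h p q)
    · exact ⟨p', by simp [hz]⟩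
  obtain ⟨⟨σ, τ⟩, hσ⟩ := Equiv.Perm.mem_sumCongrHom_range_of_perm_mapsTo_inl h1
  refine ⟨(σ, τ⁻¹), ?_⟩
  have : d = ((d.trans (Equiv.sumComm _ _) : Equiv.Perm (Pt v up ⊕ Pt v down))).trans
      (Equiv.sumComm _ _) := by ext x; simp
  rw [this, ← hσ]
  ext x
  rcases x with x | x <;> simp [ofPerm]

/-- Diagrams fixed by the flip are involutions of the boundary points of the word. -/
theorem card_flip_eq : Nat.card {d : Diagram v v // d.flip = d} =
    Nat.card {σ : Equiv.Perm (Pt v up ⊕ Pt v down) // σ * σ = 1} := by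
  refine Nat.card_congr (Equiv.subtypeEquiv
    { toFun := fun d => d.trans (Equiv.sumComm _ _)
      invFun := fun σ => σ.trans (Equiv.sumComm _ _)
      left_inv := fun d => by ext x; simp
      right_inv := fun σ => by ext x; simp } fun d => ?_)
  rw [← inv_eq_iff_mul_eq_one]
  constructor
  · intro h
    ext1 x
    change d.symm (Equiv.sumComm _ _ x) = Equiv.sumComm _ _ (d x)
    conv_rhs => rw [← h]
    simp [flip]
  · intro h
    ext1 x
    have := congrArg (fun σ => Equiv.sumComm _ _ (σ x)) h
    simpa [flip] using this

end Diagram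

variable {t : ℂ}

/-- Permutations acting on the strands of a word. -/
noncomputable def permHom (X : OBrauer ℂ t) :
    Equiv.Perm (Pt X.word up) × Equiv.Perm (Pt X.word down) →* End X where
  toFun σ := ofDiagram (Diagram.ofPerm σ)
  map_one' := by rw [Diagram.ofPerm_one]; rfl
  map_mul' σ τ := by
    change _ = (ofDiagram (Diagram.ofPerm τ) : X ⟶ X) ≫ ofDiagram (Diagram.ofPerm σ)
    rw [ofDiagram_comp, (Diagram.ofPerm_comp τ σ).1, (Diagram.ofPerm_comp τ σ).2, pow_zero,
      one_smul]

instance (X : OBrauer ℂ t) : FiniteDimensional ℂ (End X) :=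
  inferInstanceAs (FiniteDimensional ℂ (X ⟶ X))

/-- If `X'` has one letter of each kind less than `X`, then the diagrams of `X` with a cap factor
through `X'` and the others are given by permutations, so a splitting for `X'` yields one for
`X`. -/
theorem exists_symSplit_step (ht : ∀ z : ℤ, t ≠ z) {X' X : OBrauer ℂ t}
    (hu : Nat.card (Pt X.word up) = Nat.card (Pt X'.word up) + 1)
    (hd : Nat.card (Pt X.word down) = Nat.card (Pt X'.word down) + 1)
    (h : ∃ n, SymSplit ((tracedDagger ht).antiInv X') n 1) :
    ∃ n, SymSplit ((tracedDagger ht).antiInv X) n 1 := by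
  classical
  -- any point `b` may serve as the end point of the cap
  have equ : ∀ (A B : Type) [Finite A] [Finite B] (_ : Nat.card B = Nat.card A + 1) (b : B),
      ∃ e : Option A ≃ B, e none = b := by
    intro A B _ _ h b
    have := Fintype.ofFinite A
    have := Fintype.ofFinite B
    rw [Nat.card_eq_fintype_card, Nat.card_eq_fintype_card, ← Fintype.card_option] at h
    obtain ⟨e⟩ := Fintype.card_eq.1 h.symm
    exact ⟨e.trans (Equiv.swap (e none) b), by simp⟩
  refine (tracedDagger ht).exists_symSplit_of_through h (exists_symSplit_perm_prod _ _)
    (MonoidAlgebra.lift ℂ _ _ (permHom X)) (fun x => ?_) (fun a => ?_)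
  · induction x using MonoidAlgebra.induction_linear with
    | zero => simp
    | add x y hx hy => rw [map_add, map_add, hx, hy, map_add, map_add]
    | single σ r =>
      rw [groupInv_single, MonoidAlgebra.lift_single, MonoidAlgebra.lift_single, map_smul]
      congr 1
      change dagLin X X (ofDiagram _) = ofDiagram _
      rw [dagLin_ofDiagram, Diagram.flip_ofPerm]
  · induction (show X ⟶ X from a) using hom_induction with
    | zero => exact ⟨0, by rw [map_zero, sub_zero]; exact AddSubgroup.zero_mem _⟩
    | add f g hf hg =>
      obtain ⟨x, hx⟩ := hf
      obtain ⟨y, hy⟩ := hg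
      refine ⟨x + y, ?_⟩
      rw [map_add, add_sub_add_comm]
      exact AddSubgroup.add_mem _ hx hy
    | smul c d =>
      by_cases hcap : ∃ p q, d (Sum.inl p) = Sum.inl q
      · obtain ⟨p, q, hpq⟩ := hcap
        obtain ⟨pu, rfl⟩ := equ _ _ hu p
        obtain ⟨pd, rfl⟩ := equ _ _ hd q
        refine ⟨0, ?_⟩
        rw [map_zero, sub_zero]
        refine AddSubgroup.subset_closure ⟨c • ofDiagram (Diagram.cap pu pd),
          ofDiagram (Diagram.removeCap pu pd d), ?_⟩
        rw [Linear.smul_comp, ofDiagram_comp, (Diagram.cap_comp_removeCap hpq).1,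
          (Diagram.cap_comp_removeCap hpq).2, pow_zero, one_smul]
      · push Not at hcap
        obtain ⟨σ, rfl⟩ := Diagram.exists_ofPerm d hcap
        refine ⟨MonoidAlgebra.single σ c, ?_⟩
        rw [MonoidAlgebra.lift_single]
        have : c • (ofDiagram (Diagram.ofPerm σ) : X ⟶ X) = c • permHom X σ := rfl
        rw [this, sub_self]
        exact AddSubgroup.zero_mem _

theorem card_pt (w : List Letter) (o : Letter) : Nat.card (Pt w o) = w.count o := by
  rw [Nat.card_eq_fintype_card, Fintype.card_subtype, Finset.card_filter]
  induction w with
  | nil => rfl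
  | cons a w ih =>
    have h : ∑ i : Fin (a :: w).length, (if (a :: w).get i = o then 1 else 0) =
        (if a = o then 1 else 0) + ∑ i : Fin w.length, (if w.get i = o then 1 else 0) :=
      Fin.sum_univ_succ (n := w.length) fun i => if (a :: w).get i = o then 1 else 0
    rw [h, ih, List.count_cons, add_comm]
    simp

theorem card_pt_tensorPow (n : ℕ) (o : Letter) :
    Nat.card (Pt ((upDown ℂ t).tensorPow n).word o) = n := by
  rw [card_pt]
  induction n with
  | zero => rfl
  | succ n ih =>
    change List.count o (((upDown ℂ t).tensorPow n).word ++ [up, down]) = n + 1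
    rw [List.count_append, ih]
    cases o <;> rfl

theorem exists_symSplit_tensorPow (ht : ∀ z : ℤ, t ≠ z) (n : ℕ) :
    ∃ m, SymSplit ((tracedDagger ht).antiInv ((upDown ℂ t).tensorPow n)) m 1 := by
  induction n with
  | zero =>
    have hsub : Subsingleton (Diagram ([] : List Letter) []) := by
      have : ∀ o, IsEmpty (Pt [] o) := fun o => ⟨fun x => x.1.elim0⟩
      exact ⟨fun a b => Equiv.ext fun x => by rcases x with x | x <;> exact isEmptyElim x⟩
    have hsc : ∀ a : ((upDown ℂ t).tensorPow 0) ⟶ ((upDown ℂ t).tensorPow 0),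
        ∃ c : ℂ, a = c • 𝟙 _ := by
      intro a
      induction a using hom_induction with
      | zero => exact ⟨0, by simp⟩
      | add f g hf hg =>
        obtain ⟨c, rfl⟩ := hf
        obtain ⟨c', rfl⟩ := hg
        exact ⟨c + c', by rw [add_smul]⟩
      | smul c d =>
        refine ⟨c, ?_⟩
        rw [← ofDiagram_id]
        congr 2
        exact hsub.elim _ _
    refine ⟨1, MinSym.symSplit ⟨?_, one_mul 1, ?_, fun a => ?_⟩⟩
    · exact (diagramBasis _ _).ne_zero (Diagram.id ((upDown ℂ t).tensorPow 0).word)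
    · change dagLin _ _ (𝟙 _) = 𝟙 _
      rw [← ofDiagram_id, dagLin_ofDiagram]
      exact congrArg ofDiagram (hsub.elim _ _)
    · obtain ⟨c, hc⟩ := hsc a
      exact ⟨c, by rw [one_mul, mul_one]; exact hc⟩
  | succ n ih =>
    exact exists_symSplit_step ht (by rw [card_pt_tensorPow, card_pt_tensorPow])
      (by rw [card_pt_tensorPow, card_pt_tensorPow]) ih

/-- The number of minimal symmetric idempotents of the tensor power is the number of diagrams fixed
by the flip, that is, the number of involutions of `2 n` points. -/
theorem symSplit_tensorPow (ht : ∀ z : ℤ, t ≠ z) (n : ℕ) :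
    SymSplit ((tracedDagger ht).antiInv ((upDown ℂ t).tensorPow n))
      (Nat.card {σ : Equiv.Perm (Fin (2 * n)) // σ * σ = 1}) 1 := by
  obtain ⟨m, hm⟩ := exists_symSplit_tensorPow ht n
  have h1 := hm.eq_card_fixed (diagramBasis _ _) Diagram.flip (fun d => dagLin_ofDiagram d)
  have h2 : Nat.card {σ : Equiv.Perm (Pt ((upDown ℂ t).tensorPow n).word up ⊕
      Pt ((upDown ℂ t).tensorPow n).word down) // σ * σ = 1} =
      Nat.card {σ : Equiv.Perm (Fin (2 * n)) // σ * σ = 1} := by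
    have hc : Nat.card (Pt ((upDown ℂ t).tensorPow n).word up ⊕
      Pt ((upDown ℂ t).tensorPow n).word down) = 2 * n := by
      rw [Nat.card_sum, card_pt_tensorPow, card_pt_tensorPow, two_mul]
    let e := (Finite.equivFinOfCardEq hc).permCongrHom
    refine Nat.card_congr (e.toEquiv.subtypeEquiv fun σ => ?_)
    change _ ↔ e σ * e σ = 1
    rw [← map_mul, EmbeddingLike.map_eq_one_iff]
  rw [Diagram.card_flip_eq, h2] at h1
  rwa [← h1]

end OrientedBrauer

/-! ### Counting indecomposable summands -/

section Summands

variable {C K : Type*} [Category C] [Preadditive C] [Category K] [Preadditive K]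
  (F : C ⥤ K) [F.Faithful] [F.Additive]

/-- A retract of `F X` cut out by an idempotent `p` with `p End(X) p = ℂ p` is indecomposable. -/
theorem indecomposable_of_scalar [Linear ℂ C] [HasBinaryBiproducts K] [F.Full] {X : C}
    {p : X ⟶ X} (h0 : p ≠ 0)
    (hsc : ∀ a : X ⟶ X, ∃ c : ℂ, p ≫ a ≫ p = c • p) {Y : K} (i : Y ⟶ F.obj X) (e : F.obj X ⟶ Y)
    (hie : i ≫ e = 𝟙 Y) (hei : e ≫ i = F.map p) : Indecomposable Y := by
  refine ⟨fun hz => h0 (F.map_injective ?_), fun A B φ => ?_⟩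
  · rw [← hei, hz.eq_of_tgt e 0, zero_comp, F.map_zero]
  · set f : Y ⟶ Y := φ.hom ≫ biprod.fst ≫ biprod.inl ≫ φ.inv with hf
    have hff : f ≫ f = f := by simp [hf]
    -- the projection `f` onto `A` corresponds to an idempotent in `p End(X) p = ℂ p`, so it is
    -- `0` or `1`
    obtain ⟨a, ha⟩ := F.map_surjective (e ≫ f ≫ i)
    obtain ⟨c, hc⟩ := hsc a
    have hpp : p ≫ p = p := F.map_injective (by
      rw [F.map_comp, ← hei, Category.assoc, reassoc_of% hie])
    have hac : a = c • p := by
      rw [← hc]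
      apply F.map_injective
      rw [F.map_comp, F.map_comp, ha, ← hei]
      simp only [Category.assoc, reassoc_of% hie]
    have haa : a ≫ a = a := F.map_injective (by
      rw [F.map_comp, ha]
      simp only [Category.assoc, reassoc_of% hie, reassoc_of% hff])
    have hcc : c = 0 ∨ c = 1 := by
      rw [hac, Linear.smul_comp, Linear.comp_smul, hpp, smul_smul] at haa
      have h1 : (c * c - c) • p = 0 := by rw [sub_smul, haa, sub_self]
      have h2 := (smul_eq_zero.1 h1).resolve_right h0
      have h3 : c * (c - 1) = 0 := by linear_combination h2
      rcases mul_eq_zero.1 h3 with h | h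
      · exact Or.inl h
      · exact Or.inr (sub_eq_zero.1 h)
    have hfi : f = i ≫ (e ≫ f ≫ i) ≫ e := by
      simp only [Category.assoc, reassoc_of% hie, hie, Category.comp_id]
    rcases hcc with rfl | rfl
    · left
      rw [zero_smul] at hac
      rw [← ha, hac, F.map_zero, zero_comp, comp_zero] at hfi
      rw [IsZero.iff_id_eq_zero]
      have : 𝟙 A = biprod.inl ≫ φ.inv ≫ f ≫ φ.hom ≫ biprod.fst := by simp [hf]
      rw [this, hfi]
      simp
    · right
      rw [one_smul] at hac
      rw [← ha, hac, ← hei, Category.assoc, hie, Category.comp_id, hie] at hfi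
      rw [IsZero.iff_id_eq_zero]
      have h1 : 𝟙 B = biprod.inr ≫ φ.inv ≫ f ≫ φ.hom ≫ biprod.snd := by rw [hfi]; simp
      rw [h1, hf]
      simp

/-- The images in `K` of the members of a complete family of minimal idempotents are the
indecomposable summands. -/
theorem isSumOfIndecomposables_of_symSplit [Linear ℂ C] [HasFiniteBiproducts K]
    [IsIdempotentComplete K] [F.Full] (D : TracedDagger C) {X : C} {n : ℕ}
    (h : SymSplit (D.antiInv X) n 1) : IsSumOfIndecomposables (F.obj X) n := by
  obtain ⟨p', hp, hpo, hps⟩ := h.exists_family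
  let p : Fin n → (X ⟶ X) := p'
  have hpp : ∀ i, p i ≫ p i = p i := fun i => (hp i).idem
  have hpo' : ∀ i j, i ≠ j → p i ≫ p j = 0 := fun i j hij => hpo j i hij.symm
  have hps' : ∑ i, p i = 𝟙 X := hps
  choose Y ι π hιπ hπι using fun i => IsIdempotentComplete.idempotents_split (F.obj X) (F.map (p i))
    (by rw [← F.map_comp, hpp])
  have hzero : ∀ i j, i ≠ j → ι i ≫ π j = 0 := by
    intro i j hij
    have : ι i ≫ π j = ι i ≫ (π i ≫ ι i) ≫ (π j ≫ ι j) ≫ π j := by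
      simp only [Category.assoc, reassoc_of% hιπ, hιπ, Category.comp_id]
    rw [this, hπι, hπι, ← Category.assoc (F.map _), ← F.map_comp, hpo' i j hij, F.map_zero,
      zero_comp, comp_zero]
  have : HasBinaryBiproducts K := hasBinaryBiproducts_of_finite_biproducts K
  refine ⟨Y, fun i => indecomposable_of_scalar F (hp i).ne_zero (fun a => ?_) (ι i) (π i) (hιπ i)
    (hπι i), ⟨⟨biproduct.lift π, biproduct.desc ι, ?_, ?_⟩⟩⟩
  · obtain ⟨c, hc⟩ := (hp i).scalar a
    exact ⟨c, hc⟩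
  · rw [biproduct.lift_desc]
    simp only [hπι]
    rw [← F.map_sum, hps', F.map_id]
  · apply biproduct.hom_ext'
    intro i
    apply biproduct.hom_ext
    intro j
    simp only [biproduct.ι_desc_assoc, Category.assoc, biproduct.lift_π, Category.comp_id]
    by_cases hij : i = j
    · subst hij
      rw [hιπ, biproduct.ι_π_self]
    · rw [hzero i j hij, biproduct.ι_π_ne _ hij]

/-- An idempotent of `X` whose image in `K` is a retract isomorphic to an indecomposable object is
primitive. -/
theorem primitive_of_indecomposable [HasBinaryBiproducts K] [IsIdempotentComplete K] {X : C}
    {q : X ⟶ X} {Y : K}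
    (hY : Indecomposable Y) (α : Y ⟶ F.obj X) (β : F.obj X ⟶ Y) (hαβ : α ≫ β = 𝟙 Y)
    (hβα : β ≫ α = F.map q) (r s : X ⟶ X) (hr : r ≫ r = r) (hs : s ≫ s = s) (hrs : r ≫ s = 0)
    (hsr : s ≫ r = 0) (hq : r + s = q) : r = 0 ∨ s = 0 := by
  obtain ⟨Yr, ir, er, hr1, hr2⟩ := IsIdempotentComplete.idempotents_split (F.obj X) (F.map r)
    (by rw [← F.map_comp, hr])
  obtain ⟨Ys, is, es, hs1, hs2⟩ := IsIdempotentComplete.idempotents_split (F.obj X) (F.map s)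
    (by rw [← F.map_comp, hs])
  have key : ∀ (x y : X ⟶ X) {A B : K} (i : A ⟶ F.obj X) (e : F.obj X ⟶ A) (j : B ⟶ F.obj X)
      (f : F.obj X ⟶ B), i ≫ e = 𝟙 A → e ≫ i = F.map x → j ≫ f = 𝟙 B → f ≫ j = F.map y →
      i ≫ β ≫ α ≫ f = i ≫ F.map (x ≫ q ≫ y) ≫ f := by
    intro x y A B i e j f h1 h2 h3 h4
    rw [F.map_comp, F.map_comp, ← h2, ← h4, ← hβα]
    simp only [Category.assoc, reassoc_of% h1, h3, Category.comp_id]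
  have hrr : ir ≫ β ≫ α ≫ er = 𝟙 _ := by
    rw [key r r ir er ir er hr1 hr2 hr1 hr2, ← hq, Preadditive.add_comp, Preadditive.comp_add, hr,
      hr, hsr, comp_zero, add_zero, ← hr2]
    simp only [Category.assoc, reassoc_of% hr1, hr1]
  have hss : is ≫ β ≫ α ≫ es = 𝟙 _ := by
    rw [key s s is es is es hs1 hs2 hs1 hs2, ← hq, Preadditive.add_comp, Preadditive.comp_add, hs,
      hs, hrs, comp_zero, zero_add, ← hs2]
    simp only [Category.assoc, reassoc_of% hs1, hs1]
  have hrs' : ir ≫ β ≫ α ≫ es = 0 := by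
    rw [key r s ir er is es hr1 hr2 hs1 hs2, ← hq, Preadditive.add_comp, Preadditive.comp_add, hs,
      hrs, comp_zero, add_zero, F.map_zero, zero_comp, comp_zero]
  have hsr' : is ≫ β ≫ α ≫ er = 0 := by
    rw [key s r is es ir er hs1 hs2 hr1 hr2, ← hq, Preadditive.add_comp, Preadditive.comp_add, hr,
      hsr, comp_zero, add_zero, F.map_zero, zero_comp, comp_zero]
  have iso : Y ≅ Yr ⊞ Ys :=
    { hom := biprod.lift (α ≫ er) (α ≫ es)
      inv := biprod.desc (ir ≫ β) (is ≫ β)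
      hom_inv_id := by
        rw [biprod.lift_desc]
        have : (α ≫ er) ≫ ir ≫ β + (α ≫ es) ≫ is ≫ β =
            α ≫ (er ≫ ir + es ≫ is) ≫ β := by
          simp only [Preadditive.add_comp, Preadditive.comp_add, Category.assoc]
        rw [this, hr2, hs2, ← F.map_add, hq, ← hβα, Category.assoc, reassoc_of% hαβ, hαβ]
      inv_hom_id := by
        apply biprod.hom_ext' <;> apply biprod.hom_ext <;>
          simp [hrr, hss, hrs', hsr'] }
  rcases hY.2 _ _ iso with hz | hz
  · left
    apply F.map_injective
    rw [← hr2, hz.eq_of_tgt er 0, zero_comp, F.map_zero]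
  · right
    apply F.map_injective
    rw [← hs2, hz.eq_of_tgt es 0, zero_comp, F.map_zero]

/-- An endomorphism algebra that splits into `n` symmetric minimal idempotents and has a
nondegenerate trace is semisimple, so all decompositions of the object into indecomposables have `n`
summands. -/
theorem isSumOfIndecomposables_iff [Linear ℂ C] [HasFiniteBiproducts K]
    [IsIdempotentComplete K] [F.Full] (D : TracedDagger C) {X : C} {n : ℕ}
    (h : SymSplit (D.antiInv X) n 1) (m : ℕ) : IsSumOfIndecomposables (F.obj X) m ↔ m = n := by
  refine ⟨?_, ?_⟩
  · rintro ⟨Y, hY, ⟨φ⟩⟩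
    have : HasBinaryBiproducts K := hasBinaryBiproducts_of_finite_biproducts K
    choose q hq using fun i => F.map_surjective
      ((φ.hom ≫ biproduct.π Y i) ≫ (biproduct.ι Y i ≫ φ.inv))
    have hαβ : ∀ i, (biproduct.ι Y i ≫ φ.inv) ≫ (φ.hom ≫ biproduct.π Y i) = 𝟙 _ := by
      intro i; simp
    have hαβ0 : ∀ i j, i ≠ j → (biproduct.ι Y i ≫ φ.inv) ≫ (φ.hom ≫ biproduct.π Y j) = 0 := by
      intro i j hij; simp [biproduct.ι_π_ne _ hij]
    refine h.card_primitive (D.tr (X := X)) (fun a b => D.tr_comm b a)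
      (fun x hx => D.nondeg x hx) (fun i => (q i : End X)) (fun i h0 => ?_) (fun i j => ?_) ?_
      (fun i r s hr hs hrs hsr hsum => ?_)
    · have h1 : F.map (q i) = 0 := by
        rw [show q i = 0 from h0, F.map_zero]
      apply (hY i).1
      rw [IsZero.iff_id_eq_zero]
      have h2 : 𝟙 (Y i) = (biproduct.ι Y i ≫ φ.inv) ≫ F.map (q i) ≫ (φ.hom ≫ biproduct.π Y i) := by
        rw [hq, Category.assoc (φ.hom ≫ _), hαβ, Category.comp_id, hαβ]
      rw [h2, h1, zero_comp, comp_zero]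
    · change q j ≫ q i = _
      split_ifs with hij
      · subst hij
        apply F.map_injective
        rw [F.map_comp, hq, Category.assoc, ← Category.assoc (biproduct.ι Y i ≫ φ.inv), hαβ,
          Category.id_comp]
      · apply F.map_injective
        rw [F.map_comp, hq, hq, Category.assoc, ← Category.assoc (biproduct.ι Y j ≫ φ.inv),
          hαβ0 j i (Ne.symm hij), zero_comp, comp_zero]
        exact (F.map_zero X X).symm
    · change ∑ i, q i = 𝟙 X
      apply F.map_injective
      rw [F.map_sum, F.map_id]
      simp only [hq]
      have : ∑ i, (φ.hom ≫ biproduct.π Y i) ≫ biproduct.ι Y i ≫ φ.inv =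
          φ.hom ≫ (∑ i, biproduct.π Y i ≫ biproduct.ι Y i) ≫ φ.inv := by
        simp only [Preadditive.sum_comp, Preadditive.comp_sum, Category.assoc]
      rw [this, biproduct.total, Category.id_comp, φ.hom_inv_id]
    · exact primitive_of_indecomposable F (hY i) _ _ (hαβ i) (hq i).symm r s hr hs hsr hrs hsum
  · rintro rfl
    exact isSumOfIndecomposables_of_symSplit F D h

end Summands

namespace OrientedBrauer

theorem isSumOfIndecomposables_tensorPow_iff {t : ℂ} (ht : ∀ z : ℤ, t ≠ z) (n m : ℕ) :
    IsSumOfIndecomposables ((toKar ℂ t).obj ((upDown ℂ t).tensorPow n)) m ↔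
      m = Nat.card {σ : Equiv.Perm (Fin (2 * n)) // σ * σ = 1} := by
  have : (toKar ℂ t).Full := inferInstanceAs (Mat_.embedding _ ⋙ Idempotents.toKaroubi _).Full
  have : (toKar ℂ t).Faithful :=
    inferInstanceAs (Mat_.embedding _ ⋙ Idempotents.toKaroubi _).Faithful
  have : (toKar ℂ t).Additive :=
    inferInstanceAs (Mat_.embedding _ ⋙ Idempotents.toKaroubi _).Additive
  exact isSumOfIndecomposables_iff (toKar ℂ t) (tracedDagger ht) (symSplit_tensorPow ht n) m

end OrientedBrauer

/-! ### Counting involutions -/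

section Involutions

open Finset Nat

/-- The number of permutations of `m` letters whose square is the identity. -/
noncomputable def numInvolutions (m : ℕ) : ℕ := Nat.card {σ : Equiv.Perm (Fin m) // σ * σ = 1}

/-- The number of involutions is the sum over `j` of the number of permutations of cycle type
`2 ^ j`. -/
theorem numInvolutions_eq_sum {m N : ℕ} (hN : m < N) :
    (numInvolutions m : ℝ) =
      ∑ j ∈ range N, (m.choose (2 * j) : ℝ) * ((2 * j)! / (2 ^ j * j !)) := by
  have h1 : numInvolutions m =
      ∑ j ∈ range N, #{σ : Equiv.Perm (Fin m) | σ.cycleType = Multiset.replicate j 2} := by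
    rw [numInvolutions, Nat.card_eq_fintype_card, Fintype.card_subtype,
      Finset.card_eq_sum_card_fiberwise (f := fun σ => σ.cycleType.card) (t := range N)]
    · refine Finset.sum_congr rfl fun j _ => ?_
      congr 1
      ext σ
      simp only [mem_filter, mem_univ, true_and, ← pow_two]
      rw [Equiv.Perm.pow_prime_eq_one_iff, Multiset.eq_replicate]
      exact and_comm
    · intro σ _
      have h2 : σ.cycleType.card • 2 ≤ σ.cycleType.sum :=
        Multiset.card_nsmul_le_sum fun x hx => Equiv.Perm.two_le_of_mem_cycleType hx
      have h3 := σ.support.card_le_univ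
      rw [σ.sum_cycleType] at h2
      rw [Fintype.card_fin] at h3
      simp only [coe_range, Set.mem_Iio]
      rw [smul_eq_mul] at h2
      omega
  rw [h1, Nat.cast_sum]
  refine Finset.sum_congr rfl fun j _ => ?_
  have h2 := Equiv.Perm.card_of_cycleType_mul_eq (Fin m) (Multiset.replicate j 2)
  have h3 : ∏ n ∈ (Multiset.replicate j 2).toFinset, ((Multiset.replicate j 2).count n)! = j ! := by
    rcases Nat.eq_zero_or_pos j with rfl | hj
    · simp
    · rw [Multiset.toFinset_replicate, if_neg hj.ne', prod_singleton, Multiset.count_replicate_self]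
  rw [h3, Multiset.sum_replicate, Multiset.prod_replicate, Fintype.card_fin, smul_eq_mul,
    mul_comm j 2] at h2
  by_cases hj : 2 * j ≤ m
  · rw [if_pos ⟨hj, fun a ha => (Multiset.eq_of_mem_replicate ha).ge⟩,
      ← Nat.choose_mul_factorial_mul_factorial hj] at h2
    have h4 := congrArg (Nat.cast : ℕ → ℝ) h2
    push_cast at h4
    have := Nat.factorial_pos (m - 2 * j)
    have := Nat.factorial_pos j
    rw [mul_div_assoc', eq_div_iff (by positivity)]
    refine mul_right_cancel₀ (b := ((m - 2 * j)! : ℝ)) (by positivity) ?_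
    linear_combination h4
  · rw [if_neg (fun h => hj h.1)] at h2
    have := Nat.factorial_pos (m - 2 * j)
    have := Nat.factorial_pos j
    rw [(Nat.mul_eq_zero.1 h2).resolve_right (by positivity), Nat.choose_eq_zero_of_lt (by omega)]
    simp

theorem numInvolutions_zero : numInvolutions 0 = 1 := by
  have := numInvolutions_eq_sum (m := 0) (N := 1) one_pos
  simpa using this

/-- The last letter is either fixed or exchanged with one of the `m` others. -/
theorem numInvolutions_succ (m : ℕ) :
    numInvolutions (m + 1) = numInvolutions m + m * numInvolutions (m - 1) := by
  rcases m with _ | m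
  · have := numInvolutions_eq_sum (m := 1) (N := 2) one_lt_two
    rw [numInvolutions_zero]
    simpa [sum_range_succ] using this
  rw [Nat.add_sub_cancel]
  have : (numInvolutions (m + 2) : ℝ) = numInvolutions (m + 1) + (m + 1) * numInvolutions m := by
    rw [numInvolutions_eq_sum (m := m + 2) (N := m + 4) (by omega),
      numInvolutions_eq_sum (m := m + 1) (N := m + 4) (by omega),
      numInvolutions_eq_sum (m := m) (N := m + 3) (by omega), sum_range_succ' _ (m + 3),
      sum_range_succ' _ (m + 3), mul_sum, add_right_comm, ← sum_add_distrib]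
    congr 1
    · refine sum_congr rfl fun j _ => ?_
      have h1 : (m + 2).choose (2 * (j + 1)) =
          (m + 1).choose (2 * j + 1) + (m + 1).choose (2 * (j + 1)) := rfl
      have h2 : ((m + 1 : ℕ) : ℝ) * m.choose (2 * j) =
          (m + 1).choose (2 * j + 1) * (2 * j + 1 : ℕ) := by
        exact_mod_cast Nat.add_one_mul_choose_eq m (2 * j)
      have h3 : ((2 * (j + 1))! : ℝ) = (2 * j + 2) * (2 * j + 1) * (2 * j)! := by
        rw [show 2 * (j + 1) = 2 * j + 1 + 1 by ring, factorial_succ, factorial_succ]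
        push_cast; ring
      have := Nat.factorial_pos j
      rw [h1, h3, factorial_succ]
      push_cast at h2 ⊢
      rw [← mul_assoc (m + 1 : ℝ), h2]
      field_simp
      ring
  exact_mod_cast this

/-- Involutions of a disjoint union of `a` and `b` letters, counted by the number `j` of
two-cycles that join the two parts. -/
theorem numInvolutions_add (a b N : ℕ) (hN : a < N) : numInvolutions (a + b) =
    ∑ j ∈ range N, j ! * a.choose j * b.choose j *
      (numInvolutions (a - j) * numInvolutions (b - j)) := by
  induction a using Nat.strong_induction_on generalizing b N with
  | _ a ih =>
    obtain ⟨M, rfl⟩ : ∃ M, N = M + 1 := ⟨N - 1, by omega⟩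
    rcases a with _ | a
    · rw [sum_eq_single 0]
      · simp [numInvolutions_zero]
      · intro j _ hj
        rw [Nat.choose_eq_zero_of_lt (by omega)]
        simp
      · simp
    have h1 := ih a (by omega) b (M + 1) (by omega)
    -- a letter added to the first part is fixed, or joined to the second part (`h2`), or joined to
    -- the first part (`h3`)
    have h2 : b * numInvolutions (a + b - 1) = b * ∑ j ∈ range M, j ! * a.choose j *
        (b - 1).choose j * (numInvolutions (a - j) * numInvolutions (b - 1 - j)) := by
      rcases b with _ | b
      · simp
      · rw [← ih a (by omega) _ M (by omega)]; rfl
    have h3 : a * numInvolutions (a + b - 1) = a * ∑ j ∈ range (M + 1), j ! * (a - 1).choose j *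
        b.choose j * (numInvolutions (a - 1 - j) * numInvolutions (b - j)) := by
      rcases a with _ | a
      · simp
      · rw [← ih (a + 1 - 1) (by omega) _ (M + 1) (by omega)]
        congr 2; omega
    have h4 : ∀ j, (a + 1).choose (j + 1) * (j + 1)! * b.choose (j + 1) =
        b * (j ! * a.choose j * (b - 1).choose j) +
          (j + 1)! * a.choose (j + 1) * b.choose (j + 1) := by
      intro j
      have h5 : b.choose (j + 1) * (j + 1) = b * (b - 1).choose j := by
        rcases b with _ | b
        · simp
        · exact (Nat.add_one_mul_choose_eq b j).symm
      rw [Nat.choose_succ_succ, factorial_succ]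
      linear_combination (a.choose j * j !) * h5
    have h6 : ∀ j, a.choose j * numInvolutions (a + 1 - j) = a.choose j * numInvolutions (a - j) +
        a * ((a - 1).choose j * numInvolutions (a - 1 - j)) := by
      intro j
      rcases le_or_gt j a with hj | hj
      · rw [show a + 1 - j = a - j + 1 by omega, numInvolutions_succ, mul_add,
          show a - j - 1 = a - 1 - j by omega]
        have h7 : a.choose j * (a - j) = a * (a - 1).choose j := by
          rcases a with _ | a
          · simp
          · exact (Nat.choose_mul_succ_eq a j).symm.trans (mul_comm _ _)
        linear_combination numInvolutions (a - 1 - j) * h7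
      · rw [Nat.choose_eq_zero_of_lt hj, Nat.choose_eq_zero_of_lt (by omega : a - 1 < j)]
        simp
    have h8 : ∑ j ∈ range (M + 1), j ! * (a + 1).choose j * b.choose j *
        (numInvolutions (a + 1 - j) * numInvolutions (b - j)) =
        ∑ j ∈ range (M + 1), j ! * a.choose j * b.choose j *
          (numInvolutions (a + 1 - j) * numInvolutions (b - j)) +
        b * ∑ j ∈ range M, j ! * a.choose j *
          (b - 1).choose j * (numInvolutions (a - j) * numInvolutions (b - 1 - j)) := by
      rw [sum_range_succ', sum_range_succ' _ M, mul_sum, add_right_comm, ← sum_add_distrib]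
      rw [Nat.choose_zero_right, Nat.choose_zero_right, Nat.choose_zero_right]
      congr 1
      refine sum_congr rfl fun j _ => ?_
      rw [show a + 1 - (j + 1) = a - j by omega, show b - (j + 1) = b - 1 - j by omega]
      linear_combination numInvolutions (a - j) * numInvolutions (b - 1 - j) * h4 j
    rw [h8, ← h2, show a + 1 + b = a + b + 1 by ring, numInvolutions_succ, add_mul, h3, ← add_assoc,
      h1]
    congr 1
    rw [mul_sum, ← sum_add_distrib]
    refine sum_congr rfl fun j _ => ?_
    linear_combination j ! * b.choose j * numInvolutions (b - j) * (h6 j).symm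

theorem numInvolutions_two_mul (n : ℕ) : numInvolutions (2 * n) =
    ∑ k ∈ range (n + 1), numInvolutions k ^ 2 * n.choose k ^ 2 * (n - k)! := by
  rw [two_mul, numInvolutions_add n n (n + 1) n.lt_succ_self, ← sum_range_reflect]
  refine sum_congr rfl fun k hk => ?_
  have hk' : k ≤ n := by rw [mem_range] at hk; omega
  rw [show n + 1 - 1 - k = n - k by omega, Nat.choose_symm hk', Nat.sub_sub_self hk']
  ring

end Involutions

/-! ### Expansion of the falling factorials -/

section FallingFactorial

open Finset

/-- Third-order Taylor estimate of the logarithms, with the first two power sums evaluated. -/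
theorem abs_sum_log_one_sub_add_le {n k : ℕ} (hk : 2 * k ≤ n) (hn : 0 < n) :
    |∑ i ∈ range k, Real.log (1 - i / n) + k * (k - 1) / (2 * n) +
      k * (k - 1) * (2 * k - 1) / (12 * n ^ 2)| ≤ 2 * (k : ℝ) ^ 4 / n ^ 3 := by
  have hn' : (0 : ℝ) < n := by exact_mod_cast hn
  have h1 : ∀ k : ℕ, ∑ i ∈ range k, ((i : ℝ) / n + (i / n) ^ 2 / 2) =
      (k : ℝ) * (k - 1) / (2 * n) + k * (k - 1) * (2 * k - 1) / (12 * n ^ 2) := by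
    intro k
    induction k with
    | zero => simp
    | succ k ih =>
      rw [sum_range_succ, ih]
      push_cast
      field_simp
      ring
  rw [add_assoc, ← h1, ← sum_add_distrib]
  have h2 : ∀ i ∈ range k, |Real.log (1 - i / n) + ((i : ℝ) / n + (i / n) ^ 2 / 2)| ≤
      2 * (k : ℝ) ^ 3 / n ^ 3 := by
    intro i hi
    have hik : (i : ℝ) ≤ k := by exact_mod_cast (mem_range.1 hi).le
    have hy0 : 0 ≤ (i : ℝ) / n := by positivity
    have hy1 : (i : ℝ) / n ≤ 1 / 2 := by
      rw [div_le_iff₀ hn']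
      have : (2 * k : ℝ) ≤ n := by exact_mod_cast hk
      linarith
    have h3 := Real.abs_log_sub_add_sum_range_le (x := (i : ℝ) / n)
      (by rw [abs_of_nonneg hy0]; linarith) 2
    simp only [sum_range_succ, sum_range_zero, abs_of_nonneg hy0] at h3
    norm_num at h3
    rw [add_comm (Real.log _)]
    refine h3.trans ?_
    rw [div_le_iff₀ (by linarith)]
    have h4 : ((i : ℝ) / n) ^ 3 ≤ (k : ℝ) ^ 3 / n ^ 3 := by
      rw [← div_pow]
      gcongr
    have h5 : (0 : ℝ) ≤ (k : ℝ) ^ 3 / n ^ 3 := by positivity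
    rw [mul_div_assoc]
    nlinarith
  refine (abs_sum_le_sum_abs _ _).trans ((sum_le_sum h2).trans (le_of_eq ?_))
  rw [sum_const, card_range, nsmul_eq_mul]
  ring

/-- The relative deviation `(2 * k - x) / x` of `2 * k` from the mean `x`. -/
noncomputable def relDev (x : ℝ) (k : ℕ) : ℝ := 2 * k / x - 1

/-- Second-order expansion of `∑ i < k, log (1 - i / n)` at `k ≈ √(n / 2)`. -/
theorem abs_sum_log_one_sub_expansion {n k : ℕ} {x : ℝ} (hx : 100 ≤ x) (hxn : x ^ 2 = 2 * n)
    (hD : |relDev x k| ≤ 1) :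
    |∑ i ∈ range k, Real.log (1 - i / n) + 1 / 4 + relDev x k / 2 + relDev x k ^ 2 / 4 -
      5 / (12 * x)| ≤ 2 * (|relDev x k| / x) + 18 / x ^ 2 := by
  have hx0 : 0 < x := by linarith
  have hn : (n : ℝ) = x ^ 2 / 2 := by linarith
  have hn0 : 0 < n := by
    have : (0 : ℝ) < n := by rw [hn]; positivity
    exact_mod_cast this
  set D := relDev x k with hDdef
  have hk : (k : ℝ) = (1 + D) * x / 2 := by
    rw [hDdef, relDev]; field_simp; ring
  have hkx : (k : ℝ) ≤ x := by
    rw [hk]; nlinarith [(abs_le.1 hD).2]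
  have h2k : 2 * k ≤ n := by
    have : (2 * k : ℝ) ≤ n := by rw [hn]; nlinarith
    exact_mod_cast this
  have h1 := abs_sum_log_one_sub_add_le h2k hn0
  have h2 : 2 * (k : ℝ) ^ 4 / n ^ 3 ≤ 16 / x ^ 2 := by
    rw [hn, div_le_div_iff₀ (by positivity) (by positivity)]
    have : (k : ℝ) ^ 4 ≤ x ^ 4 := by gcongr
    have h3 : 0 ≤ x ^ 2 := by positivity
    nlinarith
  have h3 : (k : ℝ) * (k - 1) / (2 * n) = (1 + D) ^ 2 / 4 - (1 + D) / (2 * x) := by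
    rw [hk, hn]; field_simp; ring
  have h4 : (k : ℝ) * (k - 1) * (2 * k - 1) / (12 * n ^ 2) =
      (1 + D) ^ 3 / (12 * x) - (1 + D) ^ 2 / (4 * x ^ 2) + (1 + D) / (6 * x ^ 3) := by
    rw [hk, hn]; field_simp; ring
  rw [h3, h4] at h1
  set S := ∑ i ∈ range k, Real.log (1 - i / n)
  have hD' := abs_le.1 hD
  -- substitute `2 * k = (1 + D) * x` and `2 * n = x ^ 2` and collect the terms of order
  -- `D / x` and `1 / x ^ 2`
  have e1 : S + 1 / 4 + D / 2 + D ^ 2 / 4 - 5 / (12 * x) =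
      (S + ((1 + D) ^ 2 / 4 - (1 + D) / (2 * x)) + ((1 + D) ^ 3 / (12 * x) -
        (1 + D) ^ 2 / (4 * x ^ 2) + (1 + D) / (6 * x ^ 3))) +
      (D * (1 / 2 - (3 + 3 * D + D ^ 2) / 12)) * x⁻¹ +
      ((1 + D) ^ 2 / 4 - (1 + D) / 6 * x⁻¹) / x ^ 2 := by
    field_simp; ring
  have e2 : |(D * (1 / 2 - (3 + 3 * D + D ^ 2) / 12)) * x⁻¹| ≤ 2 * (|D| / x) := by
    rw [abs_mul, abs_mul, abs_of_pos (inv_pos.2 hx0),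
      show 2 * (|D| / x) = 2 * |D| * x⁻¹ by rw [mul_assoc, ← div_eq_mul_inv]]
    refine mul_le_mul_of_nonneg_right ?_ (inv_pos.2 hx0).le
    have : |1 / 2 - (3 + 3 * D + D ^ 2) / 12| ≤ 2 := by
      rw [abs_le]; constructor <;> nlinarith
    nlinarith [abs_nonneg D]
  have hxi : x⁻¹ ≤ 1 := by
    rw [inv_le_one₀ hx0]; linarith
  have hxi0 := inv_pos.2 hx0
  have e3 : |((1 + D) ^ 2 / 4 - (1 + D) / 6 * x⁻¹) / x ^ 2| ≤ 2 / x ^ 2 := by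
    rw [abs_div, abs_of_pos (by positivity : 0 < x ^ 2)]
    gcongr
    rw [abs_le]; constructor <;> nlinarith
  rw [e1]
  have e4 : (18 : ℝ) / x ^ 2 = 16 / x ^ 2 + 2 / x ^ 2 := by ring
  refine (abs_add_three _ _ _).trans ?_
  rw [e4]
  linarith

/-- Second-order expansion of `exp` at a value `-d / 2 - d ^ 2 / 4 + 5 * e / 12`, up to terms of
order `d ^ 3`, `e * d` and `e ^ 2`. -/
theorem abs_exp_sub_expansion_le {L D e : ℝ} (he0 : 0 ≤ e) (he : e ≤ 1 / 100) (hD : |D| ≤ 1)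
    (hL : |L + D / 2 + D ^ 2 / 4 - 5 / 12 * e| ≤ 2 * (|D| * e) + 18 * e ^ 2) :
    |Real.exp L - (1 - D / 2 - D ^ 2 / 8 + 5 / 12 * e)| ≤
      100 * (|D| ^ 3 + e * |D| + e ^ 2) := by
  set d := |D| with hd
  have hd0 : 0 ≤ d := abs_nonneg D
  have hdD : D ^ 2 = d ^ 2 := (sq_abs D).symm
  set r := L + D / 2 + D ^ 2 / 4 - 5 / 12 * e with hr
  have hLr : L = r - D / 2 - D ^ 2 / 4 + 5 / 12 * e := by rw [hr]; ring
  have hDd := abs_le.1 (le_refl d)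
  have hD1 : D ≤ d := le_abs_self D
  have hD2 : -d ≤ D := neg_abs_le D
  have hde : d * e ≤ e := by nlinarith
  have hee : e ^ 2 ≤ e / 100 := by nlinarith
  have hde2 : d * e ≤ d / 100 := by nlinarith
  have hdd : d ^ 2 ≤ d := by nlinarith
  have hr' := abs_le.1 hL
  have hM : |r - D ^ 2 / 4 + 5 / 12 * e| ≤ d ^ 2 / 4 + 3 * e := by
    rw [hdD, abs_le]
    constructor <;> linarith [sq_nonneg d]
  have hLd : |L| ≤ d + e := by
    rw [hLr, hdD, abs_le]
    constructor <;> linarith [sq_nonneg d]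
  have hL1 : |L| ≤ 1 := by
    rw [hLr, hdD, abs_le]
    constructor <;> linarith [sq_nonneg d]
  have hexp := Real.exp_bound (x := L) hL1 (n := 3) (by norm_num)
  have hL3 : |L| ^ 3 ≤ 4 * (d ^ 3 + e ^ 2) := by
    have h1 : |L| ^ 3 ≤ (d + e) ^ 3 := by gcongr
    have h2 : (d + e) ^ 3 ≤ 4 * (d ^ 3 + e ^ 3) := by
      nlinarith [mul_nonneg (add_nonneg hd0 he0) (sq_nonneg (d - e))]
    have h3 : e ^ 3 ≤ e ^ 2 := by nlinarith [sq_nonneg e]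
    linarith
  simp only [sum_range_succ, sum_range_zero] at hexp
  norm_num [Nat.factorial] at hexp
  have hsq : |L ^ 2 - D ^ 2 / 4| ≤ 10 * (d ^ 3 + e * d + e ^ 2) := by
    have h1 : L ^ 2 - D ^ 2 / 4 = (r - D ^ 2 / 4 + 5 / 12 * e) *
        ((r - D ^ 2 / 4 + 5 / 12 * e) - D) := by rw [hLr]; ring
    rw [h1, abs_mul]
    have h2 : |(r - D ^ 2 / 4 + 5 / 12 * e) - D| ≤ d ^ 2 / 4 + 3 * e + d :=
      (abs_sub _ _).trans (by linarith)
    refine (mul_le_mul hM h2 (abs_nonneg _) (by positivity)).trans ?_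
    have h3 : 0 ≤ e * d := by positivity
    have h4 : e * d ^ 2 ≤ e * d := by gcongr
    have h5 : d ^ 4 ≤ d ^ 3 := by
      rw [pow_succ d 3]
      exact mul_le_of_le_one_right (by positivity) hD
    have h6 : 0 ≤ d ^ 3 := by positivity
    have h7 : (d ^ 2 / 4 + 3 * e) * (d ^ 2 / 4 + 3 * e + d) =
        d ^ 4 / 16 + 3 / 2 * (e * d ^ 2) + d ^ 3 / 4 + 9 * e ^ 2 + 3 * (e * d) := by ring
    rw [h7]
    linarith [sq_nonneg e]
  have hkey : Real.exp L - (1 - D / 2 - D ^ 2 / 8 + 5 / 12 * e) =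
      (Real.exp L - (1 + L + L ^ 2 / 2)) + (L ^ 2 - D ^ 2 / 4) / 2 + r := by
    rw [hr]; ring
  rw [hkey]
  have h6 : 0 ≤ d ^ 3 := by positivity
  have h7 : 0 ≤ e * d := by positivity
  refine (abs_add_three _ _ _).trans ?_
  rw [abs_div, abs_two]
  have h8 : |Real.exp L - (1 + L + L ^ 2 / 2)| ≤ |L| ^ 3 := by
    refine hexp.trans ?_
    linarith [pow_nonneg (abs_nonneg L) 3]
  linarith [sq_nonneg e]

/-- Expansion of `n.descFactorial k / n ^ k`, uniform in `k`. For `|relDev x k| ≥ 1` it holds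
because both sides are trivially bounded. -/
theorem exists_abs_descFactorial_sub_le : ∃ C : ℝ, 0 ≤ C ∧ ∀ (n k : ℕ) (x : ℝ), 100 ≤ x →
    x ^ 2 = 2 * n →
    |(n.descFactorial k / n ^ k : ℝ) - Real.exp (-(1 / 4)) *
      (1 - relDev x k / 2 - relDev x k ^ 2 / 8 + 5 / 12 * (1 / x))| ≤
      C * (|relDev x k| ^ 3 + 1 / x * |relDev x k| + (1 / x) ^ 2) := by
  refine ⟨100, by norm_num, fun n k x hx hxn => ?_⟩
  have hx0 : 0 < x := by linarith
  have hn : (n : ℝ) = x ^ 2 / 2 := by linarith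
  have hn0 : (0 : ℝ) < n := by rw [hn]; positivity
  have he0 : 0 ≤ 1 / x := by positivity
  have he : 1 / x ≤ 1 / 100 := one_div_le_one_div_of_le (by norm_num) hx
  have hexp0 := Real.exp_pos (-(1 / 4))
  have hexp1 : Real.exp (-(1 / 4)) ≤ 1 := Real.exp_le_one_iff.2 (by norm_num)
  set D := relDev x k with hDdef
  have hd0 := abs_nonneg D
  rcases le_or_gt |D| 1 with hD | hD
  · have hkx : (k : ℝ) ≤ x := by
      have hk : (k : ℝ) = (1 + D) * x / 2 := by
        rw [hDdef, relDev]; field_simp; ring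
      rw [hk]; nlinarith [(abs_le.1 hD).2]
    have hkn : (k : ℝ) < n := by rw [hn]; nlinarith
    have hprod : (n.descFactorial k / n ^ k : ℝ) =
        Real.exp (∑ i ∈ range k, Real.log (1 - i / n)) := by
      rw [Real.exp_sum, Nat.descFactorial_eq_prod_range, Nat.cast_prod, ← card_range k,
        ← prod_const, card_range, ← prod_div_distrib]
      refine prod_congr rfl fun i hi => ?_
      have hik : (i : ℝ) < n := lt_trans (by exact_mod_cast mem_range.1 hi) hkn
      rw [Real.exp_log (by rw [sub_pos, div_lt_one hn0]; exact hik),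
        Nat.cast_sub (by exact_mod_cast hik.le), sub_div, div_self hn0.ne']
    have h1 := abs_sum_log_one_sub_expansion hx hxn hD
    rw [← hDdef] at h1
    have h2 := abs_exp_sub_expansion_le (L := ∑ i ∈ range k, Real.log (1 - i / n) + 1 / 4)
      (D := D) he0 he hD (by
        convert h1 using 2
        · field_simp
        · field_simp
        · rw [one_div, inv_pow, div_eq_mul_inv])
    rw [hprod]
    have h3 : Real.exp (∑ i ∈ range k, Real.log (1 - i / n)) = Real.exp (-(1 / 4)) *
        Real.exp (∑ i ∈ range k, Real.log (1 - i / n) + 1 / 4) := by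
      rw [← Real.exp_add, neg_add_cancel_comm_assoc]
    rw [h3, ← mul_sub, abs_mul, abs_of_pos hexp0]
    exact (mul_le_of_le_one_left (abs_nonneg _) hexp1).trans h2
  · have h1 : (n.descFactorial k / n ^ k : ℝ) ≤ 1 := by
      rw [div_le_one (by positivity)]
      exact_mod_cast Nat.descFactorial_le_pow n k
    have h2 : (0 : ℝ) ≤ n.descFactorial k / n ^ k := by positivity
    have h3 : |1 - D / 2 - D ^ 2 / 8 + 5 / 12 * (1 / x)| ≤ 2 + |D| + |D| ^ 2 := by
      rw [abs_le, sq_abs]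
      constructor <;> nlinarith [le_abs_self D, neg_abs_le D, sq_nonneg D]
    have h4 : |D| ≤ |D| ^ 3 := le_self_pow₀ hD.le (by norm_num)
    have h5 : |D| ^ 2 ≤ |D| ^ 3 := pow_le_pow_right₀ hD.le (by norm_num)
    refine (abs_sub _ _).trans ?_
    rw [abs_mul, abs_of_pos hexp0, abs_of_nonneg h2]
    have h6 : Real.exp (-(1 / 4)) * |1 - D / 2 - D ^ 2 / 8 + 5 / 12 * (1 / x)| ≤
        2 + |D| + |D| ^ 2 :=
      (mul_le_of_le_one_left (abs_nonneg _) hexp1).trans h3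
    have h7 : 0 ≤ 1 / x * |D| := by positivity
    have h8 : 0 ≤ (1 / x) ^ 2 := by positivity
    linarith

end FallingFactorial

/-! ### Moments of the even Poisson weights -/

section Moments

open Nat Real

/-- The weight `x ^ (2 * k) / (2 * k)!`, the Poisson weight of `2 * k` up to normalization. -/
noncomputable def evenWeight (x : ℝ) (k : ℕ) : ℝ := x ^ (2 * k) / (2 * k)!

theorem evenWeight_nonneg (x : ℝ) (k : ℕ) : 0 ≤ evenWeight x k := by
  rw [evenWeight, pow_mul]; positivity

/-- Shifting between the weights of `2 * k` and `2 * k + 1`, by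
`(2 * k + 1) / (2 * k + 1)! = 1 / (2 * k)!`. Together with `hasSum_evenWeight_mul` this computes
the falling factorial moments. -/
theorem hasSum_oddWeight_mul {x s : ℝ} {R : ℕ → ℝ}
    (h : HasSum (fun k => evenWeight x k * R k) s) :
    HasSum (fun k => x ^ (2 * k + 1) / (2 * k + 1)! * ((2 * k + 1) * R k)) (x * s) := by
  refine (h.mul_left x).congr_fun fun k => ?_
  have := Nat.factorial_pos (2 * k)
  rw [evenWeight, factorial_succ]
  push_cast
  field_simp
  ring

theorem hasSum_evenWeight_mul {x s : ℝ} {R : ℕ → ℝ}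
    (h : HasSum (fun k => x ^ (2 * k + 1) / (2 * k + 1)! * R (k + 1)) s) :
    HasSum (fun k => evenWeight x k * (2 * k * R k)) (x * s) := by
  rw [← hasSum_nat_add_iff' 1]
  simp only [Finset.sum_range_one, CharP.cast_eq_zero, mul_zero, zero_mul, sub_zero]
  refine (h.mul_left x).congr_fun fun k => ?_
  have := Nat.factorial_pos (2 * k + 1)
  rw [evenWeight, show 2 * (k + 1) = 2 * k + 1 + 1 by ring, factorial_succ (2 * k + 1)]
  push_cast
  field_simp
  ring

theorem hasSum_evenWeight (x : ℝ) : HasSum (fun k => evenWeight x k * 1) (cosh x) := by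
  simpa only [mul_one, evenWeight] using hasSum_cosh x

theorem hasSum_evenWeight_one (x : ℝ) :
    HasSum (fun k => evenWeight x k * (2 * k * 1)) (x * sinh x) :=
  hasSum_evenWeight_mul (R := fun _ => 1) (by simpa only [mul_one] using hasSum_sinh x)

theorem hasSum_evenWeight_two (x : ℝ) :
    HasSum (fun k => evenWeight x k * (2 * k * (2 * k - 1))) (x * (x * cosh x)) := by
  refine hasSum_evenWeight_mul (R := fun k => 2 * k - 1)
    ((hasSum_oddWeight_mul (hasSum_evenWeight x)).congr_fun fun k => ?_)
  push_cast; ring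

theorem hasSum_evenWeight_three (x : ℝ) :
    HasSum (fun k => evenWeight x k * (2 * k * ((2 * k - 1) * (2 * k - 2))))
      (x * (x * (x * sinh x))) := by
  refine hasSum_evenWeight_mul (R := fun k => (2 * k - 1) * (2 * k - 2))
    ((hasSum_oddWeight_mul (hasSum_evenWeight_one x)).congr_fun fun k => ?_)
  push_cast; ring

theorem hasSum_evenWeight_four (x : ℝ) :
    HasSum (fun k => evenWeight x k * (2 * k * ((2 * k - 1) * (2 * k - 2) * (2 * k - 3))))
      (x * (x * (x * (x * cosh x)))) := by
  refine hasSum_evenWeight_mul (R := fun k => (2 * k - 1) * (2 * k - 2) * (2 * k - 3))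
    ((hasSum_oddWeight_mul (hasSum_evenWeight_two x)).congr_fun fun k => ?_)
  push_cast; ring

/-- The mean of the relative deviation, exponentially small. -/
theorem hasSum_relDev {x : ℝ} (hx : 0 < x) :
    HasSum (fun k => evenWeight x k * relDev x k) (-exp (-x)) := by
  rw [← sinh_sub_cosh, show sinh x - cosh x = x⁻¹ * (x * sinh x) - cosh x by field_simp]
  refine (((hasSum_evenWeight_one x).mul_left x⁻¹).sub (hasSum_evenWeight x)).congr_fun fun k => ?_
  rw [relDev]
  field_simp

/-- The variance of the relative deviation, asymptotically `1 / x`. -/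
theorem hasSum_relDev_sq {x : ℝ} (hx : 0 < x) :
    HasSum (fun k => evenWeight x k * relDev x k ^ 2) (sinh x / x + 2 * exp (-x)) := by
  have h : sinh x / x + 2 * exp (-x) = (x ^ 2)⁻¹ * (x * (x * cosh x)) +
      ((x ^ 2)⁻¹ - 2 * x⁻¹) * (x * sinh x) + cosh x := by
    rw [← cosh_sub_sinh]; field_simp; ring
  rw [h]
  refine ((((hasSum_evenWeight_two x).mul_left (x ^ 2)⁻¹).add
    ((hasSum_evenWeight_one x).mul_left ((x ^ 2)⁻¹ - 2 * x⁻¹))).add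
    (hasSum_evenWeight x)).congr_fun fun k => ?_
  rw [relDev]
  field_simp
  ring

/-- The fourth moment of the relative deviation, of order `1 / x ^ 2`. -/
theorem hasSum_relDev_pow_four {x : ℝ} (hx : 0 < x) :
    HasSum (fun k => evenWeight x k * relDev x k ^ 4)
      (3 * cosh x / x ^ 2 + sinh x / x ^ 3 + (8 - 12 / x + 4 / x ^ 2) * exp (-x)) := by
  have h : 3 * cosh x / x ^ 2 + sinh x / x ^ 3 + (8 - 12 / x + 4 / x ^ 2) * exp (-x) =
      (x ^ 4)⁻¹ * (x * (x * (x * (x * cosh x)))) +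
      (6 * (x ^ 4)⁻¹ - 4 * (x ^ 3)⁻¹) * (x * (x * (x * sinh x))) +
      (7 * (x ^ 4)⁻¹ - 12 * (x ^ 3)⁻¹ + 6 * (x ^ 2)⁻¹) * (x * (x * cosh x)) +
      ((x ^ 4)⁻¹ - 4 * (x ^ 3)⁻¹ + 6 * (x ^ 2)⁻¹ - 4 * x⁻¹) * (x * sinh x) + cosh x := by
    rw [← cosh_sub_sinh]; field_simp; ring
  rw [h]
  refine ((((((hasSum_evenWeight_four x).mul_left _).add
    ((hasSum_evenWeight_three x).mul_left _)).add
    ((hasSum_evenWeight_two x).mul_left _)).add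
    ((hasSum_evenWeight_one x).mul_left _)).add
    (hasSum_evenWeight x)).congr_fun fun k => ?_
  rw [relDev]
  field_simp
  ring

end Moments

/-! ### The weighted sum -/

section WeightedSum

open Finset Nat Real

/-- The number of involutions of `2 * n` letters, sorted by half the number `k` of fixed
points. -/
theorem hasSum_numInvolutions {n : ℕ} (hn : 0 < n) {x : ℝ} (hxn : x ^ 2 = 2 * n) :
    HasSum (fun k => evenWeight x k * (n.descFactorial k / n ^ k))
      (numInvolutions (2 * n) / ((2 * n)! / (2 ^ n * n !))) := by
  have hn' : (0 : ℝ) < n := by exact_mod_cast hn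
  have h2n := Nat.factorial_pos (2 * n)
  have hnf := Nat.factorial_pos n
  have h1 : (numInvolutions (2 * n) : ℝ) / ((2 * n)! / (2 ^ n * n !)) =
      ∑ k ∈ range (n + 1), evenWeight x k * (n.descFactorial k / n ^ k) := by
    rw [numInvolutions_eq_sum (N := 2 * n + 1) (by omega),
      ← sum_subset (range_subset_range.2 (by omega : n + 1 ≤ 2 * n + 1)), ← sum_range_reflect,
      sum_div]
    · refine sum_congr rfl fun k hk => ?_
      have hk' : k ≤ n := by rw [mem_range] at hk; omega
      obtain ⟨j, rfl⟩ := Nat.exists_eq_add_of_le hk'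
      rw [show k + j + 1 - 1 - k = j by omega]
      have e1 := Nat.choose_mul_factorial_mul_factorial (by omega : 2 * j ≤ 2 * (k + j))
      rw [show 2 * (k + j) - 2 * j = 2 * k by omega] at e1
      have e2 := Nat.factorial_mul_descFactorial hk'
      rw [Nat.add_sub_cancel_left] at e2
      have e1' := congrArg (Nat.cast : ℕ → ℝ) e1
      have e2' := congrArg (Nat.cast : ℕ → ℝ) e2
      push_cast at e1' e2'
      have := Nat.factorial_pos (2 * k)
      have := Nat.factorial_pos (2 * j)
      have := Nat.factorial_pos j
      rw [evenWeight, pow_mul, hxn, mul_pow, ← e1', ← e2', pow_add]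
      have hc : (0 : ℝ) < (2 * (k + j)).choose (2 * j) := by
        exact_mod_cast Nat.choose_pos (by omega)
      have hd : (0 : ℝ) < (k + j).descFactorial k := by
        exact_mod_cast Nat.descFactorial_pos.2 hk'
      push_cast at hn' ⊢
      field_simp
    · intro j _ hj
      rw [Nat.choose_eq_zero_of_lt (by rw [mem_range] at hj; omega)]
      simp
  rw [h1]
  refine hasSum_sum_of_ne_finset_zero fun k hk => ?_
  rw [Nat.descFactorial_of_lt (by rw [mem_range] at hk; omega)]
  simp

theorem exp_neg_le_sq_mul_exp {x : ℝ} (hx : 0 < x) : exp (-x) ≤ (1 / x) ^ 2 * exp x := by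
  have h1 : x ≤ exp x := by linarith [add_one_le_exp x]
  have h2 := exp_pos x
  rw [exp_neg, one_div, inv_pow, ← div_eq_inv_mul, inv_eq_one_div,
    div_le_div_iff₀ h2 (by positivity)]
  nlinarith

/-- The weighted sum of the errors `|D| ^ 3 + |D| / x + 1 / x ^ 2` is of order
`x ^ (-3 / 2) * exp x`. -/
theorem exists_hasSum_error {x : ℝ} (hx : 100 ≤ x) : ∃ s : ℝ, s ≤ 13 * (1 / x * √(1 / x)) * exp x ∧
    ∃ g : ℕ → ℝ, HasSum g s ∧ ∀ k, evenWeight x k *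
      (|relDev x k| ^ 3 + 1 / x * |relDev x k| + (1 / x) ^ 2) ≤ g k := by
  have hx0 : 0 < x := by linarith
  set e := 1 / x with he
  have he0 : 0 < e := by positivity
  have he1 : e ≤ 1 := by rw [he, div_le_one hx0]; linarith
  set η := √e with hη
  have hη0 : 0 < η := sqrt_pos.2 he0
  have hηe : η ^ 2 = e := sq_sqrt he0.le
  have hη1 : η ≤ 1 := sqrt_le_one.2 he1
  refine ⟨_, ?_, fun k => evenWeight x k * 1 * (η * e / 2 + e ^ 2) +
    evenWeight x k * relDev x k ^ 2 * η + evenWeight x k * relDev x k ^ 4 * (1 / (2 * η)),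
    (((hasSum_evenWeight x).mul_right _).add ((hasSum_relDev_sq hx0).mul_right _)).add
      ((hasSum_relDev_pow_four hx0).mul_right _), fun k => ?_⟩
  · have hE := exp_pos x
    have hneg := exp_neg_le_sq_mul_exp hx0
    rw [← he] at hneg
    have hneg0 := exp_pos (-x)
    have h0 : e ^ 2 ≤ 1 := by nlinarith
    have hcosh : cosh x ≤ exp x := by
      rw [cosh_eq]
      have : exp (-x) ≤ exp x := exp_le_exp.2 (by linarith)
      linarith
    have hsinh : sinh x ≤ exp x := by rw [sinh_eq]; linarith
    have h2 : sinh x / x + 2 * exp (-x) ≤ 3 * e * exp x := by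
      rw [div_eq_mul_one_div, ← he]
      have h3 : sinh x * e ≤ exp x * e := by gcongr
      have h4 : e ^ 2 * exp x ≤ e * exp x := by gcongr; nlinarith
      nlinarith
    have h4 : 3 * cosh x / x ^ 2 + sinh x / x ^ 3 + (8 - 12 / x + 4 / x ^ 2) * exp (-x) ≤
        16 * e ^ 2 * exp x := by
      have e1 : 3 * cosh x / x ^ 2 + sinh x / x ^ 3 + (8 - 12 / x + 4 / x ^ 2) * exp (-x) =
          3 * e ^ 2 * cosh x + e ^ 3 * sinh x + (8 - 12 * e + 4 * e ^ 2) * exp (-x) := by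
        rw [he]; field_simp
      rw [e1]
      have h5 : 3 * e ^ 2 * cosh x ≤ 3 * e ^ 2 * exp x := by gcongr
      have h6 : e ^ 3 * sinh x ≤ e ^ 2 * exp x := by
        have : e ^ 3 ≤ e ^ 2 := pow_le_pow_of_le_one he0.le he1 (by norm_num)
        have : 0 ≤ sinh x := sinh_nonneg_iff.2 hx0.le
        gcongr
      have h7 : (8 - 12 * e + 4 * e ^ 2) * exp (-x) ≤ 12 * (e ^ 2 * exp x) := by
        refine mul_le_mul (by linarith) hneg hneg0.le (by norm_num)
      linarith
    have h5 : 16 * e ^ 2 * exp x * (1 / (2 * η)) = 8 * (e * η) * exp x := by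
      rw [← hηe]; field_simp; ring
    have h6 : e ^ 2 ≤ e * η := by
      rw [pow_two]; gcongr; rw [← hηe]; nlinarith
    have h7 : cosh x * (η * e / 2 + e ^ 2) ≤ exp x * (η * e / 2 + e * η) := by gcongr
    have h8 : (sinh x / x + 2 * exp (-x)) * η ≤ 3 * e * exp x * η := by gcongr
    have h9 : (3 * cosh x / x ^ 2 + sinh x / x ^ 3 + (8 - 12 / x + 4 / x ^ 2) * exp (-x)) *
        (1 / (2 * η)) ≤ 16 * e ^ 2 * exp x * (1 / (2 * η)) := by gcongr
    rw [h5] at h9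
    have h10 : 0 ≤ e * η * exp x := by positivity
    linarith
  · set D := relDev x k
    have hw := evenWeight_nonneg x k
    set d := |D| with hd
    have hd0 : 0 ≤ d := abs_nonneg D
    have hD2 : D ^ 2 = d ^ 2 := (sq_abs D).symm
    have hD4 : D ^ 4 = d ^ 4 := by rw [show D ^ 4 = (D ^ 2) ^ 2 by ring, hD2]; ring
    -- only even moments are known, so odd powers are bounded by even ones; `d ^ 2` is of order
    -- `η ^ 2`
    have h1 : d ^ 3 ≤ (η * d ^ 2 + d ^ 4 / η) / 2 := by
      have : (η * d ^ 2 + d ^ 4 / η) / 2 - d ^ 3 = d ^ 2 * (η - d) ^ 2 / (2 * η) := by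
        field_simp; ring
      have : 0 ≤ d ^ 2 * (η - d) ^ 2 / (2 * η) := by positivity
      linarith
    have h2 : e * d ≤ η * (e + d ^ 2) / 2 := by
      rw [← hηe]
      nlinarith [mul_nonneg hη0.le (sq_nonneg (η - d))]
    change _ ≤ evenWeight x k * 1 * (η * e / 2 + e ^ 2) + evenWeight x k * D ^ 2 * η +
      evenWeight x k * D ^ 4 * (1 / (2 * η))
    rw [hD2, hD4]
    have h3 : evenWeight x k * 1 * (η * e / 2 + e ^ 2) + evenWeight x k * d ^ 2 * η +
        evenWeight x k * d ^ 4 * (1 / (2 * η)) = evenWeight x k *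
        ((η * d ^ 2 + d ^ 4 / η) / 2 + η * (e + d ^ 2) / 2 + e ^ 2) := by
      field_simp; ring
    rw [h3]
    gcongr

/-- Summing the expansion of `n.descFactorial k / n ^ k` against the moments: the constant
`7 / 24 = 5 / 12 - 1 / 8` comes from the term `5 / (12 * x)` and from `- D ^ 2 / 8`, where `D ^ 2`
has mean `1 / x`. -/
theorem exists_abs_numInvolutions_sub_le : ∃ C : ℝ, ∀ (n : ℕ) (x : ℝ), 100 ≤ x → x ^ 2 = 2 * n →
    |numInvolutions (2 * n) / ((2 * n)! / (2 ^ n * n !)) / (exp (-(1 / 4)) * exp x / 2) -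
      (1 + 7 / (24 * x))| ≤ C * (1 / x * √(1 / x)) := by
  obtain ⟨C, hC0, hC⟩ := exists_abs_descFactorial_sub_le
  refine ⟨(13 * C + 2) * (2 * exp (1 / 4)), fun n x hx hxn => ?_⟩
  have hx0 : 0 < x := by linarith
  have hn0 : 0 < n := by
    have : (0 : ℝ) < n := by nlinarith
    exact_mod_cast this
  obtain ⟨s, hs, g, hg, hgk⟩ := exists_hasSum_error hx
  have hS := hasSum_numInvolutions hn0 hxn
  set S : ℝ := numInvolutions (2 * n) / ((2 * n)! / (2 ^ n * n !))
  have hmain := (((((hasSum_evenWeight x).mul_right (1 + 5 / 12 * (1 / x))).sub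
    ((hasSum_relDev hx0).mul_right (1 / 2))).sub
    ((hasSum_relDev_sq hx0).mul_right (1 / 8))).mul_left (exp (-(1 / 4))))
  have hdiff := HasSum.norm_le_of_bounded (hS.sub hmain) (hg.mul_left C) (fun k => by
    have hw := evenWeight_nonneg x k
    have h1 := mul_le_mul_of_nonneg_left (hC n k x hx hxn) hw
    have h2 := mul_le_mul_of_nonneg_left (hgk k) hC0
    rw [← abs_of_nonneg hw, ← abs_mul, abs_of_nonneg hw] at h1
    rw [Real.norm_eq_abs]
    refine le_trans (le_of_eq ?_) (h1.trans ((le_of_eq ?_).trans h2))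
    · congr 1; ring
    · ring)
  rw [Real.norm_eq_abs] at hdiff
  set M := exp (-(1 / 4)) * (cosh x * (1 + 5 / 12 * (1 / x)) - -exp (-x) * (1 / 2) -
    (sinh x / x + 2 * exp (-x)) * (1 / 8))
  have hE := exp_pos x
  have hq := exp_pos (-(1 / 4))
  have hq1 : exp (-(1 / 4)) ≤ 1 := exp_le_one_iff.2 (by norm_num)
  have hneg0 := exp_pos (-x)
  set e := 1 / x with he
  have he0 : 0 < e := by positivity
  have he1 : e ≤ 1 := by rw [he, div_le_one hx0]; linarith
  have hee : e ≤ √e := by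
    rw [le_sqrt he0.le he0.le]; nlinarith
  have hneg : exp (-x) ≤ e * √e * exp x := by
    refine (exp_neg_le_sq_mul_exp hx0).trans ?_
    rw [← he, pow_two]
    gcongr
  have hM : |M - exp (-(1 / 4)) * exp x / 2 * (1 + 7 / (24 * x))| ≤ 2 * (e * √e * exp x) := by
    have h1 : M - exp (-(1 / 4)) * exp x / 2 * (1 + 7 / (24 * x)) =
        exp (-(1 / 4)) * (exp (-x) * (3 / 4 + 13 / 48 * e)) := by
      have h2 : sinh x / x = sinh x * e := by rw [he, mul_one_div]
      have h3 : 7 / (24 * x) = 7 / 24 * e := by rw [he]; field_simp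
      simp only [M]
      rw [h2, h3, cosh_eq, sinh_eq]
      ring
    rw [h1, abs_of_pos (by positivity)]
    refine (mul_le_of_le_one_left (by positivity) hq1).trans ?_
    nlinarith
  have hfin : |S - exp (-(1 / 4)) * exp x / 2 * (1 + 7 / (24 * x))| ≤
      (13 * C + 2) * (e * √e * exp x) := by
    have h1 := (abs_sub_le S M (exp (-(1 / 4)) * exp x / 2 * (1 + 7 / (24 * x)))).trans
      (add_le_add hdiff hM)
    have h2 := mul_le_mul_of_nonneg_left hs hC0
    linarith
  have hP : 0 < exp (-(1 / 4)) * exp x / 2 := by positivity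
  have h1 : S / (exp (-(1 / 4)) * exp x / 2) - (1 + 7 / (24 * x)) =
      (S - exp (-(1 / 4)) * exp x / 2 * (1 + 7 / (24 * x))) / (exp (-(1 / 4)) * exp x / 2) := by
    field_simp
  rw [h1, abs_div, abs_of_pos hP, div_le_iff₀ hP]
  refine hfin.trans (le_of_eq ?_)
  have h2 : exp (1 / 4) * exp (-(1 / 4)) = 1 := by rw [← exp_add]; norm_num
  linear_combination -(13 * C + 2) * (e * √e * exp x) * h2

end WeightedSum

/-! ### Asymptotics of the number of involutions -/

section Asymptotics

open Nat Real Filter Topology _root_.Asymptotics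

/-- The telescoped estimate for consecutive terms of the Stirling sequence. -/
theorem log_stirlingSeq_sub_le {n : ℕ} (hn : 0 < n) (j : ℕ) :
    log (Stirling.stirlingSeq n) - log (Stirling.stirlingSeq (n + j)) ≤
      1 / (12 * n) - 1 / (12 * (n + j : ℕ)) := by
  induction j with
  | zero => simp
  | succ j ih =>
    have h1 := Stirling.log_stirlingSeq_sdiff_le (n + j)
    have h2 : (0 : ℝ) < n + j := by positivity
    have h3 : (1 : ℝ) / (12 * (n + j : ℕ) * ((n + j : ℕ) + 1)) =
        1 / (12 * (n + j : ℕ)) - 1 / (12 * (n + (j + 1) : ℕ)) := by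
      push_cast
      field_simp
      ring
    rw [h3, add_assoc] at h1
    linarith

/-- Stirling's formula with an error term for `(2 * n)! / (2 ^ n * n !)`. -/
theorem abs_factorial_ratio_sub_one_le {n : ℕ} (hn : 0 < n) :
    |((2 * n)! / (2 ^ n * n !) : ℝ) / (√2 * (2 * n / exp 1) ^ n) - 1| ≤ 1 / n := by
  have hn' : (0 : ℝ) < n := by exact_mod_cast hn
  have hs : ∀ m : ℕ, 0 < m → 0 < Stirling.stirlingSeq m := by
    intro m hm
    obtain ⟨k, rfl⟩ := Nat.exists_eq_succ_of_ne_zero hm.ne'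
    exact Stirling.stirlingSeq'_pos k
  have hsn := hs n hn
  have hs2n := hs (2 * n) (by omega)
  have h1 : ((2 * n)! / (2 ^ n * n !) : ℝ) / (√2 * (2 * n / exp 1) ^ n) =
      Stirling.stirlingSeq (2 * n) / Stirling.stirlingSeq n := by
    have := Nat.factorial_pos (2 * n)
    have := Nat.factorial_pos n
    have h2 : √(2 * (2 * n : ℕ) : ℝ) = √2 * √(2 * n : ℝ) := by
      rw [← sqrt_mul (by norm_num)]; push_cast; ring_nf
    rw [Stirling.stirlingSeq, Stirling.stirlingSeq, h2]
    have h3 : 0 < √(2 * n : ℝ) := by positivity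
    have h4 : (2 * (n : ℝ) / exp 1) ^ n = 2 ^ n * (n / exp 1) ^ n := by
      rw [← mul_pow, mul_div_assoc]
    have h5 : ((2 * n : ℕ) / exp 1 : ℝ) ^ (2 * n) = (2 ^ n * (n / exp 1) ^ n) ^ 2 := by
      rw [← h4, ← pow_mul, mul_comm n 2]; push_cast; rfl
    have h6 : 0 < ((n : ℝ) / exp 1) ^ n := by positivity
    rw [h4, h5]
    generalize ((n : ℝ) / exp 1) ^ n = p at *
    field_simp
  rw [h1]
  -- the quotient is at most `1`, and its logarithm is at least `-1 / (12 * n)`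
  have h2 : Stirling.stirlingSeq (2 * n) ≤ Stirling.stirlingSeq n := by
    obtain ⟨k, rfl⟩ := Nat.exists_eq_succ_of_ne_zero hn.ne'
    exact Stirling.stirlingSeq'_antitone (by omega : k ≤ 2 * k + 1)
  have h3 := log_stirlingSeq_sub_le hn n
  rw [← two_mul] at h3
  have h4 : log (Stirling.stirlingSeq (2 * n) / Stirling.stirlingSeq n) ≤
      Stirling.stirlingSeq (2 * n) / Stirling.stirlingSeq n - 1 :=
    log_le_sub_one_of_pos (by positivity)
  rw [log_div hs2n.ne' hsn.ne'] at h4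
  have h5 : Stirling.stirlingSeq (2 * n) / Stirling.stirlingSeq n ≤ 1 := by
    rwa [div_le_one hsn]
  have h6 : (1 : ℝ) / (12 * n) ≤ 1 / n := by
    apply one_div_le_one_div_of_le hn'; linarith
  have h7 : (0 : ℝ) ≤ 1 / (12 * (2 * n : ℕ)) := by positivity
  rw [abs_le]
  constructor <;> linarith [show (0 : ℝ) ≤ 1 / n by positivity]

/-- The first-order approximation to the number of involutions of `2 * n` letters. -/
noncomputable def involutionApprox (n : ℕ) : ℝ :=
  (n : ℝ) ^ n * (2 : ℝ) ^ ((n : ℝ) - 1 / 2) * exp (-(n : ℝ) + √(2 * n) - 1 / 4)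

theorem involutionApprox_eq (n : ℕ) : involutionApprox n =
    (2 * n / exp 1) ^ n * (exp (√(2 * n) - 1 / 4) / √2) := by
  rw [involutionApprox, rpow_sub two_pos, rpow_natCast, ← sqrt_eq_rpow,
    show -(n : ℝ) + √(2 * n) - 1 / 4 = -(n * 1) + (√(2 * n) - 1 / 4) by ring, exp_add, exp_neg,
    exp_nat_mul, div_pow, mul_pow]
  field_simp

theorem exists_abs_numInvolutions_div_sub_le : ∃ C : ℝ, ∀ n : ℕ, 5000 ≤ n →
    |numInvolutions (2 * n) / involutionApprox n - (1 + 7 / (24 * √(2 * n)))| ≤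
      C * (1 / √(2 * n) * √(1 / √(2 * n))) := by
  obtain ⟨C, hC⟩ := exists_abs_numInvolutions_sub_le
  refine ⟨2 * C + 4, fun n hn => ?_⟩
  have hn0 : 0 < n := by omega
  have hn' : (5000 : ℝ) ≤ n := by exact_mod_cast hn
  set x := √(2 * n : ℝ) with hx
  have hxn : x ^ 2 = 2 * n := sq_sqrt (by positivity)
  have hx100 : 100 ≤ x := by
    rw [hx, le_sqrt (by norm_num) (by positivity)]; linarith
  have hx0 : 0 < x := by linarith
  have h1 := hC n x hx100 hxn
  have h2 := abs_factorial_ratio_sub_one_le hn0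
  set q : ℝ := ((2 * n)! / (2 ^ n * n !) : ℝ) / (√2 * (2 * n / exp 1) ^ n) with hq
  set T : ℝ := numInvolutions (2 * n) / ((2 * n)! / (2 ^ n * n !)) / (exp (-(1 / 4)) * exp x / 2)
    with hT
  have h3 : numInvolutions (2 * n) / involutionApprox n = q * T := by
    have := Nat.factorial_pos (2 * n)
    have := Nat.factorial_pos n
    have h4 : exp (x - 1 / 4) = exp (-(1 / 4)) * exp x := by rw [← exp_add]; ring_nf
    have h5 : (0 : ℝ) < (2 * n / exp 1) ^ n := by positivity
    have h6 : √(2 : ℝ) * √2 = 2 := mul_self_sqrt (by norm_num)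
    rw [involutionApprox_eq, hq, hT, ← hx, h4]
    generalize (2 * n / exp 1 : ℝ) ^ n = y at *
    field_simp
    linear_combination (numInvolutions (2 * n) : ℝ) * h6
  rw [h3]
  set e := 1 / x with he
  have he0 : 0 < e := by positivity
  have he1 : e ≤ 1 := by rw [he, div_le_one hx0]; linarith
  have hee : e ≤ √e := by
    rw [le_sqrt he0.le he0.le]; nlinarith
  have hA : 7 / (24 * x) = 7 / 24 * e := by rw [he]; field_simp
  have hne : (1 : ℝ) / n = 2 * (e * e) := by
    rw [he, show (n : ℝ) = x ^ 2 / 2 by linarith]; field_simp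
  have hn1 : (1 : ℝ) / n ≤ 1 := by
    rw [div_le_one (by linarith)]; linarith
  rw [hA] at h1 ⊢
  have h4 : q * T - (1 + 7 / 24 * e) = q * (T - (1 + 7 / 24 * e)) + (q - 1) * (1 + 7 / 24 * e) := by
    ring
  have h5 : |q| ≤ 2 := by
    have := abs_le.1 h2
    rw [abs_le]; constructor <;> linarith
  rw [h4]
  refine (abs_add_le _ _).trans ?_
  rw [abs_mul, abs_mul, abs_of_pos (by positivity : 0 < 1 + 7 / 24 * e)]
  have h6 : |q| * |T - (1 + 7 / 24 * e)| ≤ 2 * (C * (e * √e)) :=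
    mul_le_mul h5 h1 (abs_nonneg _) zero_le_two
  have h7 : |q - 1| * (1 + 7 / 24 * e) ≤ 2 * (e * e) * 2 := by
    rw [← hne]
    exact mul_le_mul h2 (by linarith) (by positivity) (by positivity)
  have h8 : e * e ≤ e * √e := by gcongr
  linarith

theorem tendsto_sqrt_two_mul_atTop : Tendsto (fun n : ℕ => √(2 * n : ℝ)) atTop atTop :=
  tendsto_sqrt_atTop.comp (tendsto_natCast_atTop_atTop.const_mul_atTop two_pos)

theorem isLittleO_numInvolutions :
    (fun n : ℕ => (numInvolutions (2 * n) : ℝ) / involutionApprox n -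
      (1 + 7 / (24 * √(2 * n)))) =o[atTop] (fun n : ℕ => 1 / √n) := by
  obtain ⟨C, hC⟩ := exists_abs_numInvolutions_div_sub_le
  have h1 : (fun n : ℕ => (numInvolutions (2 * n) : ℝ) / involutionApprox n -
      (1 + 7 / (24 * √(2 * n)))) =O[atTop] (fun n : ℕ => 1 / √(2 * n : ℝ) * √(1 / √(2 * n))) := by
    refine IsBigO.of_bound C ?_
    filter_upwards [eventually_ge_atTop 5000] with n hn
    rw [norm_eq_abs, norm_eq_abs, abs_of_nonneg (by positivity : 0 ≤ 1 / √(2 * n : ℝ) * _)]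
    exact hC n hn
  refine h1.trans_isLittleO ?_
  have h2 : (fun n : ℕ => 1 / √(2 * n : ℝ)) =O[atTop] (fun n : ℕ => 1 / √(n : ℝ)) := by
    refine IsBigO.of_bound (1 / √2) (Eventually.of_forall fun n => ?_)
    rw [sqrt_mul zero_le_two, norm_of_nonneg (by positivity), norm_of_nonneg (by positivity),
      one_div_mul_one_div]
  have h3 : (fun n : ℕ => √(1 / √(2 * n : ℝ))) =o[atTop] (fun _ : ℕ => (1 : ℝ)) := by
    rw [isLittleO_one_iff, ← Real.sqrt_zero]
    refine (continuous_sqrt.tendsto 0).comp ?_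
    simp only [one_div]
    exact tendsto_inv_atTop_zero.comp tendsto_sqrt_two_mul_atTop
  simpa only [mul_one] using h2.mul_isLittleO h3

theorem tendsto_correction :
    Tendsto (fun n : ℕ => 1 + 7 / (24 * √(2 * n : ℝ))) atTop (𝓝 1) := by
  have h : Tendsto (fun n : ℕ => 7 / (24 * √(2 * n : ℝ))) atTop (𝓝 0) :=
    (tendsto_sqrt_two_mul_atTop.const_mul_atTop (by norm_num)).const_div_atTop 7
  simpa using h.const_add 1

theorem tendsto_numInvolutions_div :
    Tendsto (fun n : ℕ => (numInvolutions (2 * n) : ℝ) / involutionApprox n) atTop (𝓝 1) := by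
  have h1 : Tendsto (fun n : ℕ => (1 : ℝ) / √n) atTop (𝓝 0) := by
    simp only [one_div]
    exact tendsto_inv_atTop_zero.comp (tendsto_sqrt_atTop.comp tendsto_natCast_atTop_atTop)
  have h2 := (isLittleO_numInvolutions.isBigO.trans_tendsto h1).add tendsto_correction
  simpa using h2

theorem involutionApprox_pos {n : ℕ} (hn : 0 < n) : 0 < involutionApprox n := by
  have : (0 : ℝ) < n := by exact_mod_cast hn
  rw [involutionApprox]
  positivity

theorem isEquivalent_numInvolutions :
    (fun n : ℕ => (numInvolutions (2 * n) : ℝ)) ~[atTop]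
      (fun n : ℕ => involutionApprox n * (1 + 7 / (24 * √(2 * n)))) := by
  refine isEquivalent_of_tendsto_one ?_
  have h := tendsto_numInvolutions_div.div tendsto_correction one_ne_zero
  rw [div_one] at h
  refine h.congr fun n => ?_
  simp only [Pi.div_apply]
  rw [div_div]

theorem isEquivalent_numInvolutions_root :
    (fun n : ℕ => (numInvolutions (2 * n) : ℝ) ^ (1 / (n : ℝ))) ~[atTop]
      (fun n : ℕ => 2 / exp 1 * n) := by
  refine isEquivalent_of_tendsto_one ?_
  have hlog : Tendsto (fun n : ℕ => (√(2 * n : ℝ) - 1 / 4 - log √2 +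
      log (numInvolutions (2 * n) / involutionApprox n)) * (1 / n)) atTop (𝓝 0) := by
    have h0 : Tendsto (fun n : ℕ => (1 : ℝ) / n) atTop (𝓝 0) :=
      tendsto_one_div_atTop_nhds_zero_nat
    have h1 : Tendsto (fun n : ℕ => √(2 * n : ℝ) * (1 / n)) atTop (𝓝 0) := by
      have h2 : Tendsto (fun n : ℕ => 2 / √(2 * n : ℝ)) atTop (𝓝 0) :=
        tendsto_sqrt_two_mul_atTop.const_div_atTop 2
      refine h2.congr' ?_
      filter_upwards [eventually_gt_atTop 0] with n hn
      have hn' : (0 : ℝ) < n := by exact_mod_cast hn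
      have h3 : 0 < √(2 * n : ℝ) := by positivity
      rw [div_eq_iff h3.ne', mul_right_comm, mul_self_sqrt (by positivity)]
      field_simp
    have h2 : Tendsto (fun n : ℕ => log (numInvolutions (2 * n) / involutionApprox n)) atTop
        (𝓝 0) := by
      rw [← log_one]
      exact (continuousAt_log one_ne_zero).tendsto.comp tendsto_numInvolutions_div
    have h3 := (h1.sub (h0.const_mul (1 / 4 + log √2))).add (h2.mul h0)
    simp only [mul_zero, sub_zero, add_zero] at h3
    refine h3.congr fun n => ?_
    ring
  have h1 := (continuous_exp.tendsto 0).comp hlog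
  rw [exp_zero] at h1
  refine h1.congr' ?_
  have hev : ∀ᶠ n : ℕ in atTop, 0 < (numInvolutions (2 * n) : ℝ) / involutionApprox n :=
    tendsto_numInvolutions_div.eventually (lt_mem_nhds one_pos)
  filter_upwards [hev, eventually_gt_atTop 0] with n hR hn
  have hn' : (0 : ℝ) < n := by exact_mod_cast hn
  have hG := involutionApprox_pos hn
  set R : ℝ := numInvolutions (2 * n) / involutionApprox n with hRdef
  have hb : (numInvolutions (2 * n) : ℝ) =
      (2 * n / exp 1) ^ n * (exp (√(2 * n) - 1 / 4) / √2 * R) := by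
    rw [← mul_assoc, ← involutionApprox_eq, hRdef, mul_div_cancel₀ _ hG.ne']
  have hy : 0 < exp (√(2 * n) - 1 / 4) / √2 * R := by positivity
  rw [Pi.div_apply, hb, mul_rpow (by positivity) hy.le, one_div (n : ℝ),
    pow_rpow_inv_natCast (by positivity) hn.ne', rpow_def_of_pos hy, log_mul (by positivity) hR.ne',
    log_div (by positivity) (by positivity), log_exp]
  simp only [Function.comp_apply, one_div, ← hRdef]
  field_simp

end Asymptotics

/-! ### The number of summands and its growth -/

theorem mainTheorem6 (t : ℂ) (ht : ∀ z : ℤ, t ≠ z) :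
    (∀ m : ℕ, Finite (SymIrrep m) ∧
      cd m = Nat.card {σ : Equiv.Perm (Fin m) // σ * σ = 1}) ∧
    ∃ b : ℕ → ℕ,
      (∀ n m : ℕ, IsSumOfIndecomposables ((OrientedBrauer.toKar ℂ t).obj
        ((OrientedBrauer.upDown ℂ t).tensorPow n)) m ↔ m = b n) ∧
      (∀ n : ℕ, b n =
        ∑ k ∈ Finset.range (n + 1), cd k ^ 2 * n.choose k ^ 2 * (n - k).factorial) ∧
      (∀ n : ℕ, b n = cd (2 * n)) ∧
      Asymptotics.IsEquivalent Filter.atTop (fun n : ℕ => (b n : ℝ)) (fun n : ℕ =>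
        (n : ℝ) ^ n * (2 : ℝ) ^ ((n : ℝ) - 1 / 2) *
          Real.exp (-(n : ℝ) + Real.sqrt (2 * n) - 1 / 4) *
            (1 + 7 / (24 * Real.sqrt (2 * n)))) ∧
      Asymptotics.IsLittleO Filter.atTop (fun n : ℕ =>
        (b n : ℝ) / ((n : ℝ) ^ n * (2 : ℝ) ^ ((n : ℝ) - 1 / 2) *
          Real.exp (-(n : ℝ) + Real.sqrt (2 * n) - 1 / 4)) -
            (1 + 7 / (24 * Real.sqrt (2 * n))))
        (fun n : ℕ => 1 / Real.sqrt n) ∧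
      Asymptotics.IsEquivalent Filter.atTop (fun n : ℕ => (b n : ℝ) ^ (1 / (n : ℝ)))
        (fun n : ℕ => 2 / Real.exp 1 * n) := by
  have hcd : ∀ m, cd m = numInvolutions m := cd_eq_card_involutions
  refine ⟨fun m => ⟨finite_symIrrep m, cd_eq_card_involutions m⟩, fun n => numInvolutions (2 * n),
    fun n m => OrientedBrauer.isSumOfIndecomposables_tensorPow_iff ht n m, fun n => ?_,
    fun n => (hcd _).symm, isEquivalent_numInvolutions, isLittleO_numInvolutions,
    isEquivalent_numInvolutions_root⟩
  simp only [hcd]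
  exact numInvolutions_two_mul n
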